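/- Let $n\ge 2$, let $\Omega\subset\mathbb{R}^n$ be a bounded domain with $C^2$ boundary $\Gamma=\partial\Omega$, let $\nu$ be the outward unit normal on $\Gamma$ and $\sigma$ the $(n-1)$-dimensional surface measure on $\Gamma$. Let $\rho\in C^2(\Gamma)$, $\rho>0$, and for $\varepsilon>0$ put $$\Sigma_\varepsilon=\{\xi+t\,\nu(\xi):\ \xi\in\Gamma,\ 0<t<\varepsilon\rho(\xi)\},\qquad \Omega_\varepsilon=\Omega\cup\Gamma\cup\Sigma_\varepsilon .$$ Let $1<p<\infty$ and $u\in C^{1,\alpha}(\overline\Omega)$ for some $\alpha\in(0,1)$. (A) Let $\varepsilon_0>0$ and $C>0$, and for each $\varepsilon\in(0,\varepsilon_0)$ let $\tilde u_\varepsilon\in W^{1,p}(\Omega\cup\Sigma_\varepsilon)$ satisfy $\tilde u_\varepsilon=u$ in $\Omega$ and $|\nabla\tilde u_\varepsilon|\le C$ almost everywhere in $\Sigma_\varepsilon$, with $C$ independent of $\varepsilon$. Then $$\int_{\Sigma_\varepsilon}|\nabla\tilde u_\varepsilon|^p\,dx=O(\varepsilon)\quad\text{as }\varepsilon\to0^+,$$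 and for every $\varepsilon\in(0,\varepsilon_0)$ one has $|\Sigma_\varepsilon|<\infty$ and $\int_{\Sigma_\varepsilon}|\nabla\tilde u_\varepsilon|^p\,dx\le C^p|\Sigma_\varepsilon|$. (B) For all sufficiently small $\varepsilon>0$ the affine extension $$\tilde u_\varepsilon=u\ \text{ in }\Omega,\qquad \tilde u_\varepsilon(\xi+t\,\nu(\xi))=u(\xi)\Bigl(1-\frac{t}{\varepsilon\rho(\xi)}\Bigr)\quad(\xi\in\Gamma,\ 0<t<\varepsilon\rho(\xi))$$ is well defined and belongs to $W^{1,p}(\Omega\cup\Sigma_\varepsilon)$, and it vanishes on the outer boundary: $\tilde u_\varepsilon(x)\to0$ as $x\to y$, $x\in\Sigma_\varepsilon$, for every $y\in\partial\Omega_\varepsilon$. The function $|u|^p\rho^{1-p}$ is $\sigma$-integrable on $\Gamma$, and $$\int_{\Sigma_\varepsilon}\varepsilon^{p-1}|\nabla\tilde u_\varepsilon|^p\,dx=\int_\Gamma\frac{|u(\xi)|^p}{\rho(\xi)^{p-1}}\,d\sigma(\xi)+O(\varepsilon)\quad\text{as }\varepsilon\to0^+;$$ in particular the left-hand side equals $\int_\Gamma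 |u|^p\rho^{1-p}\,d\sigma+o(1)$. Here $\nabla$ is the weak gradient. -/

import Mathlib

open Set Filter Topology MeasureTheory Asymptotics
open scoped NNReal ENNReal ContDiff RealInnerProductSpace

noncomputable section

namespace ThinCoating

/-- `φ` is a local `C²` defining function, on the open neighbourhood `U` of `ξ`, of the set `Ω`:
it is negative exactly at the points of `U` that belong to `Ω`, and has no critical point. -/
structure IsDefiningFunction {n : ℕ} (Ω : Set (EuclideanSpace ℝ (Fin n)))
    (ξ : EuclideanSpace ℝ (Fin n)) (U : Set (EuclideanSpace ℝ (Fin n)))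
    (φ : EuclideanSpace ℝ (Fin n) → ℝ) : Prop where
  isOpen : IsOpen U
  mem : ξ ∈ U
  contDiffOn : ContDiffOn ℝ 2 φ U
  gradient_ne_zero : ∀ x ∈ U, gradient φ x ≠ 0
  inter_eq : Ω ∩ U = {x ∈ U | φ x < 0}

/-- The boundary of `Ω` is of class `C²`, with `Ω` locally on one side of it. -/
def HasC2Boundary {n : ℕ} (Ω : Set (EuclideanSpace ℝ (Fin n))) : Prop :=
  ∀ ξ ∈ frontier Ω, ∃ U φ, IsDefiningFunction Ω ξ U φ

/-- `v` is the outward unit normal of `Ω` at its boundary point `ξ`: the normalized gradient of a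
local defining function (any of them, see `IsOuterUnitNormal.unique`). -/
def IsOuterUnitNormal {n : ℕ} (Ω : Set (EuclideanSpace ℝ (Fin n)))
    (ξ v : EuclideanSpace ℝ (Fin n)) : Prop :=
  ∃ U φ, IsDefiningFunction Ω ξ U φ ∧ v = ‖gradient φ ξ‖⁻¹ • gradient φ ξ

/-- The outward unit normal `ν_Γ(ξ)` of `Ω` at a boundary point `ξ`. -/
def outerNormal {n : ℕ} (Ω : Set (EuclideanSpace ℝ (Fin n))) (ξ : EuclideanSpace ℝ (Fin n)) :
    EuclideanSpace ℝ (Fin n) :=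
  Classical.epsilon (IsOuterUnitNormal Ω ξ)

/-- The layer `Σ_ε = {ξ + t ν_Γ(ξ) : ξ ∈ Γ, 0 < t < ε ρ(ξ)}` attached to `Γ = ∂Ω`. -/
def layer {n : ℕ} (Ω : Set (EuclideanSpace ℝ (Fin n))) (ρ : EuclideanSpace ℝ (Fin n) → ℝ)
    (ε : ℝ) : Set (EuclideanSpace ℝ (Fin n)) :=
  {x | ∃ ξ ∈ frontier Ω, ∃ t : ℝ, 0 < t ∧ t < ε * ρ ξ ∧ x = ξ + t • outerNormal Ω ξ}

/-- The coated domain `Ω_ε = Ω ∪ Σ_ε ∪ Γ`. -/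
def coatedDomain {n : ℕ} (Ω : Set (EuclideanSpace ℝ (Fin n))) (ρ : EuclideanSpace ℝ (Fin n) → ℝ)
    (ε : ℝ) : Set (EuclideanSpace ℝ (Fin n)) :=
  Ω ∪ layer Ω ρ ε ∪ frontier Ω

/-- `u ∈ C^{1,α}(closure Ω)`: `u` is continuous on the closure, differentiable in `Ω`, and its
gradient extends to an `α`-Hölder continuous vector field on the closure. -/
def IsC1Holder {n : ℕ} (Ω : Set (EuclideanSpace ℝ (Fin n))) (α : ℝ≥0)
    (u : EuclideanSpace ℝ (Fin n) → ℝ) : Prop :=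
  ContinuousOn u (closure Ω) ∧
    ∃ G : EuclideanSpace ℝ (Fin n) → EuclideanSpace ℝ (Fin n),
      (∀ x ∈ Ω, HasGradientAt u (G x) x) ∧ ∃ C : ℝ≥0, HolderOnWith C α G (closure Ω)

/-- `G` is the weak gradient of `f` on the open set `U`. -/
structure HasWeakGradient {n : ℕ} (U : Set (EuclideanSpace ℝ (Fin n)))
    (f : EuclideanSpace ℝ (Fin n) → ℝ)
    (G : EuclideanSpace ℝ (Fin n) → EuclideanSpace ℝ (Fin n)) : Prop where
  locallyIntegrableOn : LocallyIntegrableOn f U volume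
  locallyIntegrableOn_gradient : LocallyIntegrableOn G U volume
  integral_eq : ∀ φ : EuclideanSpace ℝ (Fin n) → ℝ, ContDiff ℝ ∞ φ → HasCompactSupport φ →
    tsupport φ ⊆ U → ∀ v : EuclideanSpace ℝ (Fin n),
      ∫ x in U, f x * fderiv ℝ φ x v = - ∫ x in U, ⟪G x, v⟫ * φ x

/-- `f ∈ W^{1,p}(U)`, with weak gradient `∇f = G`. -/
structure MemW1p {n : ℕ} (U : Set (EuclideanSpace ℝ (Fin n))) (p : ℝ)
    (f : EuclideanSpace ℝ (Fin n) → ℝ)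
    (G : EuclideanSpace ℝ (Fin n) → EuclideanSpace ℝ (Fin n)) : Prop where
  memLp : MemLp f (ENNReal.ofReal p) (volume.restrict U)
  memLp_gradient : MemLp G (ENNReal.ofReal p) (volume.restrict U)
  hasWeakGradient : HasWeakGradient U f G

/-- `w` is the affine extension of `u` to `Ω ∪ Σ_ε`: it equals `u` in `Ω`, and
`u(ξ) (1 - t / (ε ρ(ξ)))` at the point `ξ + t ν_Γ(ξ)` of the layer. -/
def IsAffineExtension {n : ℕ} (Ω : Set (EuclideanSpace ℝ (Fin n)))
    (ρ u : EuclideanSpace ℝ (Fin n) → ℝ) (ε : ℝ) (w : EuclideanSpace ℝ (Fin n) → ℝ) : Prop :=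
  EqOn w u Ω ∧ ∀ ξ ∈ frontier Ω, ∀ t : ℝ, 0 < t → t < ε * ρ ξ →
    w (ξ + t • outerNormal Ω ξ) = u ξ * (1 - t / (ε * ρ ξ))

/-- A defining function vanishes at the boundary point. -/
theorem IsDefiningFunction.eq_zero {n : ℕ} {Ω U : Set (EuclideanSpace ℝ (Fin n))}
    {ξ : EuclideanSpace ℝ (Fin n)} {φ : EuclideanSpace ℝ (Fin n) → ℝ}
    (h : IsDefiningFunction Ω ξ U φ) (hΩ : IsOpen Ω) (hξ : ξ ∈ frontier Ω) : φ ξ = 0 := by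
  have hU : U ∈ 𝓝 ξ := h.isOpen.mem_nhds h.mem
  have hc : ContinuousAt φ ξ := h.contDiffOn.continuousOn.continuousAt hU
  have hnot : ξ ∉ Ω := by
    rw [hΩ.frontier_eq] at hξ
    exact hξ.2
  refine le_antisymm ?_ ?_
  · by_contra! hpos
    have h1 : ∀ᶠ x in 𝓝 ξ, 0 < φ x := hc.eventually (lt_mem_nhds hpos)
    obtain ⟨y, ⟨hy1, hy2⟩, hy3⟩ :=
      (mem_closure_iff_nhds.1 (frontier_subset_closure hξ) _ (inter_mem h1 hU))
    have : y ∈ {x ∈ U | φ x < 0} := h.inter_eq ▸ ⟨hy3, hy2⟩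
    exact absurd this.2 (not_lt.2 (le_of_lt hy1))
  · by_contra! hneg
    have : ξ ∈ Ω ∩ U := h.inter_eq ▸ ⟨h.mem, hneg⟩
    exact hnot this.1

/-- Along a direction `d`, a defining function has the sign of `⟪∇φ(ξ), d⟫`. -/
theorem IsDefiningFunction.hasDerivAt {n : ℕ} {Ω U : Set (EuclideanSpace ℝ (Fin n))}
    {ξ : EuclideanSpace ℝ (Fin n)} {φ : EuclideanSpace ℝ (Fin n) → ℝ}
    (h : IsDefiningFunction Ω ξ U φ) (d : EuclideanSpace ℝ (Fin n)) :
    HasDerivAt (fun t : ℝ => φ (ξ + t • d)) ⟪gradient φ ξ, d⟫ 0 := by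
  have hd : DifferentiableAt ℝ φ ξ :=
    (h.contDiffOn.differentiableOn (by norm_num)).differentiableAt (h.isOpen.mem_nhds h.mem)
  have h1 : HasFDerivAt φ (InnerProductSpace.toDual ℝ _ (gradient φ ξ)) (ξ + (0 : ℝ) • d) := by
    simpa using hd.hasGradientAt.hasFDerivAt
  have h2 : HasDerivAt (fun t : ℝ => ξ + t • d) d 0 := by
    simpa using ((hasDerivAt_id (0 : ℝ)).smul_const d).const_add ξ
  have h3 := h1.comp_hasDerivAt (0 : ℝ) h2
  rw [InnerProductSpace.toDual_apply_apply] at h3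
  exact h3

/-- The outward unit normal does not depend on the defining function. -/
theorem IsOuterUnitNormal.unique {n : ℕ} {Ω : Set (EuclideanSpace ℝ (Fin n))}
    {ξ v w : EuclideanSpace ℝ (Fin n)} (hΩ : IsOpen Ω) (hξ : ξ ∈ frontier Ω)
    (hv : IsOuterUnitNormal Ω ξ v) (hw : IsOuterUnitNormal Ω ξ w) : v = w := by
  obtain ⟨U, φ, hφ, rfl⟩ := hv
  obtain ⟨V, ψ, hψ, rfl⟩ := hw
  have ha := norm_pos_iff.2 (hφ.gradient_ne_zero ξ hφ.mem)
  have hb := norm_pos_iff.2 (hψ.gradient_ne_zero ξ hψ.mem)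
  set a := gradient φ ξ with haa
  set b := gradient ψ ξ with hbb
  set v := ‖a‖⁻¹ • a with hv
  set w := ‖b‖⁻¹ • b with hw
  have hv1 : ‖v‖ = 1 := by rw [hv, norm_smul, norm_inv, norm_norm, inv_mul_cancel₀ ha.ne']
  have hw1 : ‖w‖ = 1 := by rw [hw, norm_smul, norm_inv, norm_norm, inv_mul_cancel₀ hb.ne']
  by_contra hne
  have hlt : ⟪v, w⟫ < 1 := (inner_lt_one_iff_real_of_norm_eq_one hv1 hw1).2 hne
  have hav : a = ‖a‖ • v := by rw [hv, smul_smul, mul_inv_cancel₀ ha.ne', one_smul]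
  have hbw : b = ‖b‖ • w := by rw [hw, smul_smul, mul_inv_cancel₀ hb.ne', one_smul]
  have h1 : ⟪a, w - v⟫ < 0 := by
    rw [hav, real_inner_smul_left, inner_sub_right, real_inner_self_eq_norm_sq, hv1]
    exact mul_neg_of_pos_of_neg ha (by linarith)
  have h2 : 0 < ⟪b, w - v⟫ := by
    rw [hbw, real_inner_smul_left, inner_sub_right, real_inner_self_eq_norm_sq, hw1,
      real_inner_comm]
    exact mul_pos hb (by linarith)
  have hline : Tendsto (fun t : ℝ => ξ + t • (w - v)) (𝓝[>] 0) (𝓝 ξ) := by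
    have : Continuous fun t : ℝ => ξ + t • (w - v) := by fun_prop
    simpa using (this.tendsto 0).mono_left nhdsWithin_le_nhds
  have e1 : ∀ᶠ t in 𝓝[>] (0 : ℝ), φ (ξ + t • (w - v)) < 0 := by
    have := (hφ.hasDerivAt (w - v)).hasDerivWithinAt (s := Ioi 0)
    rw [hasDerivWithinAt_iff_tendsto_slope' (by simp)] at this
    filter_upwards [this.eventually (gt_mem_nhds h1), self_mem_nhdsWithin] with t ht ht0
    have ht0 : 0 < t := ht0
    simp only [slope, sub_zero, zero_smul, add_zero, hφ.eq_zero hΩ hξ, vsub_eq_sub,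
      smul_eq_mul] at ht
    by_contra! hc
    exact absurd ht (not_lt.2 (mul_nonneg (inv_pos.2 ht0).le hc))
  have e2 : ∀ᶠ t in 𝓝[>] (0 : ℝ), 0 < ψ (ξ + t • (w - v)) := by
    have := (hψ.hasDerivAt (w - v)).hasDerivWithinAt (s := Ioi 0)
    rw [hasDerivWithinAt_iff_tendsto_slope' (by simp)] at this
    filter_upwards [this.eventually (lt_mem_nhds h2), self_mem_nhdsWithin] with t ht ht0
    have ht0 : 0 < t := ht0
    simp only [slope, sub_zero, zero_smul, add_zero, hψ.eq_zero hΩ hξ, vsub_eq_sub,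
      smul_eq_mul] at ht
    exact (mul_pos_iff_of_pos_left (inv_pos.2 ht0)).1 ht
  obtain ⟨t, ht1, ht2, ht3, ht4⟩ := (e1.and (e2.and
    ((hline.eventually (hφ.isOpen.mem_nhds hφ.mem)).and
      (hline.eventually (hψ.isOpen.mem_nhds hψ.mem))))).exists
  have m1 : ξ + t • (w - v) ∈ Ω ∩ U := hφ.inter_eq ▸ ⟨ht3, ht1⟩
  have m2 : ξ + t • (w - v) ∈ {x ∈ V | ψ x < 0} := hψ.inter_eq ▸ ⟨m1.1, ht4⟩
  exact absurd m2.2 (not_lt.2 ht2.le)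

theorem outerNormal_spec {n : ℕ} {Ω : Set (EuclideanSpace ℝ (Fin n))} (h : HasC2Boundary Ω)
    {ξ : EuclideanSpace ℝ (Fin n)} (hξ : ξ ∈ frontier Ω) :
    IsOuterUnitNormal Ω ξ (outerNormal Ω ξ) := by
  obtain ⟨U, φ, hφ⟩ := h ξ hξ
  exact Classical.epsilon_spec (p := IsOuterUnitNormal Ω ξ) ⟨_, U, φ, hφ, rfl⟩

end ThinCoating

end

/-! Near Γ every point is uniquely x = π(x) + d(x) ν(π(x)), with π, d and ν∘π of class C¹
(`exists_isTube`). In these coordinates the affine extension is u(π) (1 - d / (ε ρ(π))). Since ∇d =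
ν∘π and 0 < d/ε < ρ(π) in the layer, its gradient is -u/(ερ) ν plus a term bounded uniformly in ε:
only the derivative falling on d leaves an uncompensated factor 1/ε
(`exists_gradient_affineProfile_bound`). Hence ε|∇w| = |u|/ρ + O(ε), and the same holds for p-th
powers because t ↦ t^p is Lipschitz on bounded intervals. As the layer has volume O(ε), the scaled
energy is ε⁻¹ ∫ g∘π + O(ε) with g = (|u|/ρ)^p, and everything reduces to the first-order tube
formula ∫ g∘π = ε ∫ ρ g dσ + O(ε²) over the layer (`exists_integral_slice_sub_le`).

The tube formula is obtained from Lipschitz maps instead of Jacobians. Around a boundary point, Γ is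
flattened and the normal tube straightened by maps whose derivative at the point is the identity.
They and their inverses are L-Lipschitz nearby for any L > 1, so very thin slices of the tube have
the expected volume up to a power of L (`exists_local_volume_bounds`), uniformly along Γ by
compactness. A slice of width s is cut into N thin slices. Moving one onto another along the normals
costs a factor at most (1 + Cs)^n (`exists_volume_shift_le`). With N large and then L → 1, only the
factor 1 + O(s) remains (`exists_volume_slice_bounds`). These bounds hold over every Borel part of
Γ, so they compare measures and may be integrated.

The set Ω ∪ Σ_ε is open and omits Γ, so the extension is classically differentiable on all of it
with bounded gradient. This is then the weak gradient, and any other weak gradient agrees with it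
almost everywhere. Part (A) only needs |Σ_ε| = O(ε). -/

noncomputable section

namespace ThinCoating

/-! ### Classical and weak gradients -/

section WeakGradient

variable {n : ℕ}

/-- A function that is differentiable at every point of an open set, with locally integrable
gradient, has this gradient as its weak gradient. -/
theorem hasWeakGradient_of_hasGradientAt {U : Set (EuclideanSpace ℝ (Fin n))} (hU : IsOpen U)
    {f : EuclideanSpace ℝ (Fin n) → ℝ} {G : EuclideanSpace ℝ (Fin n) → EuclideanSpace ℝ (Fin n)}
    (hG : LocallyIntegrableOn G U volume) (hf : ∀ x ∈ U, HasGradientAt f (G x) x) :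
    HasWeakGradient U f G := by
  have hfc : ContinuousOn f U := fun x hx => (hf x hx).continuousAt.continuousWithinAt
  refine ⟨hfc.locallyIntegrableOn hU.measurableSet, hG, ?_⟩
  intro φ hφ hφc hφU v
  have hφ0 : ∀ x, x ∉ U → φ x = 0 := fun x hx => image_eq_zero_of_notMem_tsupport (fun h => hx (hφU h))
  have hdφ0 : ∀ x, x ∉ U → fderiv ℝ φ x = 0 := fun x hx =>
    image_eq_zero_of_notMem_tsupport (f := fderiv ℝ φ)
      (fun h => hx (hφU (tsupport_fderiv_subset ℝ h)))
  set g : EuclideanSpace ℝ (Fin n) → ℝ := fun x => f x * φ x with hg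
  have hgd : ∀ x ∈ U, HasFDerivAt (𝕜 := ℝ) g (f x • fderiv ℝ φ x + φ x • InnerProductSpace.toDual ℝ (EuclideanSpace ℝ (Fin n)) (G x)) x := by
    intro x hx
    exact (hf x hx).hasFDerivAt.mul ((hφ.differentiable (by simp)) x).hasFDerivAt
  have hg0 : ∀ x, x ∉ tsupport φ → HasFDerivAt (𝕜 := ℝ) g 0 x := by
    intro x hx
    have : g =ᶠ[𝓝 x] fun _ => 0 := by
      have h1 : φ =ᶠ[𝓝 x] 0 := notMem_tsupport_iff_eventuallyEq.1 hx
      filter_upwards [h1] with y hy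
      simp [hg, hy]
    exact (hasFDerivAt_const (0:ℝ) x).congr_of_eventuallyEq this
  have hgdiff : Differentiable ℝ g := by
    intro x
    by_cases hx : x ∈ U
    · exact (hgd x hx).differentiableAt
    · exact (hg0 x (fun h => hx (hφU h))).differentiableAt
  have hgc : HasCompactSupport g := hφc.mul_left
  have hgi : Integrable g volume := hgdiff.continuous.integrable_of_hasCompactSupport hgc
  have hfd : ∀ x, fderiv ℝ g x v = f x * fderiv ℝ φ x v + ⟪G x, v⟫ * φ x := by
    intro x
    by_cases hx : x ∈ U
    · rw [(hgd x hx).fderiv]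
      simp [mul_comm]
    · rw [(hg0 x (fun h => hx (hφU h))).fderiv, hφ0 x hx, hdφ0 x hx]
      simp
  have hK : IsCompact (tsupport φ) := hφc
  have i1 : Integrable (fun x => f x * fderiv ℝ φ x v) volume := by
    have hc : ContinuousOn (fun x => f x * fderiv ℝ φ x v) (tsupport φ) := by
      refine (hfc.mono hφU).mul ?_
      exact ((hφ.continuous_fderiv (by simp)).clm_apply continuous_const).continuousOn
    refine (hc.integrableOn_compact hK).integrable_of_forall_notMem_eq_zero ?_
    intro x hx
    have : fderiv ℝ φ x = 0 := image_eq_zero_of_notMem_tsupport fun h => hx (tsupport_fderiv_subset ℝ h)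
    simp [this]
  have i2 : Integrable (fun x => ⟪G x, v⟫ * φ x) volume := by
    have h1 : IntegrableOn G (tsupport φ) volume := hG.integrableOn_compact_subset hφU hK
    have h2 : IntegrableOn (fun x => ⟪G x, v⟫) (tsupport φ) volume := h1.inner_const v
    have h3 : IntegrableOn (fun x => ⟪G x, v⟫ * φ x) (tsupport φ) volume :=
      h2.mul_continuousOn hφ.continuous.continuousOn hK
    refine h3.integrable_of_forall_notMem_eq_zero ?_
    intro x hx
    simp [image_eq_zero_of_notMem_tsupport hx]
  -- Integration by parts against the constant 1. It needs differentiability everywhere and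
  -- integrability only, so the gradient of `f` need not be continuous.
  have hzero : ∫ x, fderiv ℝ g x v = 0 := by
    have h := integral_mul_fderiv_eq_neg_fderiv_mul_of_integrable (μ := volume) (f := fun _ => (1:ℝ))
      (g := g) (v := v) (by simp) (by simp only [one_mul, hfd]; exact i1.add i2) (by simpa using hgi)
      (fun x _ => differentiableAt_const _) (fun x _ => hgdiff x)
    simpa using h
  have e1 : ∫ x in U, f x * fderiv ℝ φ x v = ∫ x, f x * fderiv ℝ φ x v := by
    refine setIntegral_eq_integral_of_forall_compl_eq_zero fun x hx => ?_
    simp [hdφ0 x hx]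
  have e2 : ∫ x in U, ⟪G x, v⟫ * φ x = ∫ x, ⟪G x, v⟫ * φ x := by
    refine setIntegral_eq_integral_of_forall_compl_eq_zero fun x hx => ?_
    simp [hφ0 x hx]
  rw [e1, e2]
  have : ∫ x, fderiv ℝ g x v = (∫ x, f x * fderiv ℝ φ x v) + ∫ x, ⟪G x, v⟫ * φ x := by
    rw [← integral_add i1 i2]
    exact integral_congr_ae (Eventually.of_forall hfd)
  linarith

/-- The weak gradient on an open set is unique up to null sets. -/
theorem HasWeakGradient.ae_eq {U : Set (EuclideanSpace ℝ (Fin n))} (hU : IsOpen U)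
    {f : EuclideanSpace ℝ (Fin n) → ℝ} {G H : EuclideanSpace ℝ (Fin n) → EuclideanSpace ℝ (Fin n)}
    (hG : HasWeakGradient U f G) (hH : HasWeakGradient U f H) : ∀ᵐ x ∂volume, x ∈ U → G x = H x := by
  have hli : LocallyIntegrableOn (fun x => G x - H x) U volume :=
    hG.locallyIntegrableOn_gradient.sub hH.locallyIntegrableOn_gradient
  have key := hU.ae_eq_zero_of_integral_contDiff_smul_eq_zero hli ?_
  · filter_upwards [key] with x hx hxU using sub_eq_zero.1 (hx hxU)
  intro φ hφ hφc hφU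
  have hint : ∀ K : EuclideanSpace ℝ (Fin n) → EuclideanSpace ℝ (Fin n), LocallyIntegrableOn K U volume →
      Integrable (fun x => φ x • K x) volume := by
    intro K hK
    have h1 : IntegrableOn K (tsupport φ) volume := hK.integrableOn_compact_subset hφU hφc
    have h3 : IntegrableOn (fun x => φ x • K x) (tsupport φ) volume :=
      h1.continuousOn_smul hφ.continuous.continuousOn hφc
    refine h3.integrable_of_forall_notMem_eq_zero ?_
    intro x hx
    simp [image_eq_zero_of_notMem_tsupport hx]
  -- Pairing the vector integral with a fixed `v` gives the right-hand side of the weak-gradient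
  -- identity, whose left-hand side involves `f` alone; so the integrals for `G` and `H` coincide.
  have hcomp : ∀ K : EuclideanSpace ℝ (Fin n) → EuclideanSpace ℝ (Fin n), LocallyIntegrableOn K U volume →
      ∀ v, ⟪∫ x, φ x • K x, v⟫ = ∫ x in U, ⟪K x, v⟫ * φ x := by
    intro K hK v
    rw [real_inner_comm, ← integral_inner (hint K hK)]
    rw [setIntegral_eq_integral_of_forall_compl_eq_zero]
    · refine integral_congr_ae (Eventually.of_forall fun x => ?_)
      simp only [inner_smul_right, real_inner_comm v]
      ring
    · intro x hx
      rw [image_eq_zero_of_notMem_tsupport (fun h => hx (hφU h)), mul_zero]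
  simp_rw [smul_sub]
  rw [integral_sub (hint G hG.locallyIntegrableOn_gradient) (hint H hH.locallyIntegrableOn_gradient)]
  rw [sub_eq_zero]
  refine ext_inner_right ℝ fun v => ?_
  rw [hcomp G hG.locallyIntegrableOn_gradient, hcomp H hH.locallyIntegrableOn_gradient]
  have h1 := hG.integral_eq φ hφ hφc hφU v
  have h2 := hH.integral_eq φ hφ hφc hφU v
  linarith

end WeakGradient

/-! ### Hausdorff measure under Lipschitz maps, and volumes of cylinders -/

section Volume

variable {X Y : Type*} [EMetricSpace X] [MeasurableSpace X] [BorelSpace X]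
  [EMetricSpace Y] [MeasurableSpace Y] [BorelSpace Y]

theorem _root_.LipschitzOnWith.euclideanHausdorffMeasure_image_le {K : ℝ≥0} {f : X → Y} {s : Set X}
    (h : LipschitzOnWith K f s) (d : ℕ) :
    Measure.euclideanHausdorffMeasure d (f '' s) ≤ (K : ℝ≥0∞) ^ d * Measure.euclideanHausdorffMeasure d s := by
  simp only [Measure.euclideanHausdorffMeasure_def, Measure.smul_apply, ENNReal.smul_def, smul_eq_mul]
  have := h.hausdorffMeasure_image_le (d := d) (by positivity)
  rw [ENNReal.rpow_natCast] at this
  rw [mul_left_comm]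
  gcongr

/-- Lebesgue measure is the normalized n-dimensional Hausdorff measure, so neither injectivity of
the map nor measurability of the set is required. This stands in for the change of variables formula
throughout. -/
theorem _root_.LipschitzOnWith.volume_image_le {n : ℕ} {K : ℝ≥0}
    {f : EuclideanSpace ℝ (Fin n) → EuclideanSpace ℝ (Fin n)} {s : Set (EuclideanSpace ℝ (Fin n))}
    (h : LipschitzOnWith K f s) : volume (f '' s) ≤ (K : ℝ≥0∞) ^ n * volume s := by
  have := h.euclideanHausdorffMeasure_image_le n
  rwa [EuclideanSpace.euclideanHausdorffMeasure_eq_volume] at this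

/-- The volume of a right cylinder over a set in a hyperplane. -/
theorem volume_cylinder {n : ℕ} {e ξ₀ : EuclideanSpace ℝ (Fin n)} (he : ‖e‖ = 1)
    {A : Set (EuclideanSpace ℝ (Fin n))} (hA : ∀ a ∈ A, ⟪e, a - ξ₀⟫ = 0) (I : Set ℝ) :
    volume {z | ∃ a ∈ A, ∃ t ∈ I, z = a + t • e} =
      Measure.euclideanHausdorffMeasure (n - 1) A * volume I := by
  set s : Submodule ℝ (EuclideanSpace ℝ (Fin n)) := (ℝ ∙ e)ᗮ with hs
  have he0 : e ≠ 0 := by rintro rfl; simp at he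
  have hn1 : 1 ≤ n := by
    rcases Nat.eq_zero_or_pos n with rfl | h
    · exact absurd (Subsingleton.elim e 0) he0
    · exact h
  have hfr : Module.finrank ℝ s = n - 1 := by
    have h1 := Submodule.finrank_add_finrank_orthogonal (ℝ ∙ e)
    rw [finrank_span_singleton he0, finrank_euclideanSpace_fin, ← hs] at h1
    omega
  have hmp := s.measurePreserving_measurableEquivProd ξ₀
  have hvol : (Measure.euclideanHausdorffMeasure (Module.finrank ℝ (EuclideanSpace ℝ (Fin n))) :
      Measure (EuclideanSpace ℝ (Fin n))) = volume := InnerProductSpace.euclideanHausdorffMeasure_eq_volume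
  rw [hvol] at hmp
  have hemem : e ∈ sᗮ := by
    rw [hs, Submodule.orthogonal_orthogonal]; exact Submodule.mem_span_singleton_self e
  set e' : sᗮ := ⟨e, hemem⟩ with he'
  set A' : Set s := (fun a : s => ξ₀ + (a : EuclideanSpace ℝ (Fin n))) ⁻¹' A with hA'
  set I' : Set sᗮ := (fun t : ℝ => t • e') '' I with hI'
  have hset : {z | ∃ a ∈ A, ∃ t ∈ I, z = a + t • e} = s.measurableEquivProd ξ₀ ⁻¹' (A' ×ˢ I') := by
    ext z
    rw [← MeasurableEquiv.image_symm]
    simp only [mem_ofPred_eq, mem_image, Prod.exists, mem_prod, hA', hI', mem_preimage,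
      Submodule.measurableEquivProd_symm_apply, vadd_eq_add]
    constructor
    · rintro ⟨a, ha, t, ht, rfl⟩
      refine ⟨⟨a - ξ₀, ?_⟩, t • e', ⟨by simpa using ha, t, ht, rfl⟩, ?_⟩
      · rw [hs, Submodule.mem_orthogonal_singleton_iff_inner_right]; exact hA a ha
      · simp only [he', SetLike.mk_smul_mk]; abel
    · rintro ⟨a, b, ⟨ha, t, ht, rfl⟩, rfl⟩
      refine ⟨_, ha, t, ht, ?_⟩
      simp only [he', SetLike.mk_smul_mk]; abel
  -- Measurable equivalences and the product formula handle arbitrary sets, hence no measurability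
  -- of `A` or `I`.
  rw [hset, hmp.measure_preimage_equiv, Measure.volume_eq_prod, Measure.prod_prod]
  congr 1
  · have hi : Isometry (fun a : s => ξ₀ + (a : EuclideanSpace ℝ (Fin n))) := by
      refine Isometry.of_dist_eq fun a b => ?_
      simp [dist_eq_norm]
    have h1 := hi.euclideanHausdorffMeasure_preimage (d := n - 1) A
    have hr : A ∩ range (fun a : s => ξ₀ + (a : EuclideanSpace ℝ (Fin n))) = A := by
      refine inter_eq_left.2 fun a ha => ⟨⟨a - ξ₀, ?_⟩, by simp⟩
      rw [hs, Submodule.mem_orthogonal_singleton_iff_inner_right]; exact hA a ha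
    rw [hr] at h1
    rw [← h1, ← hfr, InnerProductSpace.euclideanHausdorffMeasure_eq_volume]
  · have hi : Isometry (fun t : ℝ => t • e') := by
      refine Isometry.of_dist_eq fun a b => ?_
      have : ‖e'‖ = 1 := he
      rw [dist_eq_norm, ← sub_smul, norm_smul, this, mul_one, Real.dist_eq, Real.norm_eq_abs]
    have h1 := hi.euclideanHausdorffMeasure_image (d := 1) I
    have hf1 : Module.finrank ℝ sᗮ = 1 := by
      rw [hs, Submodule.orthogonal_orthogonal, finrank_span_singleton he0]
    have e1 : (Measure.euclideanHausdorffMeasure 1 : Measure sᗮ) = volume := by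
      rw [← hf1]; exact InnerProductSpace.euclideanHausdorffMeasure_eq_volume
    have e2 : (Measure.euclideanHausdorffMeasure 1 : Measure ℝ) = volume := by
      rw [← Module.finrank_self ℝ]; exact InnerProductSpace.euclideanHausdorffMeasure_eq_volume
    rw [e1, e2] at h1
    exact h1

end Volume

/-! ### Defining functions and the normal field -/

section DefiningFunction

variable {n : ℕ} {Ω U : Set (EuclideanSpace ℝ (Fin n))} {ξ₀ x : EuclideanSpace ℝ (Fin n)}
  {φ : EuclideanSpace ℝ (Fin n) → ℝ}

/-- The normalized gradient of a function. -/
def unitGradient (φ : EuclideanSpace ℝ (Fin n) → ℝ) (x : EuclideanSpace ℝ (Fin n)) :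
    EuclideanSpace ℝ (Fin n) :=
  ‖gradient φ x‖⁻¹ • gradient φ x

theorem IsDefiningFunction.of_mem (h : IsDefiningFunction Ω ξ₀ U φ) (hx : x ∈ U) :
    IsDefiningFunction Ω x U φ :=
  ⟨h.isOpen, hx, h.contDiffOn, h.gradient_ne_zero, h.inter_eq⟩

/-- By uniqueness, the normal picked by choice at each point is given on a whole boundary patch by
one formula, which is C¹. -/
theorem IsDefiningFunction.outerNormal_eq (h : IsDefiningFunction Ω ξ₀ U φ) (hΩ : IsOpen Ω)
    (hxU : x ∈ U) (hx : x ∈ frontier Ω) : outerNormal Ω x = unitGradient φ x := by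
  have h1 : IsOuterUnitNormal Ω x (unitGradient φ x) := ⟨U, φ, h.of_mem hxU, rfl⟩
  exact IsOuterUnitNormal.unique hΩ hx (Classical.epsilon_spec (p := IsOuterUnitNormal Ω x) ⟨_, h1⟩) h1

theorem IsDefiningFunction.norm_unitGradient (h : IsDefiningFunction Ω ξ₀ U φ) (hxU : x ∈ U) :
    ‖unitGradient φ x‖ = 1 := by
  have := norm_pos_iff.2 (h.gradient_ne_zero x hxU)
  rw [unitGradient, norm_smul, norm_inv, norm_norm, inv_mul_cancel₀ this.ne']

theorem norm_outerNormal (hΩ : IsOpen Ω) (h : HasC2Boundary Ω) (hx : x ∈ frontier Ω) :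
    ‖outerNormal Ω x‖ = 1 := by
  obtain ⟨U, φ, hφ⟩ := h x hx
  rw [hφ.outerNormal_eq hΩ hφ.mem hx, hφ.norm_unitGradient hφ.mem]

theorem IsDefiningFunction.mem_iff (h : IsDefiningFunction Ω ξ₀ U φ) (hxU : x ∈ U) :
    x ∈ Ω ↔ φ x < 0 := by
  have : x ∈ Ω ∩ U ↔ x ∈ {x ∈ U | φ x < 0} := by rw [h.inter_eq]
  simpa [hxU] using this

/-- At a zero of `φ`, moving along `-∇φ ≠ 0` makes `φ` negative at once, so the zero is a limit of
points of `Ω`. -/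
theorem IsDefiningFunction.mem_frontier_iff (h : IsDefiningFunction Ω ξ₀ U φ) (hΩ : IsOpen Ω)
    (hxU : x ∈ U) : x ∈ frontier Ω ↔ φ x = 0 := by
  refine ⟨(h.of_mem hxU).eq_zero hΩ, fun h0 => ?_⟩
  rw [hΩ.frontier_eq]
  refine ⟨?_, fun hx => ?_⟩
  · have hg := h.gradient_ne_zero x hxU
    set d := -gradient φ x with hd
    have hneg : ⟪gradient φ x, d⟫ < 0 := by
      rw [hd, inner_neg_right, real_inner_self_eq_norm_sq]
      have := norm_pos_iff.2 hg
      nlinarith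
    have := ((h.of_mem hxU).hasDerivAt d).hasDerivWithinAt (s := Ioi 0)
    rw [hasDerivWithinAt_iff_tendsto_slope' (by simp)] at this
    have hline : Tendsto (fun t : ℝ => x + t • d) (𝓝[>] 0) (𝓝 x) := by
      have : Continuous fun t : ℝ => x + t • d := by fun_prop
      simpa using (this.tendsto 0).mono_left nhdsWithin_le_nhds
    refine mem_closure_of_tendsto hline ?_
    filter_upwards [this.eventually (gt_mem_nhds hneg), self_mem_nhdsWithin,
      hline.eventually (h.isOpen.mem_nhds hxU)] with t ht ht0 htU
    have ht0 : 0 < t := ht0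
    simp only [slope, sub_zero, zero_smul, add_zero, h0, vsub_eq_sub, smul_eq_mul] at ht
    rw [h.mem_iff htU]
    by_contra! hc
    exact absurd ht (not_lt.2 (mul_nonneg (inv_pos.2 ht0).le hc))
  · exact absurd ((h.mem_iff hxU).1 hx) (by simp [h0])

theorem IsDefiningFunction.contDiffOn_unitGradient (h : IsDefiningFunction Ω ξ₀ U φ) :
    ContDiffOn ℝ 1 (unitGradient φ) U := by
  have h1 : ContDiffOn ℝ 1 (fderiv ℝ φ) U :=
    h.contDiffOn.fderiv_of_isOpen h.isOpen (by norm_num)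
  have h2 : ContDiffOn ℝ 1 (gradient φ) U :=
    ((InnerProductSpace.toDual ℝ (EuclideanSpace ℝ (Fin n))).symm.contDiff).comp_contDiffOn h1
  exact (((h2.norm ℝ h.gradient_ne_zero).inv fun x hx => norm_ne_zero_iff.2 (h.gradient_ne_zero x hx)).smul h2)

end DefiningFunction

/-! ### Local inversion with identity derivative -/

section InverseFunction

variable {E : Type*} [NormedAddCommGroup E] [NormedSpace ℝ E] [CompleteSpace E]

/-- The inverse function theorem at a fixed point where the derivative is the identity. -/
theorem exists_openPartialHomeomorph_of_hasFDerivAt_id {f : E → E} {a : E} {k : WithTop ℕ∞}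
    (hk : k ≠ 0) (hf : ContDiffAt ℝ k f a) (hf' : HasFDerivAt f (ContinuousLinearMap.id ℝ E) a)
    (ha : f a = a) {U : Set E} (hU : IsOpen U) (haU : a ∈ U) :
    ∃ F : OpenPartialHomeomorph E E, ⇑F = f ∧ a ∈ F.source ∧ F.source ⊆ U ∧ a ∈ F.target ∧
      F.symm a = a ∧ ContDiffAt ℝ k F.symm a ∧
      HasStrictFDerivAt f (ContinuousLinearMap.id ℝ E) a ∧
      HasStrictFDerivAt F.symm (ContinuousLinearMap.id ℝ E) a := by
  have hf'' : HasFDerivAt f ((ContinuousLinearEquiv.refl ℝ E : E ≃L[ℝ] E) : E →L[ℝ] E) a := hf'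
  set F₀ := hf.toOpenPartialHomeomorph f hf'' hk with hF₀
  have hcoe : ⇑F₀ = f := hf.toOpenPartialHomeomorph_coe hf'' hk
  have hs : a ∈ F₀.source := hf.mem_toOpenPartialHomeomorph_source hf'' hk
  set F := F₀.restrOpen U hU with hF
  have hFc : ⇑F = f := by rw [← hcoe]; rfl
  have hFs : F.source = F₀.source ∩ U := F₀.restrOpen_source U hU
  have haF : a ∈ F.source := by rw [hFs]; exact ⟨hs, haU⟩
  have haT : a ∈ F.target := by
    have := F.map_source haF
    rwa [hFc, ha] at this
  have hsym : F.symm a = a := by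
    have := F.left_inv haF
    rwa [hFc, ha] at this
  have hcd : ContDiffAt ℝ k F.symm a := by
    refine F.contDiffAt_symm (f₀' := ContinuousLinearEquiv.refl ℝ E) haT ?_ ?_
    · rw [hsym, hFc]; exact hf''
    · rw [hsym, hFc]; exact hf
  have hst : HasStrictFDerivAt f (ContinuousLinearMap.id ℝ E) a := hf.hasStrictFDerivAt' hf' hk
  refine ⟨F, hFc, haF, ?_, haT, hsym, hcd, hst, ?_⟩
  · rw [hFs]; exact inter_subset_right
  · have := F.hasStrictFDerivAt_symm (f' := ContinuousLinearEquiv.refl ℝ E) haT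
      (by rw [hsym, hFc]; exact hst)
    exact this

end InverseFunction

/-! ### Flattening the boundary and straightening the normal tube -/

section Straightening

variable {n : ℕ}

/-- The orthogonal projection onto the hyperplane through `ξ₀` normal to `e`. -/
def hyperplaneProj (e ξ₀ z : EuclideanSpace ℝ (Fin n)) : EuclideanSpace ℝ (Fin n) :=
  z - ⟪e, z - ξ₀⟫ • e

/-- `F` straightens `Ω` near its boundary point `ξ₀`, and `Ψ` carries the straight cylinder over the
tangent hyperplane to the normal tube. -/
structure IsStraightening (Ω : Set (EuclideanSpace ℝ (Fin n))) (ξ₀ : EuclideanSpace ℝ (Fin n))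
    (F Ψ : OpenPartialHomeomorph (EuclideanSpace ℝ (Fin n)) (EuclideanSpace ℝ (Fin n))) : Prop where
  mem_source : ξ₀ ∈ F.source
  mem_target : ξ₀ ∈ F.target
  apply_self : F ξ₀ = ξ₀
  symm_apply_self : F.symm ξ₀ = ξ₀
  hasStrictFDerivAt : HasStrictFDerivAt F (ContinuousLinearMap.id ℝ _) ξ₀
  hasStrictFDerivAt_symm : HasStrictFDerivAt F.symm (ContinuousLinearMap.id ℝ _) ξ₀
  contDiffAt_symm : ContDiffAt ℝ 2 F.symm ξ₀
  mem_frontier_iff : ∀ x ∈ F.source, x ∈ frontier Ω ↔ ⟪outerNormal Ω ξ₀, F x - ξ₀⟫ = 0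
  mem_iff : ∀ x ∈ F.source, x ∈ Ω ↔ ⟪outerNormal Ω ξ₀, F x - ξ₀⟫ < 0
  tube_mem_source : ξ₀ ∈ Ψ.source
  tube_mem_target : ξ₀ ∈ Ψ.target
  tube_apply_self : Ψ ξ₀ = ξ₀
  tube_symm_apply_self : Ψ.symm ξ₀ = ξ₀
  tube_hasStrictFDerivAt : HasStrictFDerivAt Ψ (ContinuousLinearMap.id ℝ _) ξ₀
  tube_hasStrictFDerivAt_symm : HasStrictFDerivAt Ψ.symm (ContinuousLinearMap.id ℝ _) ξ₀
  tube_contDiffAt_symm : ContDiffAt ℝ 1 Ψ.symm ξ₀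
  tube_apply : ∀ᶠ z in 𝓝 ξ₀, F.symm (hyperplaneProj (outerNormal Ω ξ₀) ξ₀ z) ∈ frontier Ω ∧
    Ψ z = F.symm (hyperplaneProj (outerNormal Ω ξ₀) ξ₀ z) + ⟪outerNormal Ω ξ₀, z - ξ₀⟫ •
      outerNormal Ω (F.symm (hyperplaneProj (outerNormal Ω ξ₀) ξ₀ z))

theorem contDiff_inner_sub (e ξ₀ : EuclideanSpace ℝ (Fin n)) {k : WithTop ℕ∞} :
    ContDiff ℝ k fun z : EuclideanSpace ℝ (Fin n) => ⟪e, z - ξ₀⟫ :=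
  contDiff_const.inner ℝ (contDiff_id.sub contDiff_const)

theorem contDiff_hyperplaneProj (e ξ₀ : EuclideanSpace ℝ (Fin n)) {k : WithTop ℕ∞} :
    ContDiff ℝ k (hyperplaneProj e ξ₀) := by
  exact contDiff_id.sub ((contDiff_inner_sub e ξ₀).smul contDiff_const)

theorem inner_hyperplaneProj {e : EuclideanSpace ℝ (Fin n)} (he : ‖e‖ = 1)
    (ξ₀ z : EuclideanSpace ℝ (Fin n)) : ⟪e, hyperplaneProj e ξ₀ z - ξ₀⟫ = 0 := by
  have : hyperplaneProj e ξ₀ z - ξ₀ = (z - ξ₀) - ⟪e, z - ξ₀⟫ • e := by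
    rw [hyperplaneProj]; abel
  rw [this, inner_sub_right, inner_smul_right, real_inner_self_eq_norm_sq, he]
  ring

theorem hyperplaneProj_self (e ξ₀ : EuclideanSpace ℝ (Fin n)) : hyperplaneProj e ξ₀ ξ₀ = ξ₀ := by
  simp [hyperplaneProj]

theorem hyperplaneProj_add {e ξ₀ z : EuclideanSpace ℝ (Fin n)} (he : ‖e‖ = 1)
    (hz : ⟪e, z - ξ₀⟫ = 0) (t : ℝ) :
    ⟪e, z + t • e - ξ₀⟫ = t ∧ hyperplaneProj e ξ₀ (z + t • e) = z := by
  have h1 : ⟪e, z + t • e - ξ₀⟫ = t := by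
    have : z + t • e - ξ₀ = (z - ξ₀) + t • e := by abel
    rw [this, inner_add_right, hz, inner_smul_right, real_inner_self_eq_norm_sq, he]
    ring
  refine ⟨h1, ?_⟩
  rw [hyperplaneProj, h1]
  abel

/-- `F` replaces the coordinate along the normal `e` by the rescaled defining function. `Ψ` sends a
point of the tangent hyperplane to Γ by the inverse of `F` and turns the height over the hyperplane
into distance along the normal. Both derivatives at `ξ₀` are the identity. `Ψ` is only C¹, since the
normal of a C² boundary is only C¹. -/
theorem exists_isStraightening {Ω : Set (EuclideanSpace ℝ (Fin n))} (hΩ : IsOpen Ω)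
    (hC2 : HasC2Boundary Ω) {ξ₀ : EuclideanSpace ℝ (Fin n)} (hξ₀ : ξ₀ ∈ frontier Ω) :
    ∃ F Ψ, IsStraightening Ω ξ₀ F Ψ := by
  obtain ⟨U, φ, hφ⟩ := hC2 ξ₀ hξ₀
  have hgpos := norm_pos_iff.2 (hφ.gradient_ne_zero ξ₀ hφ.mem)
  have heν := hφ.outerNormal_eq hΩ hφ.mem hξ₀
  set e := outerNormal Ω ξ₀ with he_def
  have he : ‖e‖ = 1 := norm_outerNormal hΩ hC2 hξ₀
  have hU : U ∈ 𝓝 ξ₀ := hφ.isOpen.mem_nhds hφ.mem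
  have hφ0 : φ ξ₀ = 0 := hφ.eq_zero hΩ hξ₀
  -- This scaling turns the gradient of `c * φ` at `ξ₀` into `e`, so that the correction term in `f`
  -- has zero derivative there.
  set c := ‖gradient φ ξ₀‖⁻¹ with hc
  have hcpos : 0 < c := inv_pos.2 hgpos
  set f : EuclideanSpace ℝ (Fin n) → EuclideanSpace ℝ (Fin n) :=
    fun x => x + (c * φ x - ⟪e, x - ξ₀⟫) • e with hf
  have hfself : f ξ₀ = ξ₀ := by simp [hf, hφ0]
  have hφat : ContDiffAt ℝ 2 φ ξ₀ := hφ.contDiffOn.contDiffAt hU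
  have hfc : ContDiffAt ℝ 2 f ξ₀ := by
    exact contDiffAt_id.add (((contDiffAt_const.mul hφat).sub
      (contDiff_inner_sub e ξ₀).contDiffAt).smul contDiffAt_const)
  have hφd : HasFDerivAt φ (InnerProductSpace.toDual ℝ (EuclideanSpace ℝ (Fin n)) (gradient φ ξ₀)) ξ₀ :=
    (hφat.differentiableAt (by norm_num)).hasGradientAt.hasFDerivAt
  have hinner : ∀ x, HasFDerivAt (fun x => ⟪e, x - ξ₀⟫)
      (InnerProductSpace.toDual ℝ (EuclideanSpace ℝ (Fin n)) e) x := by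
    intro x
    have h1 : HasFDerivAt (fun x => x - ξ₀) (ContinuousLinearMap.id ℝ (EuclideanSpace ℝ (Fin n))) x :=
      (hasFDerivAt_id x).sub_const ξ₀
    exact (InnerProductSpace.toDual ℝ (EuclideanSpace ℝ (Fin n)) e).hasFDerivAt.comp x h1
  have hfd : HasFDerivAt f (ContinuousLinearMap.id ℝ (EuclideanSpace ℝ (Fin n))) ξ₀ := by
    have h1 := (hasFDerivAt_id (𝕜 := ℝ) ξ₀).add (((hφd.const_mul c).sub (hinner ξ₀)).smul_const e)
    refine h1.congr_fderiv ?_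
    have h2 : c • InnerProductSpace.toDual ℝ (EuclideanSpace ℝ (Fin n)) (gradient φ ξ₀) -
        InnerProductSpace.toDual ℝ (EuclideanSpace ℝ (Fin n)) e = 0 := by
      rw [heν, unitGradient, map_smulₛₗ]
      simp [hc]
    rw [h2]
    simp
  obtain ⟨F, hFf, hFs, hFU, hFt, hFsym, hFcd, hFst, hFst'⟩ :=
    exists_openPartialHomeomorph_of_hasFDerivAt_id (by norm_num) hfc hfd hfself hφ.isOpen hφ.mem
  have hFe : ∀ x, ⟪e, F x - ξ₀⟫ = c * φ x := by
    intro x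
    rw [hFf]
    have : f x - ξ₀ = (x - ξ₀) + (c * φ x - ⟪e, x - ξ₀⟫) • e := by simp only [hf]; abel
    rw [this, inner_add_right, inner_smul_right, real_inner_self_eq_norm_sq, he]
    ring
  set P := hyperplaneProj e ξ₀ with hP
  have hPself : P ξ₀ = ξ₀ := hyperplaneProj_self e ξ₀
  have hPcd : ContDiff ℝ 1 P := contDiff_hyperplaneProj e ξ₀
  have hNcd : ContDiffAt ℝ 1 (unitGradient φ) ξ₀ := hφ.contDiffOn_unitGradient.contDiffAt hU
  set ψ := fun z => F.symm (P z) with hψ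
  have hψself : ψ ξ₀ = ξ₀ := by simp only [hψ, hPself, hFsym]
  have hψcd : ContDiffAt ℝ 1 ψ ξ₀ := by
    refine ContDiffAt.comp ξ₀ ?_ hPcd.contDiffAt
    rw [hPself]; exact hFcd.of_le (by norm_num)
  set g := fun z => ψ z + ⟪e, z - ξ₀⟫ • unitGradient φ (ψ z) with hg
  have hgself : g ξ₀ = ξ₀ := by simp [hg, hψself]
  have hNψ : ContDiffAt ℝ 1 (fun z => unitGradient φ (ψ z)) ξ₀ := by
    refine ContDiffAt.comp (g := unitGradient φ) ξ₀ ?_ hψcd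
    rw [hψself]; exact hNcd
  have hgcd : ContDiffAt ℝ 1 g ξ₀ := by
    have : ContDiffAt ℝ 1 (fun z : EuclideanSpace ℝ (Fin n) => ⟪e, z - ξ₀⟫) ξ₀ :=
      (contDiff_inner_sub e ξ₀).contDiffAt
    exact hψcd.add (this.smul hNψ)
  have hPd : HasFDerivAt P (ContinuousLinearMap.id ℝ _ -
      (InnerProductSpace.toDual ℝ (EuclideanSpace ℝ (Fin n)) e).smulRight e) ξ₀ :=
    (hasFDerivAt_id (𝕜 := ℝ) ξ₀).sub ((hinner ξ₀).smul_const e)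
  have hψd : HasFDerivAt ψ (ContinuousLinearMap.id ℝ _ -
      (InnerProductSpace.toDual ℝ (EuclideanSpace ℝ (Fin n)) e).smulRight e) ξ₀ := by
    have h1 : HasFDerivAt F.symm (ContinuousLinearMap.id ℝ _) (P ξ₀) := by
      rw [hPself]; exact hFst'.hasFDerivAt
    have h2 := h1.comp ξ₀ hPd
    rw [ContinuousLinearMap.id_comp] at h2
    exact h2
  -- The derivative of `ψ` is the projection off `e`; the product rule restores the missing
  -- component `⟪e, ·⟫ • e`, its other term vanishing because the height of `ξ₀` is zero.
  have hgd : HasFDerivAt g (ContinuousLinearMap.id ℝ (EuclideanSpace ℝ (Fin n))) ξ₀ := by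
    have h1 := hψd.add ((hinner ξ₀).smul (hNψ.differentiableAt (by norm_num)).hasFDerivAt)
    refine h1.congr_fderiv ?_
    simp only [hψself, ← heν, sub_self, inner_zero_right, zero_smul, zero_add]
    abel
  obtain ⟨Ψ, hΨg, hΨs, -, hΨt, hΨsym, hΨcd, hΨst, hΨst'⟩ :=
    exists_openPartialHomeomorph_of_hasFDerivAt_id (by norm_num) hgcd hgd hgself isOpen_univ (mem_univ ξ₀)
  have hfr : ∀ x ∈ F.source, x ∈ frontier Ω ↔ ⟪e, F x - ξ₀⟫ = 0 := fun x hx => by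
    rw [hFe, hφ.mem_frontier_iff hΩ (hFU hx)]
    simp [hcpos.ne']
  refine ⟨F, Ψ, hFs, hFt, by rw [hFf, hfself], hFsym, by rw [hFf]; exact hFst, hFst', hFcd,
    hfr, fun x hx => ?_, hΨs, hΨt, by rw [hΨg, hgself], hΨsym, by rw [hΨg]; exact hΨst,
    hΨst', hΨcd, ?_⟩
  · rw [hFe, hφ.mem_iff (hFU hx)]
    exact ⟨fun h => mul_neg_of_pos_of_neg hcpos h, fun h => by
      by_contra! h'; exact absurd h (not_lt.2 (mul_nonneg hcpos.le h'))⟩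
  · have h1 : ∀ᶠ z in 𝓝 ξ₀, P z ∈ F.target := by
      refine hPcd.continuous.continuousAt.eventually_mem ?_
      rw [hPself]
      exact F.open_target.mem_nhds hFt
    filter_upwards [h1] with z hz
    have h2 : F.symm (P z) ∈ F.source := F.map_target hz
    have h3 : F.symm (P z) ∈ frontier Ω := by
      rw [hfr _ h2, F.right_inv hz]
      exact inner_hyperplaneProj he ξ₀ z
    refine ⟨h3, ?_⟩
    rw [hφ.outerNormal_eq hΩ (hFU h2) h3, hΨg]

end Straightening

theorem tendsto_continuousLinearMap_comp {ι E F G : Type*} [NormedAddCommGroup E] [NormedSpace ℝ E]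
    [NormedAddCommGroup F] [NormedSpace ℝ F] [NormedAddCommGroup G] [NormedSpace ℝ G] {l : Filter ι}
    {A : ι → F →L[ℝ] G} {B : ι → E →L[ℝ] F} {a : F →L[ℝ] G} {b : E →L[ℝ] F}
    (hA : Tendsto A l (𝓝 a)) (hB : Tendsto B l (𝓝 b)) :
    Tendsto (fun i => (A i).comp (B i)) l (𝓝 (a.comp b)) :=
  ((isBoundedBilinearMap_comp (𝕜 := ℝ)).continuous.tendsto (a, b)).comp (hA.prodMk_nhds hB)

/-! ### Local normal coordinates, and the trace of u on the boundary -/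

section Local

variable {n : ℕ} {Ω : Set (EuclideanSpace ℝ (Fin n))} {ξ₀ : EuclideanSpace ℝ (Fin n)}

/-- The normal tube is the image under `Ψ` of the straight cylinder. -/
theorem IsStraightening.eventually_tube
    {F Ψ : OpenPartialHomeomorph (EuclideanSpace ℝ (Fin n)) (EuclideanSpace ℝ (Fin n))}
    (h : IsStraightening Ω ξ₀ F Ψ) (he : ‖outerNormal Ω ξ₀‖ = 1) :
    ∀ᶠ z : ℝ × EuclideanSpace ℝ (Fin n) in 𝓝 (0, ξ₀), z.2 ∈ frontier Ω →
      z.2 ∈ F.source ∧ ⟪outerNormal Ω ξ₀, F z.2 - ξ₀⟫ = 0 ∧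
      F z.2 + z.1 • outerNormal Ω ξ₀ ∈ Ψ.source ∧
      Ψ (F z.2 + z.1 • outerNormal Ω ξ₀) = z.2 + z.1 • outerNormal Ω z.2 := by
  set e := outerNormal Ω ξ₀
  have hF : ContinuousAt F ξ₀ := h.hasStrictFDerivAt.continuousAt
  have ht : Tendsto (fun z : ℝ × EuclideanSpace ℝ (Fin n) => F z.2 + z.1 • e) (𝓝 (0, ξ₀)) (𝓝 ξ₀) := by
    have h1 : ContinuousAt (fun z : ℝ × EuclideanSpace ℝ (Fin n) => F z.2 + z.1 • e) (0, ξ₀) := by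
      refine ContinuousAt.add ?_ (by fun_prop)
      exact ContinuousAt.comp (f := Prod.snd) (g := F) hF continuousAt_snd
    simpa [ContinuousAt, h.apply_self] using h1
  have hs : ∀ᶠ z : ℝ × EuclideanSpace ℝ (Fin n) in 𝓝 (0, ξ₀), z.2 ∈ F.source :=
    continuousAt_snd.eventually_mem (F.open_source.mem_nhds h.mem_source)
  filter_upwards [hs, ht.eventually h.tube_apply,
    ht.eventually (Ψ.open_source.mem_nhds h.tube_mem_source)] with z hz1 hz2 hz3 hzΓ
  have h0 := (h.mem_frontier_iff z.2 hz1).1 hzΓ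
  obtain ⟨e1, e2⟩ := hyperplaneProj_add he h0 z.1
  refine ⟨hz1, h0, hz3, ?_⟩
  rw [hz2.2, e1, e2, F.left_inv hz1]

/-- Injectivity of `Ψ` recovers the straight point `F ξ + t e`; its height is `t` and its projection
is `F ξ`. -/
theorem exists_nhds_injective (hΩ : IsOpen Ω) (hC2 : HasC2Boundary Ω) (hξ₀ : ξ₀ ∈ frontier Ω) :
    ∃ W ∈ 𝓝 ((0 : ℝ), ξ₀), ∀ z ∈ W, ∀ z' ∈ W, z.2 ∈ frontier Ω → z'.2 ∈ frontier Ω →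
      z.2 + z.1 • outerNormal Ω z.2 = z'.2 + z'.1 • outerNormal Ω z'.2 → z = z' := by
  obtain ⟨F, Ψ, h⟩ := exists_isStraightening hΩ hC2 hξ₀
  have he := norm_outerNormal hΩ hC2 hξ₀
  refine ⟨_, h.eventually_tube he, ?_⟩
  intro z hz z' hz' hΓ hΓ' heq
  obtain ⟨a1, a2, a3, a4⟩ := hz hΓ
  obtain ⟨b1, b2, b3, b4⟩ := hz' hΓ'
  have h1 : F z.2 + z.1 • outerNormal Ω ξ₀ = F z'.2 + z'.1 • outerNormal Ω ξ₀ :=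
    Ψ.injOn a3 b3 (by rw [a4, b4, heq])
  have ht : z.1 = z'.1 := by
    rw [← (hyperplaneProj_add he a2 z.1).1, ← (hyperplaneProj_add he b2 z'.1).1, h1]
  have hx : F z.2 = F z'.2 := by
    rw [← (hyperplaneProj_add he a2 z.1).2, ← (hyperplaneProj_add he b2 z'.1).2, h1]
  exact Prod.ext ht (F.injOn a1 b1 hx)

/-- Strict differentiability at `ξ₀` gives, uniformly for nearby boundary points, that `φ` at `ξ + t
ν(ξ)` is `t` times a quantity larger than a/2, up to an error a/4 |t|, where a = |∇φ(ξ₀)|. So `φ`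
has the sign of `t`. -/
theorem eventually_mem_iff_neg (hΩ : IsOpen Ω) (hC2 : HasC2Boundary Ω) (hξ₀ : ξ₀ ∈ frontier Ω) :
    ∀ᶠ z : ℝ × EuclideanSpace ℝ (Fin n) in 𝓝 (0, ξ₀), z.2 ∈ frontier Ω →
      (z.2 + z.1 • outerNormal Ω z.2 ∈ Ω ↔ z.1 < 0) := by
  obtain ⟨U, φ, hφ⟩ := hC2 ξ₀ hξ₀
  have hU : U ∈ 𝓝 ξ₀ := hφ.isOpen.mem_nhds hφ.mem
  have ha := norm_pos_iff.2 (hφ.gradient_ne_zero ξ₀ hφ.mem)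
  set a := ‖gradient φ ξ₀‖ with ha_def
  have hφat : ContDiffAt ℝ 2 φ ξ₀ := hφ.contDiffOn.contDiffAt hU
  have hst : HasStrictFDerivAt φ
      (InnerProductSpace.toDual ℝ (EuclideanSpace ℝ (Fin n)) (gradient φ ξ₀)) ξ₀ :=
    hφat.hasStrictFDerivAt' (hφat.differentiableAt (by norm_num)).hasGradientAt.hasFDerivAt (by norm_num)
  have hN : ContinuousAt (unitGradient φ) ξ₀ :=
    (hφ.contDiffOn_unitGradient.contDiffAt hU).continuousAt
  have hN2 : ContinuousAt (fun z : ℝ × EuclideanSpace ℝ (Fin n) => unitGradient φ z.2) (0, ξ₀) :=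
    ContinuousAt.comp (f := Prod.snd) (g := unitGradient φ) hN continuousAt_snd
  have hp : ContinuousAt (fun z : ℝ × EuclideanSpace ℝ (Fin n) => z.2 + z.1 • unitGradient φ z.2) (0, ξ₀) :=
    continuousAt_snd.add (continuousAt_fst.smul hN2)
  have hp1 : Tendsto (fun z : ℝ × EuclideanSpace ℝ (Fin n) => z.2 + z.1 • unitGradient φ z.2)
      (𝓝 (0, ξ₀)) (𝓝 ξ₀) := by simpa [ContinuousAt] using hp
  have hp2 : Tendsto (fun z : ℝ × EuclideanSpace ℝ (Fin n) => (z.2 + z.1 • unitGradient φ z.2, z.2))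
      (𝓝 (0, ξ₀)) (𝓝 (ξ₀, ξ₀)) := by
    rw [nhds_prod_eq (x := ξ₀)]
    exact hp1.prodMk (continuous_snd.tendsto ((0 : ℝ), ξ₀))
  have hO := hp2.eventually (hst.isLittleO.bound (show (0 : ℝ) < a / 4 by positivity))
  have hin : ∀ᶠ z : ℝ × EuclideanSpace ℝ (Fin n) in 𝓝 (0, ξ₀),
      a / 2 < ⟪gradient φ ξ₀, unitGradient φ z.2⟫ := by
    have hc : ContinuousAt (fun z : ℝ × EuclideanSpace ℝ (Fin n) => ⟪gradient φ ξ₀, unitGradient φ z.2⟫)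
        (0, ξ₀) := continuousAt_const.inner hN2
    refine hc.eventually (lt_mem_nhds ?_)
    simp only [unitGradient, inner_smul_right, real_inner_self_eq_norm_sq, ← ha_def]
    field_simp
    linarith
  filter_upwards [hO, hin, hp1.eventually hU,
    continuousAt_snd.eventually_mem hU] with z h1 h2 h3 h4 hzΓ
  rw [hφ.outerNormal_eq hΩ h4 hzΓ, hφ.mem_iff h3]
  have hz0 : φ z.2 = 0 := (hφ.mem_frontier_iff hΩ h4).1 hzΓ
  rw [hz0, add_sub_cancel_left, norm_smul, hφ.norm_unitGradient h4, mul_one, sub_zero,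
    InnerProductSpace.toDual_apply_apply, inner_smul_right, Real.norm_eq_abs, Real.norm_eq_abs] at h1
  set b := ⟪gradient φ ξ₀, unitGradient φ z.2⟫
  set w := φ (z.2 + z.1 • unitGradient φ z.2)
  rw [abs_le] at h1
  rcases lt_trichotomy z.1 0 with h | h | h
  · rw [abs_of_neg h] at h1
    refine iff_of_true ?_ h
    nlinarith [h1.2]
  · rw [h] at h1
    simp only [abs_zero, mul_zero, zero_mul, sub_zero] at h1
    refine iff_of_false ?_ (by simp [h])
    linarith [h1.1]
  · rw [abs_of_pos h] at h1
    refine iff_of_false ?_ (by linarith)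
    nlinarith [h1.1]

/-- The foot point is read off in straight coordinates: undo `Ψ`, drop the height, return to Γ by
the inverse of `F`. The dropped height is the signed distance. -/
theorem exists_local_projection (hΩ : IsOpen Ω) (hC2 : HasC2Boundary Ω) (hξ₀ : ξ₀ ∈ frontier Ω)
    {η : ℝ} (hη : 0 < η) :
    ∃ r > 0, ∃ q : EuclideanSpace ℝ (Fin n) → EuclideanSpace ℝ (Fin n),
      ContDiffOn ℝ 1 q (Metric.ball ξ₀ r) ∧
      ContDiffOn ℝ 1 (fun x => outerNormal Ω (q x)) (Metric.ball ξ₀ r) ∧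
      ∀ x ∈ Metric.ball ξ₀ r, q x ∈ frontier Ω ∧ ∃ t : ℝ, |t| < η ∧ x = q x + t • outerNormal Ω (q x) := by
  obtain ⟨F, Ψ, h⟩ := exists_isStraightening hΩ hC2 hξ₀
  obtain ⟨U, φ, hφ⟩ := hC2 ξ₀ hξ₀
  have hU : U ∈ 𝓝 ξ₀ := hφ.isOpen.mem_nhds hφ.mem
  set e := outerNormal Ω ξ₀
  set q : EuclideanSpace ℝ (Fin n) → EuclideanSpace ℝ (Fin n) :=
    fun x => F.symm (hyperplaneProj e ξ₀ (Ψ.symm x)) with hq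
  have hΨt : Tendsto Ψ.symm (𝓝 ξ₀) (𝓝 ξ₀) := by
    simpa [ContinuousAt, h.tube_symm_apply_self] using h.tube_contDiffAt_symm.continuousAt
  have hqself : q ξ₀ = ξ₀ := by
    simp only [hq, h.tube_symm_apply_self, hyperplaneProj_self, h.symm_apply_self]
  have hqcd : ContDiffAt ℝ 1 q ξ₀ := by
    have h1 : ContDiffAt ℝ 1 (fun x => hyperplaneProj e ξ₀ (Ψ.symm x)) ξ₀ :=
      (contDiff_hyperplaneProj e ξ₀).contDiffAt.comp ξ₀ h.tube_contDiffAt_symm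
    refine ContDiffAt.comp (g := F.symm) ξ₀ ?_ h1
    rw [h.tube_symm_apply_self, hyperplaneProj_self]
    exact h.contDiffAt_symm.of_le (by norm_num)
  have hqt : Tendsto q (𝓝 ξ₀) (𝓝 ξ₀) := by
    simpa [ContinuousAt, hqself] using hqcd.continuousAt
  have hin : ∀ᶠ x in 𝓝 ξ₀, |⟪e, Ψ.symm x - ξ₀⟫| < η := by
    have hc : Tendsto (fun x => |⟪e, Ψ.symm x - ξ₀⟫|) (𝓝 ξ₀) (𝓝 |⟪e, ξ₀ - ξ₀⟫|) :=
      ((((contDiff_inner_sub e ξ₀ (k := 1)).continuous.tendsto ξ₀).comp hΨt)).abs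
    refine hc.eventually (gt_mem_nhds ?_)
    simpa using hη
  have hev := (hqcd.eventually (by simp)).and ((hqt.eventually hU).and
    ((hΨt.eventually h.tube_apply).and ((Ψ.open_target.eventually_mem h.tube_mem_target).and hin)))
  obtain ⟨r, hr, hball⟩ := Metric.eventually_nhds_iff_ball.1 hev
  have hmain : ∀ x ∈ Metric.ball ξ₀ r, q x ∈ frontier Ω ∧ ∃ t : ℝ, |t| < η ∧ x = q x + t • outerNormal Ω (q x) := by
    intro x hx
    obtain ⟨-, -, h3, h4, h5⟩ := hball x hx
    refine ⟨h3.1, _, h5, ?_⟩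
    have := h3.2
    rwa [Ψ.right_inv h4] at this
  have hq1 : ContDiffOn ℝ 1 q (Metric.ball ξ₀ r) := fun x hx => (hball x hx).1.contDiffWithinAt
  refine ⟨r, hr, q, hq1, ?_, hmain⟩
  refine (hφ.contDiffOn_unitGradient.comp hq1 fun x hx => (hball x hx).2.1).congr fun x hx => ?_
  exact hφ.outerNormal_eq hΩ (hball x hx).2.1 (hmain x hx).1

/-- A function in `C¹(closure Ω)` is differentiable along the boundary, and the derivative is
the extended gradient. -/
theorem hasFDerivWithinAt_frontier (hΩ : IsOpen Ω) (hC2 : HasC2Boundary Ω) (hξ₀ : ξ₀ ∈ frontier Ω)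
    {u : EuclideanSpace ℝ (Fin n) → ℝ} (hu : ContinuousOn u (closure Ω))
    {G : EuclideanSpace ℝ (Fin n) → EuclideanSpace ℝ (Fin n)}
    (hG : ∀ x ∈ Ω, HasGradientAt u (G x) x) (hGc : ContinuousOn G (closure Ω)) :
    HasFDerivWithinAt u (InnerProductSpace.toDual ℝ (EuclideanSpace ℝ (Fin n)) (G ξ₀)) (frontier Ω) ξ₀ := by
  obtain ⟨F, Ψ, h⟩ := exists_isStraightening hΩ hC2 hξ₀
  have he := norm_outerNormal hΩ hC2 hξ₀
  set e := outerNormal Ω ξ₀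
  set J := InnerProductSpace.toDual ℝ (EuclideanSpace ℝ (Fin n)) with hJ
  have hev : ∀ᶠ z in 𝓝 ξ₀, z ∈ F.target ∧ ContDiffAt ℝ 2 F.symm z :=
    (F.open_target.eventually_mem h.mem_target).and (h.contDiffAt_symm.eventually (by simp))
  obtain ⟨r, hr, hball⟩ := Metric.nhds_basis_closedBall.eventually_iff.1 hev
  -- After flattening, `Ω` is replaced near `ξ₀` by a half ball. Its convexity is what allows a
  -- derivative with a limit at the boundary to extend to the closure.
  set Z : Set (EuclideanSpace ℝ (Fin n)) := Metric.ball ξ₀ r ∩ {z | ⟪e, z - ξ₀⟫ < 0} with hZ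
  have hinc : Continuous fun z : EuclideanSpace ℝ (Fin n) => ⟪e, z - ξ₀⟫ :=
    (contDiff_inner_sub e ξ₀ (k := 1)).continuous
  have hZo : IsOpen Z := Metric.isOpen_ball.inter (isOpen_lt hinc continuous_const)
  have hZc : Convex ℝ Z := by
    refine (convex_ball ξ₀ r).inter ?_
    have : {z | ⟪e, z - ξ₀⟫ < 0} = {z | ⟪e, z⟫ < ⟪e, ξ₀⟫} := by
      ext z; simp [inner_sub_right]
    rw [this]
    exact convex_halfSpace_lt (J e).toLinearMap.isLinear _
  have hZΩ : ∀ z ∈ Z, F.symm z ∈ Ω := by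
    intro z hz
    have hzt := (hball (Metric.ball_subset_closedBall hz.1)).1
    rw [h.mem_iff _ (F.map_target hzt), F.right_inv hzt]
    exact hz.2
  have hclZ : closure Z ⊆ Metric.closedBall ξ₀ r :=
    (closure_mono inter_subset_left).trans Metric.closure_ball_subset_closedBall
  have hFsc : ∀ z ∈ closure Z, ContinuousAt F.symm z := fun z hz => (hball (hclZ hz)).2.continuousAt
  have hclΩ : ∀ z ∈ closure Z, F.symm z ∈ closure Ω := by
    intro z hz
    exact (hFsc z hz).continuousWithinAt.mem_closure hz hZΩ
  set v : EuclideanSpace ℝ (Fin n) → ℝ := fun z => u (F.symm z) with hv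
  have hvd : ∀ z ∈ Z, HasFDerivAt v ((J (G (F.symm z))).comp (fderiv ℝ F.symm z)) z := by
    intro z hz
    have h1 := (hball (Metric.ball_subset_closedBall hz.1)).2.differentiableAt (by norm_num)
    exact (hG _ (hZΩ z hz)).hasFDerivAt.comp z h1.hasFDerivAt
  have hnegZ : ∀ z ∈ Metric.ball ξ₀ r, ⟪e, z - ξ₀⟫ = 0 → z ∈ closure Z := by
    intro z hz h0
    have hline : Tendsto (fun t : ℝ => z + (-t) • e) (𝓝[>] 0) (𝓝 z) := by
      have : Continuous fun t : ℝ => z + (-t) • e := by fun_prop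
      simpa using (this.tendsto 0).mono_left nhdsWithin_le_nhds
    refine mem_closure_of_tendsto hline ?_
    filter_upwards [hline.eventually (Metric.isOpen_ball.mem_nhds hz), self_mem_nhdsWithin] with t ht ht0
    refine ⟨ht, ?_⟩
    have := (hyperplaneProj_add he h0 (-t)).1
    rw [mem_ofPred_eq, this]
    exact neg_lt_zero.2 ht0
  have hξZ : ξ₀ ∈ closure Z := hnegZ ξ₀ (Metric.mem_ball_self hr) (by simp)
  have hξcl : ξ₀ ∈ closure Ω := frontier_subset_closure hξ₀
  have hvD : HasFDerivWithinAt v (J (G ξ₀)) (closure Z) ξ₀ := by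
    refine hasFDerivWithinAt_closure_of_tendsto_fderiv
      (fun z hz => (hvd z hz).differentiableAt.differentiableWithinAt) hZc hZo ?_ ?_
    · intro z hz
      exact (hu _ (hclΩ z hz)).comp (hFsc z hz).continuousWithinAt fun y hy => subset_closure (hZΩ y hy)
    · have hfs : Tendsto F.symm (𝓝[Z] ξ₀) (𝓝[closure Ω] ξ₀) := by
        refine tendsto_nhdsWithin_iff.2 ⟨?_, ?_⟩
        · have := (hFsc ξ₀ hξZ).tendsto.mono_left (nhdsWithin_le_nhds (s := Z))
          rwa [h.symm_apply_self] at this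
        · filter_upwards [self_mem_nhdsWithin] with z hz using subset_closure (hZΩ z hz)
      have h1 : Tendsto (fun z => J (G (F.symm z))) (𝓝[Z] ξ₀) (𝓝 (J (G ξ₀))) :=
        (J.continuous.tendsto _).comp ((hGc ξ₀ hξcl).tendsto.comp hfs)
      have h2 : Tendsto (fderiv ℝ F.symm) (𝓝[Z] ξ₀) (𝓝 (ContinuousLinearMap.id ℝ _)) := by
        have := (h.contDiffAt_symm.fderiv_right (m := 1) (by norm_num)).continuousAt.tendsto.mono_left
          (nhdsWithin_le_nhds (s := Z))
        rwa [h.hasStrictFDerivAt_symm.hasFDerivAt.fderiv] at this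
      have h3 : Tendsto (fun z => (J (G (F.symm z))).comp (fderiv ℝ F.symm z)) (𝓝[Z] ξ₀)
          (𝓝 ((J (G ξ₀)).comp (ContinuousLinearMap.id ℝ _))) :=
        tendsto_continuousLinearMap_comp h1 h2
      rw [ContinuousLinearMap.comp_id] at h3
      refine h3.congr' ?_
      filter_upwards [self_mem_nhdsWithin] with z hz using (hvd z hz).fderiv.symm
  have hFc : ContinuousAt F ξ₀ := h.hasStrictFDerivAt.continuousAt
  have hW : F.source ∩ F ⁻¹' Metric.ball ξ₀ r ∈ 𝓝 ξ₀ := by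
    refine inter_mem (F.open_source.mem_nhds h.mem_source) (hFc ?_)
    rw [h.apply_self]
    exact Metric.ball_mem_nhds _ hr
  -- Close to `ξ₀`, `F` carries Γ into the flat face of the half ball; as its derivative there is
  -- the identity, the derivative of `v` pulls back unchanged.
  rw [← hasFDerivWithinAt_inter hW]
  have hcomp : HasFDerivWithinAt (fun x => v (F x)) (J (G ξ₀))
      (frontier Ω ∩ (F.source ∩ F ⁻¹' Metric.ball ξ₀ r)) ξ₀ := by
    have h1 : HasFDerivWithinAt v (J (G ξ₀)) (closure Z) (F ξ₀) := by rwa [h.apply_self]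
    have h2 := h1.comp ξ₀ (h.hasStrictFDerivAt.hasFDerivAt.hasFDerivWithinAt
      (s := frontier Ω ∩ (F.source ∩ F ⁻¹' Metric.ball ξ₀ r))) ?_
    · rw [ContinuousLinearMap.comp_id] at h2
      exact h2
    · rintro x ⟨hxΓ, hxs, hxb⟩
      exact hnegZ _ hxb ((h.mem_frontier_iff x hxs).1 hxΓ)
  refine hcomp.congr (fun x hx => ?_) ?_
  · simp only [hv, F.left_inv hx.2.1]
  · simp only [hv, F.left_inv h.mem_source]

end Local

/-! ### The global tubular neighbourhood -/

section Tube

variable {n : ℕ} {Ω : Set (EuclideanSpace ℝ (Fin n))}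

/-- `π` and `d` are the nearest point projection and the signed distance on the tubular
neighbourhood of width `τ` of the boundary. -/
structure IsTube (Ω : Set (EuclideanSpace ℝ (Fin n))) (τ : ℝ)
    (π : EuclideanSpace ℝ (Fin n) → EuclideanSpace ℝ (Fin n))
    (d : EuclideanSpace ℝ (Fin n) → ℝ) : Prop where
  pos : 0 < τ
  contDiffOn_proj : ContDiffOn ℝ 1 π (Metric.thickening τ (frontier Ω))
  contDiffOn_normal : ContDiffOn ℝ 1 (fun x => outerNormal Ω (π x)) (Metric.thickening τ (frontier Ω))
  measurable_proj : Measurable π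
  dist_eq : ∀ x ∈ Metric.thickening τ (frontier Ω), d x = ⟪x - π x, outerNormal Ω (π x)⟫
  proj_mem : ∀ x ∈ Metric.thickening τ (frontier Ω), π x ∈ frontier Ω
  eq_add : ∀ x ∈ Metric.thickening τ (frontier Ω), x = π x + d x • outerNormal Ω (π x)
  proj_apply : ∀ ξ ∈ frontier Ω, ∀ t : ℝ, |t| < τ → π (ξ + t • outerNormal Ω ξ) = ξ
  dist_apply : ∀ ξ ∈ frontier Ω, ∀ t : ℝ, |t| < τ → d (ξ + t • outerNormal Ω ξ) = t
  mem_iff : ∀ x ∈ Metric.thickening τ (frontier Ω), x ∈ Ω ↔ d x < 0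

/-- Compactness of Γ × Γ. Near the diagonal local injectivity applies; away from it the feet are a
positive distance apart, which short normal segments cannot bridge. -/
theorem exists_injectivity_radius (hΩ : IsOpen Ω) (hb : Bornology.IsBounded Ω) (hC2 : HasC2Boundary Ω) :
    ∃ τ > 0, ∀ ξ ∈ frontier Ω, ∀ ξ' ∈ frontier Ω, ∀ t t' : ℝ, |t| < τ → |t'| < τ →
      ξ + t • outerNormal Ω ξ = ξ' + t' • outerNormal Ω ξ' → ξ = ξ' ∧ t = t' := by
  have hK : IsCompact (frontier Ω) := hb.isCompact_closure.of_isClosed_subset isClosed_frontier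
    frontier_subset_closure
  have key : ∀ᶠ s : ℝ × ℝ in 𝓝 (0, 0), ∀ y ∈ frontier Ω ×ˢ frontier Ω, y.1 ∈ frontier Ω →
      y.2 ∈ frontier Ω → y.1 + s.1 • outerNormal Ω y.1 = y.2 + s.2 • outerNormal Ω y.2 →
      y.1 = y.2 ∧ s.1 = s.2 := by
    refine (hK.prod hK).eventually_forall_of_forall_eventually ?_
    rintro ⟨ξ, ξ'⟩ ⟨hξ, hξ'⟩
    by_cases hne : ξ = ξ'
    · obtain rfl : ξ = ξ' := hne
      obtain ⟨W, hW, hinj⟩ := exists_nhds_injective hΩ hC2 hξ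
      have c1 : ContinuousAt (fun z : (ℝ × ℝ) × (EuclideanSpace ℝ (Fin n) × EuclideanSpace ℝ (Fin n)) =>
        (z.1.1, z.2.1)) ((0, 0), (ξ, ξ)) := by fun_prop
      have c2 : ContinuousAt (fun z : (ℝ × ℝ) × (EuclideanSpace ℝ (Fin n) × EuclideanSpace ℝ (Fin n)) =>
        (z.1.2, z.2.2)) ((0, 0), (ξ, ξ)) := by fun_prop
      filter_upwards [c1.eventually_mem hW, c2.eventually_mem hW] with z h1 h2 m1 m2 heq
      have := hinj _ h1 _ h2 m1 m2 heq
      exact ⟨congrArg Prod.snd this, congrArg Prod.fst this⟩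
    · have c : ContinuousAt (fun z : (ℝ × ℝ) × (EuclideanSpace ℝ (Fin n) × EuclideanSpace ℝ (Fin n)) =>
        dist z.2.1 z.2.2 - (|z.1.1| + |z.1.2|)) ((0, 0), (ξ, ξ')) := by fun_prop
      have hpos : 0 < dist ξ ξ' - (|(0 : ℝ)| + |(0 : ℝ)|) := by simpa using dist_pos.2 hne
      filter_upwards [c.eventually (lt_mem_nhds hpos)] with z h1 m1 m2 heq
      exfalso
      have : dist z.2.1 z.2.2 ≤ |z.1.1| + |z.1.2| := by
        have e1 : z.2.1 - z.2.2 = z.1.2 • outerNormal Ω z.2.2 - z.1.1 • outerNormal Ω z.2.1 := by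
          rw [sub_eq_sub_iff_add_eq_add, heq, add_comm]
        rw [dist_eq_norm, e1]
        refine (norm_sub_le _ _).trans ?_
        rw [norm_smul, norm_smul, norm_outerNormal hΩ hC2 m1, norm_outerNormal hΩ hC2 m2,
          mul_one, mul_one, Real.norm_eq_abs, Real.norm_eq_abs, add_comm]
      linarith
  obtain ⟨τ, hτ, h⟩ := Metric.eventually_nhds_iff.1 key
  refine ⟨τ, hτ, fun ξ hξ ξ' hξ' t t' ht ht' heq => ?_⟩
  refine h (y := (t, t')) ?_ (ξ, ξ') ⟨hξ, hξ'⟩ hξ hξ' heq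
  rw [Prod.dist_eq]
  simpa using ⟨ht, ht'⟩

/-- Existence of a foot point comes from the local projections covering Γ, uniqueness from the
injectivity radius. Uniqueness forces the global projection to coincide with each local one, hence
to be C¹. -/
theorem exists_isTube (hΩ : IsOpen Ω) (hb : Bornology.IsBounded Ω) (hC2 : HasC2Boundary Ω) :
    ∃ τ π d, IsTube Ω τ π d := by
  have hK : IsCompact (frontier Ω) := hb.isCompact_closure.of_isClosed_subset isClosed_frontier
    frontier_subset_closure
  obtain ⟨τ₁, hτ₁, hinj⟩ := exists_injectivity_radius hΩ hb hC2
  have hsign : ∀ᶠ t : ℝ in 𝓝 0, ∀ ξ ∈ frontier Ω, ξ ∈ frontier Ω →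
      (ξ + t • outerNormal Ω ξ ∈ Ω ↔ t < 0) :=
    hK.eventually_forall_of_forall_eventually fun ξ hξ => eventually_mem_iff_neg hΩ hC2 hξ
  obtain ⟨τ₂, hτ₂, hsign⟩ := Metric.eventually_nhds_iff.1 hsign
  set η := min τ₁ τ₂ with hη
  have hηpos : 0 < η := lt_min hτ₁ hτ₂
  have hloc := fun ξ : frontier Ω => exists_local_projection hΩ hC2 ξ.2 hηpos
  choose r hr q hq hqν hqx using hloc
  have hcover : frontier Ω ⊆ ⋃ ξ : frontier Ω, Metric.ball (ξ : EuclideanSpace ℝ (Fin n)) (r ξ) :=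
    fun x hx => mem_iUnion.2 ⟨⟨x, hx⟩, Metric.mem_ball_self (hr _)⟩
  obtain ⟨τ₃, hτ₃, hthick⟩ := hK.exists_thickening_subset_open
    (isOpen_iUnion fun ξ => Metric.isOpen_ball) hcover
  -- `τ₃` keeps the tube inside the patches; `η` secures uniqueness of the foot and the sign of the
  -- distance.
  set τ := min τ₃ η with hτ
  have hτpos : 0 < τ := lt_min hτ₃ hηpos
  set T := Metric.thickening τ (frontier Ω) with hT
  have hTo : IsOpen T := Metric.isOpen_thickening
  have hTsub : ∀ x ∈ T, ∃ ξ : frontier Ω, x ∈ Metric.ball (ξ : EuclideanSpace ℝ (Fin n)) (r ξ) :=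
    fun x hx => mem_iUnion.1 (hthick (Metric.thickening_mono (min_le_left _ _) _ hx))
  have hex : ∀ x ∈ T, ∃ ξ ∈ frontier Ω, ∃ t : ℝ, |t| < η ∧ x = ξ + t • outerNormal Ω ξ := by
    intro x hx
    obtain ⟨ξ, hξ⟩ := hTsub x hx
    obtain ⟨h1, t, h2, h3⟩ := hqx ξ x hξ
    exact ⟨_, h1, t, h2, h3⟩
  choose! p hpΓ s hs hps using hex
  have huniq : ∀ x ∈ T, ∀ ξ ∈ frontier Ω, ∀ t : ℝ, |t| < η → x = ξ + t • outerNormal Ω ξ →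
      p x = ξ ∧ s x = t := by
    intro x hx ξ hξ t ht he
    refine hinj _ (hpΓ x hx) _ hξ _ _ ((hs x hx).trans_le (min_le_left _ _))
      (ht.trans_le (min_le_left _ _)) ?_
    rw [← hps x hx, he]
  have hpq : ∀ ξ : frontier Ω, ∀ x ∈ T, x ∈ Metric.ball (ξ : EuclideanSpace ℝ (Fin n)) (r ξ) →
      p x = q ξ x := by
    intro ξ x hx hxb
    obtain ⟨h1, t, h2, h3⟩ := hqx ξ x hxb
    exact (huniq x hx _ h1 t h2 h3).1
  have hpc : ContDiffOn ℝ 1 p T := by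
    intro x hx
    obtain ⟨ξ, hξ⟩ := hTsub x hx
    have h1 : ContDiffAt ℝ 1 (q ξ) x := (hq ξ).contDiffAt (Metric.isOpen_ball.mem_nhds hξ)
    refine (h1.congr_of_eventuallyEq ?_).contDiffWithinAt
    filter_upwards [hTo.mem_nhds hx, Metric.isOpen_ball.mem_nhds hξ] with y h2 h3 using hpq ξ y h2 h3
  have hνc : ContDiffOn ℝ 1 (fun x => outerNormal Ω (p x)) T := by
    intro x hx
    obtain ⟨ξ, hξ⟩ := hTsub x hx
    have h1 : ContDiffAt ℝ 1 (fun x => outerNormal Ω (q ξ x)) x :=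
      (hqν ξ).contDiffAt (Metric.isOpen_ball.mem_nhds hξ)
    refine (h1.congr_of_eventuallyEq ?_).contDiffWithinAt
    filter_upwards [hTo.mem_nhds hx, Metric.isOpen_ball.mem_nhds hξ] with y h2 h3
    rw [hpq ξ y h2 h3]
  have hsd : ∀ x ∈ T, s x = ⟪x - p x, outerNormal Ω (p x)⟫ := by
    intro x hx
    have h1 : x - p x = s x • outerNormal Ω (p x) := by
      conv_lhs => rw [hps x hx]
      rw [← hps x hx]
      exact sub_eq_of_eq_add' (hps x hx)
    rw [h1, real_inner_smul_left, real_inner_self_eq_norm_sq, norm_outerNormal hΩ hC2 (hpΓ x hx)]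
    ring
  have hTmem : ∀ ξ ∈ frontier Ω, ∀ t : ℝ, |t| < τ → ξ + t • outerNormal Ω ξ ∈ T := by
    intro ξ hξ t ht
    refine Metric.mem_thickening_iff.2 ⟨ξ, hξ, ?_⟩
    rw [dist_eq_norm, add_sub_cancel_left, norm_smul, norm_outerNormal hΩ hC2 hξ, mul_one]
    exact ht
  classical
  -- Outside the tube the projection is reset to 0, which makes it Borel on the whole space, as
  -- pushing measures forward requires.
  have hpT : EqOn (T.piecewise p 0) p T := T.piecewise_eqOn p 0
  refine ⟨τ, T.piecewise p 0, s, hτpos, hpc.congr hpT, hνc.congr fun x hx => ?_,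
    hpc.continuousOn.measurable_piecewise continuousOn_const hTo.measurableSet,
    fun x hx => ?_, fun x hx => ?_, fun x hx => ?_, fun ξ hξ t ht => ?_, fun ξ hξ t ht => ?_,
    fun x hx => ?_⟩
  · rw [hpT hx]
  · rw [hpT hx, hsd x hx]
  · rw [hpT hx]; exact hpΓ x hx
  · rw [hpT hx]; exact hps x hx
  · rw [hpT (hTmem ξ hξ t ht)]
    exact (huniq _ (hTmem ξ hξ t ht) ξ hξ t (ht.trans_le (min_le_right _ _)) rfl).1
  · exact (huniq _ (hTmem ξ hξ t ht) ξ hξ t (ht.trans_le (min_le_right _ _)) rfl).2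
  · have h1 := hsign (y := s x) (by simpa using (hs x hx).trans_le (min_le_right _ _)) (p x)
      (hpΓ x hx) (hpΓ x hx)
    rwa [← hps x hx] at h1

variable {τ : ℝ} {π : EuclideanSpace ℝ (Fin n) → EuclideanSpace ℝ (Fin n)}
  {d : EuclideanSpace ℝ (Fin n) → ℝ}

theorem IsTube.contDiffOn_dist (h : IsTube Ω τ π d) :
    ContDiffOn ℝ 1 d (Metric.thickening τ (frontier Ω)) :=
  ContDiffOn.congr ((contDiffOn_id.sub h.contDiffOn_proj).inner ℝ h.contDiffOn_normal) h.dist_eq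

theorem add_smul_outerNormal_mem_thickening (hΩ : IsOpen Ω) (hC2 : HasC2Boundary Ω)
    {ξ : EuclideanSpace ℝ (Fin n)} (hξ : ξ ∈ frontier Ω) {t : ℝ} (ht : |t| < τ) :
    ξ + t • outerNormal Ω ξ ∈ Metric.thickening τ (frontier Ω) := by
  refine Metric.mem_thickening_iff.2 ⟨ξ, hξ, ?_⟩
  rw [dist_eq_norm, add_sub_cancel_left, norm_smul, norm_outerNormal hΩ hC2 hξ, mul_one]
  exact ht

/-- The gradient of the signed distance is the normal at the projection. -/
theorem IsTube.hasGradientAt_dist (h : IsTube Ω τ π d) (hΩ : IsOpen Ω) (hC2 : HasC2Boundary Ω)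
    {x : EuclideanSpace ℝ (Fin n)} (hx : x ∈ Metric.thickening τ (frontier Ω)) :
    HasGradientAt d (outerNormal Ω (π x)) x := by
  have hTo : IsOpen (Metric.thickening τ (frontier Ω)) := Metric.isOpen_thickening
  have hT := hTo.mem_nhds hx
  set N : EuclideanSpace ℝ (Fin n) → EuclideanSpace ℝ (Fin n) := fun x => outerNormal Ω (π x) with hN
  have hπd : HasFDerivAt π (fderiv ℝ π x) x :=
    ((h.contDiffOn_proj.contDiffAt hT).differentiableAt (by norm_num)).hasFDerivAt
  have hNd : HasFDerivAt N (fderiv ℝ N x) x :=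
    ((h.contDiffOn_normal.contDiffAt hT).differentiableAt (by norm_num)).hasFDerivAt
  -- Of the product rule for ⟪x - π x, N x⟫ only ⟪v, N x⟫ survives: x - π x is parallel to `N`, and
  -- `N` is orthogonal to its own derivative (unit length) and to that of `π` (which stays in Γ).
  have hdd := ((hasFDerivAt_id (𝕜 := ℝ) x).sub hπd).inner ℝ hNd
  have hd : d =ᶠ[𝓝 x] fun x => ⟪x - π x, N x⟫ := by
    filter_upwards [hT] with y hy using h.dist_eq y hy
  have hNN : ∀ v, ⟪N x, fderiv ℝ N x v⟫ = 0 := by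
    intro v
    have h1 := hNd.inner ℝ hNd
    have h2 : (fun y => ⟪N y, N y⟫) =ᶠ[𝓝 x] fun _ => (1 : ℝ) := by
      filter_upwards [hT] with y hy
      rw [real_inner_self_eq_norm_sq, norm_outerNormal hΩ hC2 (h.proj_mem y hy)]
      norm_num
    have h3 := (h1.congr_of_eventuallyEq h2.symm).unique (hasFDerivAt_const (1 : ℝ) x)
    have h4 := congrArg (fun L => L v) h3
    simp only [ContinuousLinearMap.comp_apply, ContinuousLinearMap.prod_apply,
      fderivInnerCLM_apply, _root_.zero_apply] at h4
    rw [real_inner_comm (N x) (fderiv ℝ N x v)] at h4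
    linarith
  have hπN : ∀ v, ⟪fderiv ℝ π x v, N x⟫ = 0 := by
    intro v
    obtain ⟨U, φ, hφ⟩ := hC2 (π x) (h.proj_mem x hx)
    have h1 : HasFDerivAt φ (InnerProductSpace.toDual ℝ (EuclideanSpace ℝ (Fin n)) (gradient φ (π x))) (π x) :=
      ((hφ.contDiffOn.contDiffAt (hφ.isOpen.mem_nhds hφ.mem)).differentiableAt
        (by norm_num)).hasGradientAt.hasFDerivAt
    have h2 := h1.comp x hπd
    have h3 : (φ ∘ π) =ᶠ[𝓝 x] fun _ => (0 : ℝ) := by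
      filter_upwards [hT, hπd.continuousAt.eventually_mem (hφ.isOpen.mem_nhds hφ.mem)] with y hy hyU
      exact (hφ.mem_frontier_iff hΩ hyU).1 (h.proj_mem y hy)
    have h4 := (h2.congr_of_eventuallyEq h3.symm).unique (hasFDerivAt_const (0 : ℝ) x)
    have h5 := congrArg (fun L => L v) h4
    simp only [ContinuousLinearMap.comp_apply, InnerProductSpace.toDual_apply_apply,
      _root_.zero_apply] at h5
    rw [hN]
    simp only
    rw [hφ.outerNormal_eq hΩ hφ.mem (h.proj_mem x hx), unitGradient, inner_smul_right, real_inner_comm,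
      h5, mul_zero]
  have hxπ : x - π x = d x • N x := sub_eq_of_eq_add' (h.eq_add x hx)
  refine ((hdd.congr_of_eventuallyEq hd).congr_fderiv ?_ : HasFDerivAt d _ x)
  ext v
  simp only [ContinuousLinearMap.comp_apply, ContinuousLinearMap.prod_apply,
      fderivInnerCLM_apply, InnerProductSpace.toDual_apply_apply, _root_.sub_apply,
      ContinuousLinearMap.id_apply, inner_sub_left, hπN]
  have hx' : (id - π : EuclideanSpace ℝ (Fin n) → EuclideanSpace ℝ (Fin n)) x = d x • N x := hxπ
  rw [hx', real_inner_smul_left, hNN, mul_zero, zero_add, sub_zero, real_inner_comm]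

end Tube

/-! ### Slices of the tube, and their volume when thin -/

section Slice

variable {n : ℕ} {Ω : Set (EuclideanSpace ℝ (Fin n))} {ρ : EuclideanSpace ℝ (Fin n) → ℝ}

/-- The points `ξ + r ρ(ξ) ν(ξ)` with `ξ ∈ B` and `r ∈ I`. -/
def slice (Ω : Set (EuclideanSpace ℝ (Fin n))) (ρ : EuclideanSpace ℝ (Fin n) → ℝ)
    (B : Set (EuclideanSpace ℝ (Fin n))) (I : Set ℝ) : Set (EuclideanSpace ℝ (Fin n)) :=
  {x | ∃ ξ ∈ B, ∃ r ∈ I, x = ξ + (r * ρ ξ) • outerNormal Ω ξ}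

/-- In the coordinate r = t/ρ(ξ) the width no longer depends on ξ, so cutting and shifting act
uniformly along Γ. -/
theorem layer_eq_slice (hρ : ∀ ξ ∈ frontier Ω, 0 < ρ ξ) (ε : ℝ) :
    layer Ω ρ ε = slice Ω ρ (frontier Ω) (Ioo 0 ε) := by
  ext x
  constructor
  · rintro ⟨ξ, hξ, t, h0, h1, rfl⟩
    have := hρ ξ hξ
    refine ⟨ξ, hξ, t / ρ ξ, ⟨by positivity, (div_lt_iff₀ this).2 h1⟩, ?_⟩
    rw [div_mul_cancel₀ _ this.ne']
  · rintro ⟨ξ, hξ, r, ⟨h0, h1⟩, rfl⟩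
    have := hρ ξ hξ
    exact ⟨ξ, hξ, r * ρ ξ, by positivity, by gcongr, rfl⟩

/-- Near a boundary point, the volume of a thin slice of the tube is comparable, up to a factor close
to one, to the surface integral of its width. -/
theorem exists_local_volume_bounds (hΩ : IsOpen Ω) (hC2 : HasC2Boundary Ω)
    {ξ₀ : EuclideanSpace ℝ (Fin n)} (hξ₀ : ξ₀ ∈ frontier Ω)
    (hρ : ContinuousWithinAt ρ (frontier Ω) ξ₀) (hρ0 : 0 < ρ ξ₀) {L : ℝ≥0} (hL : 1 < L) :
    ∃ W ∈ 𝓝 ξ₀, ∃ h₀ > 0, ∀ B ⊆ frontier Ω ∩ W, MeasurableSet B → ∀ h : ℝ, 0 < h → h < h₀ →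
      volume (slice Ω ρ B (Ioc 0 h)) ≤ (L : ℝ≥0∞) ^ (n + (n - 1) + 2) * (ENNReal.ofReal h *
        ∫⁻ ξ in B, ENNReal.ofReal (ρ ξ) ∂(Measure.euclideanHausdorffMeasure (n - 1))) ∧
      ENNReal.ofReal h * ∫⁻ ξ in B, ENNReal.ofReal (ρ ξ) ∂(Measure.euclideanHausdorffMeasure (n - 1)) ≤
        (L : ℝ≥0∞) ^ (n + (n - 1) + 2) * volume (slice Ω ρ B (Ioo 0 h)) := by
  obtain ⟨F, Ψ, hs⟩ := exists_isStraightening hΩ hC2 hξ₀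
  have he := norm_outerNormal hΩ hC2 hξ₀
  have htube := hs.eventually_tube he
  set e := outerNormal Ω ξ₀
  have hL0 : (0 : ℝ) < L := by exact_mod_cast (zero_lt_one.trans hL)
  have hL1 : (1 : ℝ) < L := by exact_mod_cast hL
  -- The identity has norm at most 1 < L, so all four maps are L-Lipschitz near `ξ₀`.
  have hid : ‖ContinuousLinearMap.id ℝ (EuclideanSpace ℝ (Fin n))‖₊ < L :=
    lt_of_le_of_lt ContinuousLinearMap.norm_id_le hL
  obtain ⟨S₁, hS₁, hl₁⟩ := hs.tube_hasStrictFDerivAt.exists_lipschitzOnWith_of_nnnorm_lt L hid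
  obtain ⟨S₂, hS₂, hl₂⟩ := hs.tube_hasStrictFDerivAt_symm.exists_lipschitzOnWith_of_nnnorm_lt L hid
  obtain ⟨S₃, hS₃, hl₃⟩ := hs.hasStrictFDerivAt.exists_lipschitzOnWith_of_nnnorm_lt L hid
  obtain ⟨S₄, hS₄, hl₄⟩ := hs.hasStrictFDerivAt_symm.exists_lipschitzOnWith_of_nnnorm_lt L hid
  have hF : Tendsto F (𝓝 ξ₀) (𝓝 ξ₀) := by
    simpa [ContinuousAt, hs.apply_self] using hs.hasStrictFDerivAt.continuousAt
  have hΨ : Tendsto Ψ (𝓝 ξ₀) (𝓝 ξ₀) := by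
    simpa [ContinuousAt, hs.tube_apply_self] using hs.tube_hasStrictFDerivAt.continuousAt
  have h2 : Tendsto (fun z : ℝ × EuclideanSpace ℝ (Fin n) => z.2) (𝓝 (0, ξ₀)) (𝓝 ξ₀) :=
    continuous_snd.tendsto ((0 : ℝ), ξ₀)
  have ht : Tendsto (fun z : ℝ × EuclideanSpace ℝ (Fin n) => F z.2 + z.1 • e) (𝓝 (0, ξ₀)) (𝓝 ξ₀) := by
    have h1 : Tendsto (fun z : ℝ × EuclideanSpace ℝ (Fin n) => z.1 • e) (𝓝 (0, ξ₀)) (𝓝 ((0 : ℝ) • e)) :=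
      (continuous_fst.smul continuous_const).tendsto ((0 : ℝ), ξ₀)
    simpa using (hF.comp h2).add h1
  have hρev : ∀ᶠ ξ in 𝓝 ξ₀, ξ ∈ frontier Ω → ρ ξ₀ / L < ρ ξ ∧ ρ ξ < L * ρ ξ₀ := by
    rw [← eventually_nhdsWithin_iff]
    refine (hρ.eventually (lt_mem_nhds ?_)).and (hρ.eventually (gt_mem_nhds ?_))
    · exact div_lt_self hρ0 hL1
    · exact lt_mul_of_one_lt_left hρ0 hL1
  have hev := htube.and ((ht.eventually hS₁).and (((hΨ.comp ht).eventually hS₂).and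
    ((h2.eventually hS₃).and (((hF.comp h2).eventually hS₄).and (h2.eventually hρev)))))
  obtain ⟨η, hη, hbox⟩ := Metric.eventually_nhds_iff.1 hev
  have hbox : ∀ ξ ∈ frontier Ω, dist ξ ξ₀ < η → ∀ t : ℝ, |t| < η →
      (ξ ∈ F.source ∧ ⟪e, F ξ - ξ₀⟫ = 0 ∧ F ξ + t • e ∈ Ψ.source ∧
        Ψ (F ξ + t • e) = ξ + t • outerNormal Ω ξ) ∧ F ξ + t • e ∈ S₁ ∧ Ψ (F ξ + t • e) ∈ S₂ ∧
        ξ ∈ S₃ ∧ F ξ ∈ S₄ ∧ ρ ξ₀ / L < ρ ξ ∧ ρ ξ < L * ρ ξ₀ := by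
    intro ξ hξ hd t ht
    obtain ⟨a1, a2, a3, a4, a5, a6⟩ := hbox (y := (t, ξ)) (by
      rw [Prod.dist_eq]; exact max_lt (by simpa using ht) hd)
    exact ⟨a1 hξ, a2, a3, a4, a5, a6 hξ⟩
  -- For `h` below this bound, heights up to h L ρ(ξ₀), which dominate those of the slice, remain
  -- below `η`.
  refine ⟨Metric.ball ξ₀ η, Metric.ball_mem_nhds _ hη, η / (L * ρ ξ₀), by positivity, ?_⟩
  intro B hB hBm h hh hh0
  rw [lt_div_iff₀ (by positivity)] at hh0
  set σ := (Measure.euclideanHausdorffMeasure (n - 1) : Measure (EuclideanSpace ℝ (Fin n))) with hσ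
  set R := ∫⁻ ξ in B, ENNReal.ofReal (ρ ξ) ∂σ with hR
  have hBb : ∀ ξ ∈ B, ∀ t : ℝ, |t| < η → _ := fun ξ hξ t ht => hbox ξ (hB hξ).1 (hB hξ).2 t ht
  have hB0 : ∀ ξ ∈ B, _ := fun ξ hξ => hBb ξ hξ 0 (by simpa using hη)
  have hcyl : ∀ a ∈ F '' B, ⟪e, a - ξ₀⟫ = 0 := by
    rintro _ ⟨ξ, hξ, rfl⟩
    exact (hB0 ξ hξ).1.2.1
  have hlL : ENNReal.ofReal L = (L : ℝ≥0∞) := ENNReal.ofReal_coe_nnreal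
  have hR1 : ENNReal.ofReal (ρ ξ₀) * σ B ≤ (L : ℝ≥0∞) * R := by
    rw [hR, ← lintegral_const_mul' _ _ ENNReal.coe_ne_top, ← setLIntegral_const]
    refine setLIntegral_mono' hBm fun ξ hξ => ?_
    rw [← hlL, ← ENNReal.ofReal_mul hL0.le]
    refine ENNReal.ofReal_le_ofReal ?_
    have := (hB0 ξ hξ).2.2.2.2.2.1
    rw [div_lt_iff₀ hL0] at this
    linarith
  have hR2 : R ≤ (L : ℝ≥0∞) * (ENNReal.ofReal (ρ ξ₀) * σ B) := by
    rw [hR, ← mul_assoc, ← hlL, ← ENNReal.ofReal_mul hL0.le, ← setLIntegral_const]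
    exact setLIntegral_mono' hBm fun ξ hξ => ENNReal.ofReal_le_ofReal (hB0 ξ hξ).2.2.2.2.2.2.le
  constructor
  · have hsub : slice Ω ρ B (Ioc 0 h) ⊆
        Ψ '' {z | ∃ a ∈ F '' B, ∃ t ∈ Ioc 0 (h * (L * ρ ξ₀)), z = a + t • e} := by
      rintro _ ⟨ξ, hξ, r, ⟨hr0, hr1⟩, rfl⟩
      have hρξ := (hB0 ξ hξ).2.2.2.2.2
      have hρp : 0 < ρ ξ := (by positivity : 0 < ρ ξ₀ / L).trans hρξ.1
      have hle : r * ρ ξ ≤ h * (L * ρ ξ₀) := mul_le_mul hr1 hρξ.2.le hρp.le hh.le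
      refine ⟨F ξ + (r * ρ ξ) • e, ⟨_, mem_image_of_mem F hξ, _, ⟨by positivity, hle⟩, rfl⟩, ?_⟩
      refine (hBb ξ hξ (r * ρ ξ) ?_).1.2.2.2
      rw [abs_of_pos (by positivity)]
      exact hle.trans_lt hh0
    have hC : {z | ∃ a ∈ F '' B, ∃ t ∈ Ioc 0 (h * (L * ρ ξ₀)), z = a + t • e} ⊆ S₁ := by
      rintro _ ⟨_, ⟨ξ, hξ, rfl⟩, t, ⟨ht0, ht1⟩, rfl⟩
      refine (hBb ξ hξ t ?_).2.1
      rw [abs_of_pos ht0]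
      exact ht1.trans_lt hh0
    have hFB : σ (F '' B) ≤ (L : ℝ≥0∞) ^ (n - 1) * σ B :=
      (hl₃.mono fun ξ hξ => (hB0 ξ hξ).2.2.2.1).euclideanHausdorffMeasure_image_le (n - 1)
    -- Count of the powers of L: n for `Ψ`, n - 1 for `F`, one for the height of the enclosing
    -- cylinder, one for replacing ρ(ξ₀) σ(B) by the integral of ρ.
    calc volume (slice Ω ρ B (Ioc 0 h)) ≤ _ := measure_mono hsub
      _ ≤ (L : ℝ≥0∞) ^ n * (σ (F '' B) * volume (Ioc 0 (h * (L * ρ ξ₀)))) := by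
          rw [← volume_cylinder he hcyl]
          exact (hl₁.mono hC).volume_image_le
      _ ≤ (L : ℝ≥0∞) ^ n * (((L : ℝ≥0∞) ^ (n - 1) * σ B) *
            (ENNReal.ofReal h * (L * ENNReal.ofReal (ρ ξ₀)))) := by
          gcongr
          rw [Real.volume_Ioc, sub_zero, ENNReal.ofReal_mul hh.le, ENNReal.ofReal_mul hL0.le, hlL]
      _ = (L : ℝ≥0∞) ^ (n + (n - 1) + 1) * (ENNReal.ofReal h * (ENNReal.ofReal (ρ ξ₀) * σ B)) := by ring
      _ ≤ (L : ℝ≥0∞) ^ (n + (n - 1) + 1) * (ENNReal.ofReal h * (L * R)) := by gcongr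
      _ = _ := by ring
  · have hsub : {z | ∃ a ∈ F '' B, ∃ t ∈ Ioo 0 (h * (ρ ξ₀ / L)), z = a + t • e} ⊆
        Ψ.symm '' slice Ω ρ B (Ioo 0 h) := by
      rintro _ ⟨_, ⟨ξ, hξ, rfl⟩, t, ⟨ht0, ht1⟩, rfl⟩
      have hρξ := (hB0 ξ hξ).2.2.2.2.2
      have hρp : 0 < ρ ξ := (by positivity : 0 < ρ ξ₀ / L).trans hρξ.1
      have htη : |t| < η := by
        rw [abs_of_pos ht0]
        refine ht1.trans (lt_of_le_of_lt ?_ hh0)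
        gcongr
        exact (hρξ.1.trans hρξ.2).le
      have hb := (hBb ξ hξ t htη).1
      refine ⟨ξ + t • outerNormal Ω ξ, ⟨ξ, hξ, t / ρ ξ, ⟨by positivity, ?_⟩, ?_⟩, ?_⟩
      · rw [div_lt_iff₀ hρp]
        exact ht1.trans (by gcongr; exact hρξ.1)
      · rw [div_mul_cancel₀ _ hρp.ne']
      · rw [← hb.2.2.2, Ψ.left_inv hb.2.2.1]
    have hS : slice Ω ρ B (Ioo 0 h) ⊆ S₂ := by
      rintro _ ⟨ξ, hξ, r, ⟨hr0, hr1⟩, rfl⟩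
      have hρξ := (hB0 ξ hξ).2.2.2.2.2
      have hρp : 0 < ρ ξ := (by positivity : 0 < ρ ξ₀ / L).trans hρξ.1
      have hle : r * ρ ξ ≤ h * (L * ρ ξ₀) := mul_le_mul hr1.le hρξ.2.le hρp.le hh.le
      have hb := hBb ξ hξ (r * ρ ξ) (by rw [abs_of_pos (by positivity)]; exact hle.trans_lt hh0)
      rw [← hb.1.2.2.2]
      exact hb.2.2.1
    have hFB : σ B ≤ (L : ℝ≥0∞) ^ (n - 1) * σ (F '' B) := by
      have h1 : F.symm '' (F '' B) = B := by
        rw [image_image]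
        exact (image_congr fun ξ hξ => F.left_inv (hB0 ξ hξ).1.1).trans (image_id B)
      have h2 := (hl₄.mono (s := F '' B) (by
        rintro _ ⟨ξ, hξ, rfl⟩; exact (hB0 ξ hξ).2.2.2.2.1)).euclideanHausdorffMeasure_image_le (n - 1)
      rwa [h1] at h2
    have hρL : ENNReal.ofReal (ρ ξ₀) = L * ENNReal.ofReal (ρ ξ₀ / L) := by
      rw [← hlL, ← ENNReal.ofReal_mul hL0.le, mul_div_cancel₀ _ hL0.ne']
    calc ENNReal.ofReal h * R ≤ ENNReal.ofReal h * ((L : ℝ≥0∞) * (ENNReal.ofReal (ρ ξ₀) *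
            ((L : ℝ≥0∞) ^ (n - 1) * σ (F '' B)))) := by
          refine mul_le_mul_right (hR2.trans ?_) _
          gcongr
      _ = (L : ℝ≥0∞) ^ ((n - 1) + 2) * (σ (F '' B) * volume (Ioo 0 (h * (ρ ξ₀ / L)))) := by
          rw [Real.volume_Ioo, sub_zero, ENNReal.ofReal_mul hh.le, hρL]
          ring
      _ ≤ (L : ℝ≥0∞) ^ ((n - 1) + 2) * ((L : ℝ≥0∞) ^ n * volume (slice Ω ρ B (Ioo 0 h))) := by
          refine mul_le_mul_right ?_ _
          rw [← volume_cylinder he hcyl]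
          exact (measure_mono hsub).trans (hl₂.mono hS).volume_image_le
      _ = _ := by ring

end Slice

/-! ### Volume of slices up to a factor 1 + O(s) -/

section SliceVolume

variable {n : ℕ} {Ω : Set (EuclideanSpace ℝ (Fin n))} {ρ : EuclideanSpace ℝ (Fin n) → ℝ}
  {τ : ℝ} {π : EuclideanSpace ℝ (Fin n) → EuclideanSpace ℝ (Fin n)}
  {d : EuclideanSpace ℝ (Fin n) → ℝ}

theorem isCompact_frontier (hb : Bornology.IsBounded Ω) : IsCompact (frontier Ω) :=
  hb.isCompact_closure.of_isClosed_subset isClosed_frontier frontier_subset_closure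

theorem slice_mono {B B' : Set (EuclideanSpace ℝ (Fin n))} {I I' : Set ℝ} (hB : B ⊆ B') (hI : I ⊆ I') :
    slice Ω ρ B I ⊆ slice Ω ρ B' I' := by
  rintro _ ⟨ξ, hξ, r, hr, rfl⟩
  exact ⟨ξ, hB hξ, r, hI hr, rfl⟩

theorem slice_union_left (B B' : Set (EuclideanSpace ℝ (Fin n))) (I : Set ℝ) :
    slice Ω ρ (B ∪ B') I ⊆ slice Ω ρ B I ∪ slice Ω ρ B' I := by
  rintro _ ⟨ξ, hξ | hξ, r, hr, rfl⟩
  · exact Or.inl ⟨ξ, hξ, r, hr, rfl⟩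
  · exact Or.inr ⟨ξ, hξ, r, hr, rfl⟩

theorem slice_union_right (B : Set (EuclideanSpace ℝ (Fin n))) (I J : Set ℝ) :
    slice Ω ρ B (I ∪ J) ⊆ slice Ω ρ B I ∪ slice Ω ρ B J := by
  rintro _ ⟨ξ, hξ, r, hr | hr, rfl⟩
  · exact Or.inl ⟨ξ, hξ, r, hr, rfl⟩
  · exact Or.inr ⟨ξ, hξ, r, hr, rfl⟩

/-- `s₀` is a width for which the slices stay well inside the tube. -/
structure IsAdmissibleWidth (Ω : Set (EuclideanSpace ℝ (Fin n))) (ρ : EuclideanSpace ℝ (Fin n) → ℝ)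
    (τ s₀ : ℝ) : Prop where
  pos : 0 < s₀
  width_pos : ∀ ξ ∈ frontier Ω, 0 < ρ ξ
  mul_lt : ∀ ξ ∈ frontier Ω, s₀ * ρ ξ < τ / 2

theorem exists_isAdmissibleWidth (hb : Bornology.IsBounded Ω) (hρ : ContinuousOn ρ (frontier Ω))
    (hρ_pos : ∀ ξ ∈ frontier Ω, 0 < ρ ξ) (hτ : 0 < τ) : ∃ s₀, IsAdmissibleWidth Ω ρ τ s₀ := by
  obtain ⟨M, hM⟩ := (isCompact_frontier hb).exists_bound_of_continuousOn hρ
  have hM1 : 0 < |M| + 1 := by positivity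
  refine ⟨τ / 2 / (|M| + 1), by positivity, hρ_pos, fun ξ hξ => ?_⟩
  have h1 : ρ ξ < |M| + 1 := by
    have := hM ξ hξ
    rw [Real.norm_eq_abs] at this
    linarith [le_abs_self (ρ ξ), le_abs_self M]
  calc τ / 2 / (|M| + 1) * ρ ξ < τ / 2 / (|M| + 1) * (|M| + 1) := by gcongr
    _ = τ / 2 := by field_simp

variable {s₀ : ℝ}

theorem IsAdmissibleWidth.abs_mul_lt (h : IsAdmissibleWidth Ω ρ τ s₀)
    {ξ : EuclideanSpace ℝ (Fin n)} (hξ : ξ ∈ frontier Ω) {r : ℝ} (hr : r ∈ Icc 0 s₀) :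
    |r * ρ ξ| < τ / 2 := by
  have hp := h.width_pos ξ hξ
  rw [abs_of_nonneg (mul_nonneg hr.1 hp.le)]
  exact (mul_le_mul_of_nonneg_right hr.2 hp.le).trans_lt (h.mul_lt ξ hξ)

theorem IsTube.apply_slice (ht : IsTube Ω τ π d) (h : IsAdmissibleWidth Ω ρ τ s₀)
    {ξ : EuclideanSpace ℝ (Fin n)} (hξ : ξ ∈ frontier Ω) {r : ℝ} (hr : r ∈ Icc 0 s₀) :
    π (ξ + (r * ρ ξ) • outerNormal Ω ξ) = ξ ∧ d (ξ + (r * ρ ξ) • outerNormal Ω ξ) = r * ρ ξ := by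
  have h1 := (h.abs_mul_lt hξ hr).trans (half_lt_self ht.pos)
  exact ⟨ht.proj_apply ξ hξ _ h1, ht.dist_apply ξ hξ _ h1⟩

/-- The closed half-width tube is compact and lies in the open tube, so C¹ data on the tube are
Lipschitz, with bounded derivatives, on all admissible slices. -/
theorem slice_subset_cthickening (hΩ : IsOpen Ω) (hC2 : HasC2Boundary Ω)
    (h : IsAdmissibleWidth Ω ρ τ s₀) {B : Set (EuclideanSpace ℝ (Fin n))} (hB : B ⊆ frontier Ω)
    {I : Set ℝ} (hI : I ⊆ Icc 0 s₀) : slice Ω ρ B I ⊆ Metric.cthickening (τ / 2) (frontier Ω) := by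
  rintro _ ⟨ξ, hξ, r, hr, rfl⟩
  exact Metric.thickening_subset_cthickening _ _
    (add_smul_outerNormal_mem_thickening hΩ hC2 (hB hξ) (h.abs_mul_lt (hB hξ) (hI hr)))

theorem IsTube.cthickening_subset (ht : IsTube Ω τ π d) :
    Metric.cthickening (τ / 2) (frontier Ω) ⊆ Metric.thickening τ (frontier Ω) :=
  Metric.cthickening_subset_thickening' ht.pos (half_lt_self ht.pos) _

/-- Feet are unique, so a slice over part of Γ is a preimage under `π`. This makes the volume of a
slice additive in its base. -/
theorem IsTube.slice_eq_inter (ht : IsTube Ω τ π d) (h : IsAdmissibleWidth Ω ρ τ s₀)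
    {B : Set (EuclideanSpace ℝ (Fin n))} {I : Set ℝ} (hI : I ⊆ Icc 0 s₀) :
    slice Ω ρ (frontier Ω ∩ B) I = slice Ω ρ (frontier Ω) I ∩ π ⁻¹' B := by
  ext x
  constructor
  · rintro ⟨ξ, ⟨hξ, hξB⟩, r, hr, rfl⟩
    refine ⟨⟨ξ, hξ, r, hr, rfl⟩, ?_⟩
    rw [mem_preimage, (ht.apply_slice h hξ (hI hr)).1]
    exact hξB
  · rintro ⟨⟨ξ, hξ, r, hr, rfl⟩, hx⟩
    rw [mem_preimage, (ht.apply_slice h hξ (hI hr)).1] at hx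
    exact ⟨ξ, ⟨hξ, hx⟩, r, hr, rfl⟩

theorem IsTube.slice_Ioo_eq (ht : IsTube Ω τ π d) (hΩ : IsOpen Ω) (hC2 : HasC2Boundary Ω)
    (h : IsAdmissibleWidth Ω ρ τ s₀) {a b : ℝ} (ha : 0 ≤ a) (hb : b ≤ s₀) :
    slice Ω ρ (frontier Ω) (Ioo a b) =
      {x ∈ Metric.thickening τ (frontier Ω) | a * ρ (π x) < d x ∧ d x < b * ρ (π x)} := by
  have hI : Ioo a b ⊆ Icc 0 s₀ := fun r hr => ⟨ha.trans hr.1.le, hr.2.le.trans hb⟩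
  ext x
  constructor
  · intro hx
    refine ⟨ht.cthickening_subset (slice_subset_cthickening hΩ hC2 h subset_rfl hI hx), ?_⟩
    obtain ⟨ξ, hξ, r, hr, rfl⟩ := hx
    have hp := h.width_pos ξ hξ
    obtain ⟨h1, h2⟩ := ht.apply_slice h hξ (hI hr)
    rw [h1, h2]
    exact ⟨by gcongr; exact hr.1, by gcongr; exact hr.2⟩
  · rintro ⟨hx, h1, h2⟩
    have hp := h.width_pos _ (ht.proj_mem x hx)
    refine ⟨π x, ht.proj_mem x hx, d x / ρ (π x), ⟨(lt_div_iff₀ hp).2 h1, (div_lt_iff₀ hp).2 h2⟩, ?_⟩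
    rw [div_mul_cancel₀ _ hp.ne']
    exact ht.eq_add x hx

theorem IsTube.isOpen_slice (ht : IsTube Ω τ π d) (hΩ : IsOpen Ω) (hC2 : HasC2Boundary Ω)
    (hρ : ContinuousOn ρ (frontier Ω))
    (h : IsAdmissibleWidth Ω ρ τ s₀) {a b : ℝ} (ha : 0 ≤ a) (hb : b ≤ s₀) :
    IsOpen (slice Ω ρ (frontier Ω) (Ioo a b)) := by
  rw [ht.slice_Ioo_eq hΩ hC2 h ha hb]
  have hTo : IsOpen (Metric.thickening τ (frontier Ω)) := Metric.isOpen_thickening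
  have hρπ : ContinuousOn (fun x => ρ (π x)) (Metric.thickening τ (frontier Ω)) :=
    hρ.comp ht.contDiffOn_proj.continuousOn ht.proj_mem
  have hd := ht.contDiffOn_dist.continuousOn
  have h1 : ContinuousOn (fun x => (d x - a * ρ (π x), b * ρ (π x) - d x))
      (Metric.thickening τ (frontier Ω)) :=
    (hd.sub (continuousOn_const.mul hρπ)).prodMk ((continuousOn_const.mul hρπ).sub hd)
  have h2 := h1.isOpen_inter_preimage hTo (isOpen_Ioi (a := (0 : ℝ)).prod (isOpen_Ioi (a := (0 : ℝ))))
  convert h2 using 1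
  ext x
  simp only [mem_ofPred_eq, mem_inter_iff, mem_preimage, mem_prod, mem_Ioi, sub_pos]

theorem IsTube.measurableSet_slice (ht : IsTube Ω τ π d) (hΩ : IsOpen Ω) (hC2 : HasC2Boundary Ω)
    (hρ : ContinuousOn ρ (frontier Ω)) (h : IsAdmissibleWidth Ω ρ τ s₀)
    {B : Set (EuclideanSpace ℝ (Fin n))} (hB : B ⊆ frontier Ω) (hBm : MeasurableSet B)
    {a b : ℝ} (ha : 0 ≤ a) (hb : b ≤ s₀) : MeasurableSet (slice Ω ρ B (Ioo a b)) := by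
  have hI : Ioo a b ⊆ Icc 0 s₀ := fun r hr => ⟨ha.trans hr.1.le, hr.2.le.trans hb⟩
  rw [← inter_eq_right.2 hB, ht.slice_eq_inter h hI]
  exact (ht.isOpen_slice hΩ hC2 hρ h ha hb).measurableSet.inter (ht.measurable_proj hBm)

theorem exists_lipschitzOnWith_of_contDiffOn {E F : Type*} [NormedAddCommGroup E] [NormedSpace ℝ E]
    [NormedAddCommGroup F] [NormedSpace ℝ F] {f : E → F} {K T : Set E} (hK : IsCompact K)
    (hT : IsOpen T) (hKT : K ⊆ T) (hf : ContDiffOn ℝ 1 f T) : ∃ C, LipschitzOnWith C f K := by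
  refine LocallyLipschitzOn.exists_lipschitzOnWith_of_compact hK fun x hx => ?_
  obtain ⟨C, s, hs, hC⟩ := (hf.contDiffAt (hT.mem_nhds (hKT hx))).exists_lipschitzOnWith
  exact ⟨C, s, mem_nhdsWithin_of_mem_nhds hs, hC⟩

/-- Shifting a slice along the normals changes its volume by a factor close to one. -/
theorem IsTube.exists_volume_shift_le (ht : IsTube Ω τ π d) (hΩ : IsOpen Ω)
    (hb : Bornology.IsBounded Ω) (hC2 : HasC2Boundary Ω)
    (hρ : ContDiffOn ℝ 1 ρ (frontier Ω)) (h : IsAdmissibleWidth Ω ρ τ s₀) :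
    ∃ C : ℝ, 0 ≤ C ∧ ∀ B ⊆ frontier Ω, ∀ I ⊆ Icc 0 s₀, ∀ (J : Set ℝ) (t : ℝ), (∀ r ∈ J, r - t ∈ I) →
      volume (slice Ω ρ B J) ≤ ENNReal.ofReal (1 + C * |t|) ^ n * volume (slice Ω ρ B I) := by
  have hK : IsCompact (Metric.cthickening (τ / 2) (frontier Ω)) := (isCompact_frontier hb).cthickening
  have hV : ContDiffOn ℝ 1 (fun x => ρ (π x) • outerNormal Ω (π x)) (Metric.thickening τ (frontier Ω)) :=
    (hρ.comp ht.contDiffOn_proj ht.proj_mem).smul ht.contDiffOn_normal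
  obtain ⟨C, hC⟩ := exists_lipschitzOnWith_of_contDiffOn hK Metric.isOpen_thickening
    ht.cthickening_subset hV
  refine ⟨C, C.2, fun B hB I hI J t hJ => ?_⟩
  -- The map adds `t` to the coordinate r and fixes the foot; it differs from the identity by `t`
  -- times a C-Lipschitz field.
  have hsub : slice Ω ρ B J ⊆ (fun x => x + t • (ρ (π x) • outerNormal Ω (π x))) '' slice Ω ρ B I := by
    rintro _ ⟨ξ, hξ, r, hr, rfl⟩
    refine ⟨_, ⟨ξ, hξ, r - t, hJ r hr, rfl⟩, ?_⟩
    simp only [(ht.apply_slice h (hB hξ) (hI (hJ r hr))).1]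
    rw [add_assoc, smul_smul, ← add_smul]
    congr 2
    ring
  have hlip : LipschitzOnWith (Real.toNNReal (1 + C * |t|))
      (fun x => x + t • (ρ (π x) • outerNormal Ω (π x))) (slice Ω ρ B I) := by
    refine LipschitzOnWith.of_dist_le_mul fun x hx y hy => ?_
    have h1 := hC.dist_le_mul x (slice_subset_cthickening hΩ hC2 h hB hI hx) y
      (slice_subset_cthickening hΩ hC2 h hB hI hy)
    have hC0 : (0 : ℝ) ≤ C := C.2
    rw [Real.coe_toNNReal _ (by positivity)]
    refine (dist_add_add_le _ _ _ _).trans ?_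
    rw [dist_smul₀, Real.norm_eq_abs]
    calc dist x y + |t| * _ ≤ dist x y + |t| * (C * dist x y) := by gcongr
      _ = _ := by ring
  exact (measure_mono hsub).trans hlip.volume_image_le

/-- For short slices, the comparison of the volume with the surface integral holds uniformly along the
boundary. -/
theorem IsTube.exists_volume_bounds (ht : IsTube Ω τ π d) (hΩ : IsOpen Ω)
    (hb : Bornology.IsBounded Ω) (hC2 : HasC2Boundary Ω)
    (hρ : ContinuousOn ρ (frontier Ω)) (h : IsAdmissibleWidth Ω ρ τ s₀) {L : ℝ≥0} (hL : 1 < L) :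
    ∃ h₀ > 0, ∀ B ⊆ frontier Ω, MeasurableSet B → ∀ t : ℝ, 0 < t → t < h₀ →
      volume (slice Ω ρ B (Ioc 0 t)) ≤ (L : ℝ≥0∞) ^ (n + (n - 1) + 2) * (ENNReal.ofReal t *
        ∫⁻ ξ in B, ENNReal.ofReal (ρ ξ) ∂(Measure.euclideanHausdorffMeasure (n - 1))) ∧
      ENNReal.ofReal t * ∫⁻ ξ in B, ENNReal.ofReal (ρ ξ) ∂(Measure.euclideanHausdorffMeasure (n - 1)) ≤
        (L : ℝ≥0∞) ^ (n + (n - 1) + 2) * volume (slice Ω ρ B (Ioo 0 t)) := by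
  -- The compactness induction runs over arbitrary sets, whereas splitting `B` needs measurable
  -- pieces; hence the measurable superset `K'`.
  set P : Set (EuclideanSpace ℝ (Fin n)) → Prop := fun K => ∃ K', K ⊆ K' ∧ MeasurableSet K' ∧
    ∃ h₀ > 0, ∀ B ⊆ frontier Ω ∩ K', MeasurableSet B → ∀ t : ℝ, 0 < t → t < h₀ →
      volume (slice Ω ρ B (Ioc 0 t)) ≤ (L : ℝ≥0∞) ^ (n + (n - 1) + 2) * (ENNReal.ofReal t *
        ∫⁻ ξ in B, ENNReal.ofReal (ρ ξ) ∂(Measure.euclideanHausdorffMeasure (n - 1))) ∧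
      ENNReal.ofReal t * ∫⁻ ξ in B, ENNReal.ofReal (ρ ξ) ∂(Measure.euclideanHausdorffMeasure (n - 1)) ≤
        (L : ℝ≥0∞) ^ (n + (n - 1) + 2) * volume (slice Ω ρ B (Ioo 0 t)) with hP
  have key : P (frontier Ω) := by
    refine (isCompact_frontier hb).induction_on ?_ ?_ ?_ ?_
    · refine ⟨∅, subset_rfl, MeasurableSet.empty, 1, one_pos, fun B hB _ t _ _ => ?_⟩
      rw [inter_empty, subset_empty_iff] at hB
      subst hB
      simp [slice]
    · rintro s t hst ⟨K', h1, h2⟩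
      exact ⟨K', hst.trans h1, h2⟩
    · rintro s t ⟨K₁, hs, hm₁, h₁, hp₁, hB₁⟩ ⟨K₂, ht', hm₂, h₂, hp₂, hB₂⟩
      refine ⟨K₁ ∪ K₂, union_subset_union hs ht', hm₁.union hm₂, min (min h₁ h₂) s₀,
        lt_min (lt_min hp₁ hp₂) h.pos, fun B hB hBm r hr0 hr => ?_⟩
      have hr1 : r < h₁ := hr.trans_le ((min_le_left _ _).trans (min_le_left _ _))
      have hr2 : r < h₂ := hr.trans_le ((min_le_left _ _).trans (min_le_right _ _))
      have hr3 : r ≤ s₀ := (hr.trans_le (min_le_right _ _)).le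
      have hBΓ : B ⊆ frontier Ω := hB.trans inter_subset_left
      obtain ⟨a1, a2⟩ := hB₁ (B ∩ K₁) (inter_subset_inter hBΓ subset_rfl) (hBm.inter hm₁) r hr0 hr1
      obtain ⟨b1, b2⟩ := hB₂ (B \ K₁) (fun x hx => ⟨hBΓ hx.1, (hB hx.1).2.resolve_left hx.2⟩)
        (hBm.diff hm₁) r hr0 hr2
      rw [← lintegral_inter_add_sdiff (A := B) _ hm₁, mul_add, mul_add]
      constructor
      · refine le_trans ?_ (add_le_add a1 b1)
        refine (measure_mono ?_).trans (measure_union_le _ _)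
        refine subset_trans ?_ (slice_union_left _ _ _)
        rw [inter_union_sdiff]
      · refine (add_le_add a2 b2).trans ?_
        rw [← mul_add]
        refine mul_le_mul_right (le_of_eq ?_) _
        have hI : Ioo 0 r ⊆ Icc 0 s₀ := fun x hx => ⟨hx.1.le, hx.2.le.trans hr3⟩
        have e0 : slice Ω ρ B (Ioo 0 r) = slice Ω ρ (frontier Ω ∩ B) (Ioo 0 r) := by
          rw [inter_eq_right.2 hBΓ]
        have e1 : slice Ω ρ (B ∩ K₁) (Ioo 0 r) = slice Ω ρ B (Ioo 0 r) ∩ π ⁻¹' K₁ := by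
          rw [e0, ht.slice_eq_inter h hI, inter_assoc, ← preimage_inter, ← ht.slice_eq_inter h hI,
            ← inter_assoc, inter_eq_right.2 hBΓ]
        have e2 : slice Ω ρ (B \ K₁) (Ioo 0 r) = slice Ω ρ B (Ioo 0 r) \ π ⁻¹' K₁ := by
          rw [e0, ht.slice_eq_inter h hI, inter_sdiff_assoc, ← preimage_sdiff, ← ht.slice_eq_inter h hI,
            ← inter_sdiff_assoc, inter_eq_right.2 hBΓ]
        rw [e1, e2, measure_inter_add_sdiff _ (ht.measurable_proj hm₁)]
    · intro ξ hξ
      obtain ⟨W, hW, h₀, hh₀, hB⟩ := exists_local_volume_bounds hΩ hC2 hξ (hρ ξ hξ)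
        (h.width_pos ξ hξ) hL
      obtain ⟨O, hOW, hO, hξO⟩ := mem_nhds_iff.1 hW
      exact ⟨O, mem_nhdsWithin_of_mem_nhds (hO.mem_nhds hξO), O, subset_rfl, hO.measurableSet, h₀, hh₀,
        fun B hBO => hB B (hBO.trans (inter_subset_inter_right _ hOW))⟩
  obtain ⟨K', hK', -, h₀, hh₀, hB⟩ := key
  exact ⟨h₀, hh₀, fun B hBΓ => hB B fun x hx => ⟨hBΓ hx, hK' (hBΓ hx)⟩⟩

theorem _root_.ENNReal.le_of_forall_one_lt_le_pow_mul {a b : ℝ≥0∞} (k : ℕ)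
    (h : ∀ L : ℝ≥0, 1 < L → a ≤ (L : ℝ≥0∞) ^ k * b) : a ≤ b := by
  rcases eq_or_ne b ⊤ with rfl | hb
  · exact le_top
  have hc : Tendsto (fun L : ℝ≥0 => (L : ℝ≥0∞) ^ k * b) (𝓝[>] 1) (𝓝 (((1 : ℝ≥0) : ℝ≥0∞) ^ k * b)) := by
    refine Tendsto.mono_left ?_ nhdsWithin_le_nhds
    refine ENNReal.Tendsto.mul_const ?_ (Or.inr hb)
    exact ((ENNReal.continuous_pow k).comp ENNReal.continuous_coe).tendsto 1
  simp only [ENNReal.coe_one, one_pow, one_mul] at hc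
  refine ge_of_tendsto hc ?_
  filter_upwards [self_mem_nhdsWithin] with L hL using h L hL

/-- The volume of a slice of width `s` is the surface integral of its width, up to a factor
`1 + O(s)`. -/
theorem IsTube.exists_volume_slice_bounds (ht : IsTube Ω τ π d) (hΩ : IsOpen Ω)
    (hb : Bornology.IsBounded Ω) (hC2 : HasC2Boundary Ω)
    (hρ : ContDiffOn ℝ 1 ρ (frontier Ω)) (h : IsAdmissibleWidth Ω ρ τ s₀) :
    ∃ C : ℝ, 0 ≤ C ∧ ∀ B ⊆ frontier Ω, MeasurableSet B → ∀ s : ℝ, 0 < s → s ≤ s₀ →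
      volume (slice Ω ρ B (Ioo 0 s)) ≤ ENNReal.ofReal (1 + C * s) ^ n * (ENNReal.ofReal s *
        ∫⁻ ξ in B, ENNReal.ofReal (ρ ξ) ∂(Measure.euclideanHausdorffMeasure (n - 1))) ∧
      ENNReal.ofReal s * ∫⁻ ξ in B, ENNReal.ofReal (ρ ξ) ∂(Measure.euclideanHausdorffMeasure (n - 1)) ≤
        ENNReal.ofReal (1 + C * s) ^ n * volume (slice Ω ρ B (Ioo 0 s)) := by
  obtain ⟨C, hC0, hC⟩ := ht.exists_volume_shift_le hΩ hb hC2 hρ h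
  refine ⟨C, hC0, fun B hB hBm s hs hs0 => ?_⟩
  set R := ∫⁻ ξ in B, ENNReal.ofReal (ρ ξ) ∂(Measure.euclideanHausdorffMeasure (n - 1)) with hR
  set c := ENNReal.ofReal (1 + C * s) ^ n with hc
  have hcmono : ∀ t : ℝ, |t| ≤ s → ENNReal.ofReal (1 + C * |t|) ^ n ≤ c := fun t ht => by
    rw [hc]; gcongr
  -- Upper bound: half-open intervals leave no gap, and each piece is a shift of the first.
  have hup : ∀ t : ℝ, 0 < t → ∀ k : ℕ, k * t ≤ s →
      volume (slice Ω ρ B (Ioc 0 (k * t))) ≤ k * (c * volume (slice Ω ρ B (Ioc 0 t))) := by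
    intro t ht0 k
    induction k with
    | zero => intro _; simp [slice]
    | succ k ih =>
      intro hk
      push_cast at hk ⊢
      have hk' : k * t ≤ s := by nlinarith
      have hkt : 0 ≤ k * t := by positivity
      have htk : t ≤ s := by nlinarith
      have hsub : Ioc 0 ((k + 1) * t) ⊆ Ioc 0 (k * t) ∪ Ioc (k * t) ((k + 1) * t) := by
        rw [Ioc_union_Ioc_eq_Ioc hkt (by nlinarith)]
      have h1 := hC B hB (Ioc 0 t) (fun r hr => ⟨hr.1.le, hr.2.trans (htk.trans hs0)⟩)
        (Ioc (k * t) ((k + 1) * t)) (k * t) (fun r hr => ⟨by linarith [hr.1], by linarith [hr.2]⟩)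
      calc volume (slice Ω ρ B (Ioc 0 ((k + 1) * t)))
          ≤ volume (slice Ω ρ B (Ioc 0 (k * t)) ∪ slice Ω ρ B (Ioc (k * t) ((k + 1) * t))) :=
            measure_mono ((slice_mono subset_rfl hsub).trans (slice_union_right _ _ _))
        _ ≤ _ := measure_union_le _ _
        _ ≤ k * (c * volume (slice Ω ρ B (Ioc 0 t))) + c * volume (slice Ω ρ B (Ioc 0 t)) := by
            refine add_le_add (ih hk') (h1.trans ?_)
            gcongr
            exact hcmono _ (by rw [abs_of_nonneg hkt]; exact hk')
        _ = _ := by ring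
  -- Lower bound: open intervals give disjoint measurable slices, each of which can be shifted back
  -- to the first. The omitted endpoints do no harm.
  have hlow : ∀ t : ℝ, 0 < t → ∀ k : ℕ, k * t ≤ s →
      k * volume (slice Ω ρ B (Ioo 0 t)) ≤ c * volume (slice Ω ρ B (Ioo 0 (k * t))) := by
    intro t ht0 k
    induction k with
    | zero => intro _; simp
    | succ k ih =>
      intro hk
      push_cast at hk ⊢
      have hk' : k * t ≤ s := by nlinarith
      have hkt : 0 ≤ k * t := by positivity
      have h1 := hC B hB (Ioo (k * t) ((k + 1) * t))
        (fun r hr => ⟨hkt.trans hr.1.le, hr.2.le.trans (hk.trans hs0)⟩)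
        (Ioo 0 t) (-(k * t)) (fun r hr => ⟨by linarith [hr.1], by linarith [hr.2]⟩)
      have hdisj : Disjoint (slice Ω ρ B (Ioo 0 (k * t))) (slice Ω ρ B (Ioo (k * t) ((k + 1) * t))) := by
        refine Disjoint.mono (slice_mono hB subset_rfl) (slice_mono hB subset_rfl) ?_
        rw [ht.slice_Ioo_eq hΩ hC2 h le_rfl (hk'.trans hs0), ht.slice_Ioo_eq hΩ hC2 h hkt (hk.trans hs0)]
        rw [Set.disjoint_left]
        rintro x ⟨-, -, h1⟩ ⟨-, h2, -⟩
        exact lt_asymm h1 h2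
      calc ((k : ℝ≥0∞) + 1) * volume (slice Ω ρ B (Ioo 0 t))
          = k * volume (slice Ω ρ B (Ioo 0 t)) + volume (slice Ω ρ B (Ioo 0 t)) := by ring
        _ ≤ c * volume (slice Ω ρ B (Ioo 0 (k * t))) +
            c * volume (slice Ω ρ B (Ioo (k * t) ((k + 1) * t))) := by
            refine add_le_add (ih hk') (h1.trans ?_)
            gcongr
            exact hcmono _ (by rw [abs_neg, abs_of_nonneg hkt]; exact hk')
        _ = c * volume (slice Ω ρ B (Ioo 0 (k * t)) ∪ slice Ω ρ B (Ioo (k * t) ((k + 1) * t))) := by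
            rw [measure_union hdisj (ht.measurableSet_slice hΩ hC2 hρ.continuousOn h hB hBm hkt
              (hk.trans hs0)), mul_add]
        _ ≤ _ := by
            refine mul_le_mul_right (measure_mono (union_subset ?_ ?_)) _
            · exact slice_mono subset_rfl (Ioo_subset_Ioo_right (by nlinarith))
            · exact slice_mono subset_rfl (Ioo_subset_Ioo_left hkt)
  -- The number of pieces depends on L through `h₀`, but it cancels in the estimate, so L → 1 is
  -- harmless.
  have hN : ∀ h₀ : ℝ, 0 < h₀ → ∃ N : ℕ, 0 < N ∧ s / N < h₀ := by
    intro h₀ hh₀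
    obtain ⟨N, hN⟩ := exists_nat_gt (s / h₀)
    have hN0 : (0 : ℝ) < N := (by positivity : 0 < s / h₀).trans hN
    refine ⟨N, by exact_mod_cast hN0, ?_⟩
    rw [div_lt_iff₀ hh₀] at hN
    rw [div_lt_iff₀ hN0]
    linarith
  have hNs : ∀ N : ℕ, 0 < N → (N : ℝ≥0∞) * ENNReal.ofReal (s / N) = ENNReal.ofReal s := by
    intro N hN
    have hN' : (0 : ℝ) < N := by exact_mod_cast hN
    rw [← ENNReal.ofReal_natCast, ← ENNReal.ofReal_mul (by positivity), mul_div_cancel₀ _ hN'.ne']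
  constructor
  · refine ENNReal.le_of_forall_one_lt_le_pow_mul (n + (n - 1) + 2) fun L hL => ?_
    obtain ⟨h₀, hh₀, hvol⟩ := ht.exists_volume_bounds hΩ hb hC2 hρ.continuousOn h hL
    obtain ⟨N, hN0, hNlt⟩ := hN h₀ hh₀
    have hN' : (0 : ℝ) < N := by exact_mod_cast hN0
    have hNs' : N * (s / N) = s := by field_simp
    have h1 := hup (s / N) (by positivity) N hNs'.le
    have h2 := (hvol B hB hBm (s / N) (by positivity) hNlt).1
    rw [hNs'] at h1
    calc volume (slice Ω ρ B (Ioo 0 s)) ≤ volume (slice Ω ρ B (Ioc 0 s)) :=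
          measure_mono (slice_mono subset_rfl Ioo_subset_Ioc_self)
      _ ≤ _ := h1
      _ ≤ N * (c * ((L : ℝ≥0∞) ^ (n + (n - 1) + 2) * (ENNReal.ofReal (s / N) * R))) := by gcongr
      _ = (L : ℝ≥0∞) ^ (n + (n - 1) + 2) * (c * ((N * ENNReal.ofReal (s / N)) * R)) := by ring
      _ = _ := by rw [hNs N hN0]
  · refine ENNReal.le_of_forall_one_lt_le_pow_mul (n + (n - 1) + 2) fun L hL => ?_
    obtain ⟨h₀, hh₀, hvol⟩ := ht.exists_volume_bounds hΩ hb hC2 hρ.continuousOn h hL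
    obtain ⟨N, hN0, hNlt⟩ := hN h₀ hh₀
    have hN' : (0 : ℝ) < N := by exact_mod_cast hN0
    have hNs' : N * (s / N) = s := by field_simp
    have h1 := hlow (s / N) (by positivity) N hNs'.le
    have h2 := (hvol B hB hBm (s / N) (by positivity) hNlt).2
    rw [hNs'] at h1
    calc ENNReal.ofReal s * R = N * (ENNReal.ofReal (s / N) * R) := by rw [← mul_assoc, hNs N hN0]
      _ ≤ N * ((L : ℝ≥0∞) ^ (n + (n - 1) + 2) * volume (slice Ω ρ B (Ioo 0 (s / N)))) := by gcongr
      _ = (L : ℝ≥0∞) ^ (n + (n - 1) + 2) * (N * volume (slice Ω ρ B (Ioo 0 (s / N)))) := by ring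
      _ ≤ _ := by gcongr

end SliceVolume

/-! ### The first-order tube formula -/

section SurfaceIntegral

variable {n : ℕ} {Ω : Set (EuclideanSpace ℝ (Fin n))} {ρ : EuclideanSpace ℝ (Fin n) → ℝ}
  {τ s₀ : ℝ} {π : EuclideanSpace ℝ (Fin n) → EuclideanSpace ℝ (Fin n)}
  {d : EuclideanSpace ℝ (Fin n) → ℝ}

theorem exists_one_add_mul_pow_le {C : ℝ} (hC : 0 ≤ C) (n : ℕ) :
    ∃ D : ℝ, 0 ≤ D ∧ ∀ x ∈ Icc (0 : ℝ) 1, (1 + C * x) ^ n ≤ 1 + D * x := by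
  induction n with
  | zero => exact ⟨0, le_rfl, by simp⟩
  | succ n ih =>
    obtain ⟨D, hD, h⟩ := ih
    refine ⟨D + C + C * D, by positivity, fun x hx => ?_⟩
    have hx0 := hx.1
    have hx2 : x * x ≤ x := mul_le_of_le_one_left hx.1 hx.2
    calc (1 + C * x) ^ (n + 1) = (1 + C * x) ^ n * (1 + C * x) := pow_succ _ _
      _ ≤ (1 + D * x) * (1 + C * x) := by gcongr; exact h x hx
      _ = 1 + (D + C) * x + C * D * (x * x) := by ring
      _ ≤ 1 + (D + C) * x + C * D * x := by gcongr
      _ = _ := by ring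

theorem isBounded_slice (hΩ : IsOpen Ω) (hb : Bornology.IsBounded Ω) (hC2 : HasC2Boundary Ω)
    (hρ : ContinuousOn ρ (frontier Ω)) {I : Set ℝ} (hI : Bornology.IsBounded I) :
    Bornology.IsBounded (slice Ω ρ (frontier Ω) I) := by
  obtain ⟨M, hM⟩ := (isCompact_frontier hb).exists_bound_of_continuousOn hρ
  obtain ⟨R, hR⟩ := (isCompact_frontier hb).isBounded.exists_norm_le
  obtain ⟨S, hS⟩ := hI.exists_norm_le
  refine isBounded_iff_forall_norm_le.2 ⟨R + S * M, ?_⟩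
  rintro _ ⟨ξ, hξ, r, hr, rfl⟩
  refine (norm_add_le _ _).trans (add_le_add (hR ξ hξ) ?_)
  rw [norm_smul, norm_outerNormal hΩ hC2 hξ, mul_one, norm_mul]
  exact mul_le_mul (hS r hr) (hM ξ hξ) (norm_nonneg _) ((norm_nonneg _).trans (hS r hr))

/-- The lower volume bound controls the surface integral by the volume of a bounded slice. -/
theorem IsTube.lintegral_width_lt_top (ht : IsTube Ω τ π d) (hΩ : IsOpen Ω)
    (hb : Bornology.IsBounded Ω) (hC2 : HasC2Boundary Ω)
    (hρ : ContDiffOn ℝ 1 ρ (frontier Ω)) (h : IsAdmissibleWidth Ω ρ τ s₀) :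
    ∫⁻ ξ in frontier Ω, ENNReal.ofReal (ρ ξ) ∂(Measure.euclideanHausdorffMeasure (n - 1)) < ⊤ := by
  obtain ⟨C, hC0, hC⟩ := ht.exists_volume_slice_bounds hΩ hb hC2 hρ h
  have h1 := (hC (frontier Ω) subset_rfl isClosed_frontier.measurableSet s₀ h.pos le_rfl).2
  have h2 : ENNReal.ofReal (1 + C * s₀) ^ n * volume (slice Ω ρ (frontier Ω) (Ioo 0 s₀)) < ⊤ :=
    ENNReal.mul_lt_top (ENNReal.pow_lt_top ENNReal.ofReal_lt_top)
      (isBounded_slice hΩ hb hC2 hρ.continuousOn (Metric.isBounded_Ioo 0 s₀)).measure_lt_top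
  by_contra hcon
  rw [not_lt, top_le_iff] at hcon
  rw [hcon, ENNReal.mul_top (by simpa using h.pos)] at h1
  exact absurd h2 (not_lt.2 h1)

/-- The boundary has finite surface measure. -/
theorem IsTube.euclideanHausdorffMeasure_frontier_lt_top (ht : IsTube Ω τ π d) (hΩ : IsOpen Ω)
    (hb : Bornology.IsBounded Ω) (hC2 : HasC2Boundary Ω)
    (hρ : ContDiffOn ℝ 1 ρ (frontier Ω)) (h : IsAdmissibleWidth Ω ρ τ s₀) :
    Measure.euclideanHausdorffMeasure (n - 1) (frontier Ω) < ⊤ := by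
  rcases (frontier Ω).eq_empty_or_nonempty with he | hne
  · simp [he]
  obtain ⟨ξ, hξ, hmin⟩ := (isCompact_frontier hb).exists_isMinOn hne hρ.continuousOn
  have h1 : ENNReal.ofReal (ρ ξ) * Measure.euclideanHausdorffMeasure (n - 1) (frontier Ω) < ⊤ := by
    rw [← setLIntegral_const]
    refine lt_of_le_of_lt ?_ (ht.lintegral_width_lt_top hΩ hb hC2 hρ h)
    exact setLIntegral_mono' isClosed_frontier.measurableSet fun x hx => ENNReal.ofReal_le_ofReal (hmin hx)
  by_contra hcon
  rw [not_lt, top_le_iff] at hcon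
  rw [hcon, ENNReal.mul_top (by simpa using h.width_pos ξ hξ)] at h1
  exact lt_irrefl _ h1

/-- The normal tube formula, to first order, for functions that are constant along the normals. -/
theorem IsTube.exists_integral_slice_sub_le (ht : IsTube Ω τ π d) (hΩ : IsOpen Ω)
    (hb : Bornology.IsBounded Ω) (hC2 : HasC2Boundary Ω)
    (hρ : ContDiffOn ℝ 1 ρ (frontier Ω)) (h : IsAdmissibleWidth Ω ρ τ s₀)
    {g : EuclideanSpace ℝ (Fin n) → ℝ} (hg : ContinuousOn g (frontier Ω))
    (hg0 : ∀ ξ ∈ frontier Ω, 0 ≤ g ξ) :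
    ∃ D : ℝ, ∀ s : ℝ, 0 < s → s ≤ s₀ → s ≤ 1 →
      |(∫ x in slice Ω ρ (frontier Ω) (Ioo 0 s), g (π x)) -
        s * ∫ ξ in frontier Ω, ρ ξ * g ξ ∂(Measure.euclideanHausdorffMeasure (n - 1))| ≤ D * s ^ 2 := by
  obtain ⟨C, hC0, hC⟩ := ht.exists_volume_slice_bounds hΩ hb hC2 hρ h
  obtain ⟨D, hD0, hD⟩ := exists_one_add_mul_pow_le hC0 n
  have hΓm : MeasurableSet (frontier Ω) := isClosed_frontier.measurableSet
  set σ := (Measure.euclideanHausdorffMeasure (n - 1) : Measure (EuclideanSpace ℝ (Fin n))) with hσ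
  classical
  set f : EuclideanSpace ℝ (Fin n) → ℝ≥0∞ :=
    fun x => ENNReal.ofReal ((frontier Ω).piecewise g 0 x) with hf
  have hfm : Measurable f :=
    (hg.measurable_piecewise continuousOn_const hΓm).ennreal_ofReal
  have hfg : ∀ ξ ∈ frontier Ω, f ξ = ENNReal.ofReal (g ξ) := fun ξ hξ => by
    simp only [hf, piecewise_eq_of_mem _ _ _ hξ]
  have hρm : AEMeasurable (fun ξ => ENNReal.ofReal (ρ ξ)) (σ.restrict (frontier Ω)) :=
    (hρ.continuousOn.aemeasurable hΓm).ennreal_ofReal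
  set Q := ∫⁻ ξ in frontier Ω, ENNReal.ofReal (ρ ξ) * f ξ ∂σ with hQ
  set μ := (σ.restrict (frontier Ω)).withDensity fun ξ => ENNReal.ofReal (ρ ξ) with hμ
  have hQμ : ∫⁻ ξ, f ξ ∂μ = Q := by
    rw [hμ, lintegral_withDensity_eq_lintegral_mul₀ hρm hfm.aemeasurable]
    rfl
  have hQtop : Q < ⊤ := by
    obtain ⟨M, hM⟩ := (isCompact_frontier hb).exists_bound_of_continuousOn hg
    have h1 : Q ≤ ∫⁻ ξ in frontier Ω, ENNReal.ofReal (ρ ξ) * ENNReal.ofReal M ∂σ := by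
      refine setLIntegral_mono' hΓm fun ξ hξ => ?_
      rw [hfg ξ hξ]
      gcongr
      exact (le_abs_self _).trans (hM ξ hξ)
    refine h1.trans_lt ?_
    rw [lintegral_mul_const' _ _ ENNReal.ofReal_ne_top]
    exact ENNReal.mul_lt_top (ht.lintegral_width_lt_top hΩ hb hC2 hρ h) ENNReal.ofReal_lt_top
  have hQint : ∫ ξ in frontier Ω, ρ ξ * g ξ ∂σ = Q.toReal := by
    rw [integral_eq_lintegral_of_nonneg_ae, hQ]
    · congr 1
      refine setLIntegral_congr_fun hΓm fun ξ hξ => ?_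
      simp only [hfg ξ hξ]
      rw [ENNReal.ofReal_mul (h.width_pos ξ hξ).le]
    · filter_upwards [ae_restrict_mem hΓm] with ξ hξ using
        mul_nonneg (h.width_pos ξ hξ).le (hg0 ξ hξ)
    · exact (hρ.continuousOn.mul hg).aestronglyMeasurable hΓm
  -- Writing A for the integral over the slice, A - sQ ≤ Ds·sQ and sQ - A ≤ Ds·A, while A ≤ (1 + D)
  -- sQ because s ≤ 1.
  refine ⟨(1 + D) * D * Q.toReal, fun s hs hs0 hs1 => ?_⟩
  have hI : Ioo 0 s ⊆ Icc 0 s₀ := fun r hr => ⟨hr.1.le, hr.2.le.trans hs0⟩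
  set S := slice Ω ρ (frontier Ω) (Ioo 0 s) with hS
  have hSm : MeasurableSet S := (ht.isOpen_slice hΩ hC2 hρ.continuousOn h le_rfl hs0).measurableSet
  have hST : S ⊆ Metric.thickening τ (frontier Ω) :=
    (slice_subset_cthickening hΩ hC2 h subset_rfl hI).trans ht.cthickening_subset
  set κ := (volume.restrict S).map π with hκ
  set c := ENNReal.ofReal (1 + C * s) ^ n with hc
  set A := ∫⁻ x in S, f (π x) with hA
  have hAκ : ∫⁻ ξ, f ξ ∂κ = A := lintegral_map hfm ht.measurable_proj
  have hκB : ∀ B, MeasurableSet B → κ B = volume (slice Ω ρ (frontier Ω ∩ B) (Ioo 0 s)) := by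
    intro B hB
    rw [hκ, Measure.map_apply ht.measurable_proj hB, Measure.restrict_apply (ht.measurable_proj hB),
      ht.slice_eq_inter h hI, inter_comm]
  have hμB : ∀ B, MeasurableSet B → μ B = ∫⁻ ξ in frontier Ω ∩ B, ENNReal.ofReal (ρ ξ) ∂σ := by
    intro B hB
    rw [hμ, withDensity_apply _ hB, Measure.restrict_restrict hB, inter_comm]
  -- Volume bounds over every Borel part of Γ say exactly that the pushforward of volume and s ρ σ
  -- dominate each other up to `c`; no approximation by step functions is needed.
  have hle1 : κ ≤ (c * ENNReal.ofReal s) • μ := by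
    refine Measure.le_iff.2 fun B hB => ?_
    rw [Measure.smul_apply, smul_eq_mul, hκB B hB, hμB B hB, mul_assoc]
    exact (hC _ inter_subset_left (hΓm.inter hB) s hs hs0).1
  have hle2 : ENNReal.ofReal s • μ ≤ c • κ := by
    refine Measure.le_iff.2 fun B hB => ?_
    rw [Measure.smul_apply, Measure.smul_apply, smul_eq_mul, smul_eq_mul, hκB B hB, hμB B hB]
    exact (hC _ inter_subset_left (hΓm.inter hB) s hs hs0).2
  have hA1 : A ≤ c * ENNReal.ofReal s * Q := by
    rw [← hAκ, ← hQμ, ← smul_eq_mul, ← lintegral_smul_measure]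
    exact lintegral_mono' hle1 le_rfl
  have hA2 : ENNReal.ofReal s * Q ≤ c * A := by
    rw [← hAκ, ← hQμ, ← smul_eq_mul, ← smul_eq_mul, ← lintegral_smul_measure, ← lintegral_smul_measure]
    exact lintegral_mono' hle2 le_rfl
  have hcs : 0 ≤ 1 + C * s := by positivity
  have hctop : c < ⊤ := ENNReal.pow_lt_top ENNReal.ofReal_lt_top
  have hcr : c.toReal = (1 + C * s) ^ n := by
    rw [hc, ENNReal.toReal_pow, ENNReal.toReal_ofReal hcs]
  have hAtop : A < ⊤ := hA1.trans_lt (ENNReal.mul_lt_top (ENNReal.mul_lt_top hctop ENNReal.ofReal_lt_top) hQtop)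
  have hr1 : A.toReal ≤ (1 + C * s) ^ n * s * Q.toReal := by
    have := ENNReal.toReal_mono (ENNReal.mul_lt_top (ENNReal.mul_lt_top hctop ENNReal.ofReal_lt_top) hQtop).ne hA1
    rwa [ENNReal.toReal_mul, ENNReal.toReal_mul, hcr, ENNReal.toReal_ofReal hs.le] at this
  have hr2 : s * Q.toReal ≤ (1 + C * s) ^ n * A.toReal := by
    have := ENNReal.toReal_mono (ENNReal.mul_lt_top hctop hAtop).ne hA2
    rwa [ENNReal.toReal_mul, ENNReal.toReal_mul, hcr, ENNReal.toReal_ofReal hs.le] at this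
  have hAint : ∫ x in S, g (π x) = A.toReal := by
    rw [integral_eq_lintegral_of_nonneg_ae, hA]
    · congr 1
      exact setLIntegral_congr_fun hSm fun x hx => (hfg _ (ht.proj_mem x (hST hx))).symm
    · filter_upwards [ae_restrict_mem hSm] with x hx using hg0 _ (ht.proj_mem x (hST hx))
    · refine ContinuousOn.aestronglyMeasurable ?_ hSm
      exact hg.comp (ht.contDiffOn_proj.continuousOn.mono hST) fun x hx => ht.proj_mem x (hST hx)
  rw [hQint, hAint]
  have hp := hD s ⟨hs.le, hs1⟩
  have hA0 : 0 ≤ A.toReal := ENNReal.toReal_nonneg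
  have hQ0 : 0 ≤ Q.toReal := ENNReal.toReal_nonneg
  set P := (1 + C * s) ^ n
  have e1 : A.toReal ≤ (1 + D * s) * (s * Q.toReal) :=
    hr1.trans (by rw [mul_assoc]; gcongr)
  have e2 : s * Q.toReal ≤ (1 + D * s) * A.toReal := hr2.trans (by gcongr)
  have hsQ : 0 ≤ s * Q.toReal := by positivity
  have hDs : D * s ≤ D := mul_le_of_le_one_right hD0 hs1
  have e3 : A.toReal ≤ (1 + D) * (s * Q.toReal) := e1.trans (by gcongr)
  have e4 : D * s * A.toReal ≤ D * s * ((1 + D) * (s * Q.toReal)) := by gcongr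
  have e5 : D * s * (s * Q.toReal) ≤ D * s * ((1 + D) * (s * Q.toReal)) :=
    mul_le_mul_of_nonneg_left (by nlinarith) (by positivity)
  rw [abs_le]
  constructor <;> nlinarith

end SurfaceIntegral

/-! ### The affine extension and its gradient -/

section AffineExtension

variable {n : ℕ} {Ω : Set (EuclideanSpace ℝ (Fin n))} {ρ u : EuclideanSpace ℝ (Fin n) → ℝ}
  {G : EuclideanSpace ℝ (Fin n) → EuclideanSpace ℝ (Fin n)}
  {τ s₀ ε : ℝ} {π : EuclideanSpace ℝ (Fin n) → EuclideanSpace ℝ (Fin n)}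
  {d w : EuclideanSpace ℝ (Fin n) → ℝ}

/-- The affine profile in tubular coordinates. -/
def affineProfile (ρ u : EuclideanSpace ℝ (Fin n) → ℝ)
    (π : EuclideanSpace ℝ (Fin n) → EuclideanSpace ℝ (Fin n)) (d : EuclideanSpace ℝ (Fin n) → ℝ)
    (ε : ℝ) (x : EuclideanSpace ℝ (Fin n)) : ℝ :=
  u (π x) * (1 - d x / (ε * ρ (π x)))

/-- The product form isolates ε⁻¹ and leaves the factors `d` and 1/ρ(π), whose derivatives do not
involve ε. -/
theorem affineProfile_eq (x : EuclideanSpace ℝ (Fin n)) :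
    affineProfile ρ u π d ε x = u (π x) * (1 - ε⁻¹ * (d x * (ρ (π x))⁻¹)) := by
  rw [affineProfile, div_eq_mul_inv, mul_inv]
  ring

theorem IsTube.dist_mem (ht : IsTube Ω τ π d) (h : IsAdmissibleWidth Ω ρ τ s₀) (hε : ε ≤ s₀)
    {x : EuclideanSpace ℝ (Fin n)} (hx : x ∈ slice Ω ρ (frontier Ω) (Ioo 0 ε)) :
    π x ∈ frontier Ω ∧ 0 < d x ∧ d x < ε * ρ (π x) := by
  obtain ⟨ξ, hξ, r, hr, rfl⟩ := hx
  obtain ⟨h1, h2⟩ := ht.apply_slice h hξ ⟨hr.1.le, hr.2.le.trans hε⟩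
  have hp := h.width_pos ξ hξ
  rw [h1, h2]
  exact ⟨hξ, mul_pos hr.1 hp, by gcongr; exact hr.2⟩

/-- The gradient of the affine profile is, up to a bounded error, in the normal direction. -/
theorem IsTube.exists_gradient_affineProfile_bound (ht : IsTube Ω τ π d) (hΩ : IsOpen Ω)
    (hb : Bornology.IsBounded Ω) (hC2 : HasC2Boundary Ω)
    (hρ : ContDiffOn ℝ 1 ρ (frontier Ω)) (h : IsAdmissibleWidth Ω ρ τ s₀)
    (hu : ContinuousOn u (closure Ω)) (hG : ∀ x ∈ Ω, HasGradientAt u (G x) x)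
    (hGc : ContinuousOn G (closure Ω)) :
    ∃ M : ℝ, 0 ≤ M ∧ ∀ ε : ℝ, 0 < ε → ε ≤ s₀ → ∀ x ∈ slice Ω ρ (frontier Ω) (Ioo 0 ε),
      ∃ g, HasGradientAt (affineProfile ρ u π d ε) g x ∧
        ‖g + (u (π x) / (ε * ρ (π x))) • outerNormal Ω (π x)‖ ≤ M := by
  have hΓK := isCompact_frontier hb
  have hK : IsCompact (Metric.cthickening (τ / 2) (frontier Ω)) := hΓK.cthickening
  have hTo : IsOpen (Metric.thickening τ (frontier Ω)) := Metric.isOpen_thickening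
  set S : EuclideanSpace ℝ (Fin n) → ℝ := fun x => (ρ (π x))⁻¹ with hS
  have hSc : ContDiffOn ℝ 1 S (Metric.thickening τ (frontier Ω)) :=
    (hρ.comp ht.contDiffOn_proj ht.proj_mem).inv fun x hx => (h.width_pos _ (ht.proj_mem x hx)).ne'
  obtain ⟨Mπ, hMπ⟩ := hK.exists_bound_of_continuousOn
    ((ht.contDiffOn_proj.continuousOn_fderiv_of_isOpen hTo le_rfl).mono ht.cthickening_subset)
  obtain ⟨MS, hMS⟩ := hK.exists_bound_of_continuousOn
    ((hSc.continuousOn_fderiv_of_isOpen hTo le_rfl).mono ht.cthickening_subset)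
  obtain ⟨Mu, hMu⟩ := hΓK.exists_bound_of_continuousOn (hu.mono frontier_subset_closure)
  obtain ⟨MG, hMG⟩ := hΓK.exists_bound_of_continuousOn (hGc.mono frontier_subset_closure)
  obtain ⟨Mρ, hMρ⟩ := hΓK.exists_bound_of_continuousOn hρ.continuousOn
  set J := InnerProductSpace.toDual ℝ (EuclideanSpace ℝ (Fin n)) with hJ
  -- The first product bounds the derivative of u∘π, the second that of 1/ρ∘π weighted by u d/ε with
  -- d/ε < ρ. The absolute value gives nonnegativity without a case split on Γ being empty.
  refine ⟨|MG * Mπ + Mu * Mρ * MS|, abs_nonneg _, fun ε hε hεs x hx => ?_⟩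
  have hxK : x ∈ Metric.cthickening (τ / 2) (frontier Ω) :=
    slice_subset_cthickening hΩ hC2 h subset_rfl (fun r hr => ⟨hr.1.le, hr.2.le.trans hεs⟩) hx
  have hxT := ht.cthickening_subset hxK
  have hTx := hTo.mem_nhds hxT
  obtain ⟨hξ, hd0, hd1⟩ := ht.dist_mem h hεs hx
  have hρp := h.width_pos _ hξ
  set A := (J (G (π x))).comp (fderiv ℝ π x) with hA
  set B := fderiv ℝ S x with hB
  -- Since `π` takes values in Γ, differentiability of `u` relative to Γ suffices.
  have hUd : HasFDerivAt (fun y => u (π y)) A x := by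
    have h1 := (hasFDerivWithinAt_frontier hΩ hC2 hξ hu hG hGc).comp x
      ((ht.contDiffOn_proj.contDiffAt hTx).differentiableAt (by norm_num)).hasFDerivAt.hasFDerivWithinAt
      ht.proj_mem
    exact h1.hasFDerivAt hTx
  have hSd : HasFDerivAt S B x :=
    ((hSc.contDiffAt hTx).differentiableAt (by norm_num)).hasFDerivAt
  have hdd : HasFDerivAt d (J (outerNormal Ω (π x))) x := (ht.hasGradientAt_dist hΩ hC2 hxT).hasFDerivAt
  set F' : EuclideanSpace ℝ (Fin n) →L[ℝ] ℝ :=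
    u (π x) • -(ε⁻¹ • (d x • B + S x • J (outerNormal Ω (π x)))) + (1 - ε⁻¹ * (d x * S x)) • A with hF'
  have hW : HasFDerivAt (fun y => u (π y) * (1 - ε⁻¹ * (d y * S y))) F' x :=
    hUd.mul (((hdd.mul hSd).const_mul ε⁻¹).const_sub 1)
  have heq : affineProfile ρ u π d ε = fun y => u (π y) * (1 - ε⁻¹ * (d y * S y)) :=
    funext fun y => affineProfile_eq y
  refine ⟨J.symm F', ?_, ?_⟩
  · rw [heq, hasGradientAt_iff_hasFDerivAt]
    exact hW.congr_fderiv (J.apply_symm_apply _).symm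
  · rw [← J.norm_map, map_add, J.apply_symm_apply]
    have e1 : J ((u (π x) / (ε * ρ (π x))) • outerNormal Ω (π x)) =
        (u (π x) * ε⁻¹ * S x) • J (outerNormal Ω (π x)) := by
      rw [map_smulₛₗ, hS]
      simp only [conj_trivial]
      congr 1
      field_simp
    rw [e1]
    have e2 : F' + (u (π x) * ε⁻¹ * S x) • J (outerNormal Ω (π x)) =
        (1 - ε⁻¹ * (d x * S x)) • A - (u (π x) * (ε⁻¹ * d x)) • B := by
      rw [hF']; module
    rw [e2]
    have hSpos : 0 < S x := inv_pos.2 hρp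
    have f0 : 0 < ε⁻¹ * d x := by positivity
    have f1 : ε⁻¹ * d x < ρ (π x) := by
      rw [inv_mul_lt_iff₀ hε]; exact hd1
    have f2 : ε⁻¹ * (d x * S x) < 1 := by
      rw [← mul_assoc, hS]
      simp only
      rw [mul_inv_lt_iff₀ hρp, one_mul]
      exact f1
    have f3 : 0 < ε⁻¹ * (d x * S x) := by positivity
    have hAn : ‖A‖ ≤ MG * Mπ := by
      refine (ContinuousLinearMap.opNorm_comp_le _ _).trans ?_
      rw [J.norm_map]
      exact mul_le_mul (hMG _ hξ) (hMπ x hxK) (norm_nonneg _) ((norm_nonneg _).trans (hMG _ hξ))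
    have hMρ' : ‖ε⁻¹ * d x‖ ≤ Mρ := by
      rw [Real.norm_eq_abs, abs_of_pos f0]
      exact f1.le.trans ((le_abs_self _).trans (hMρ _ hξ))
    have hBn : ‖(u (π x) * (ε⁻¹ * d x)) • B‖ ≤ Mu * Mρ * MS := by
      rw [norm_smul, norm_mul]
      have g1 := hMu _ hξ
      have g2 := hMS x hxK
      have g3 := (norm_nonneg _).trans g1
      have g4 := (norm_nonneg _).trans hMρ'
      gcongr
    refine le_trans ?_ (le_abs_self _)
    refine (norm_sub_le _ _).trans (add_le_add ?_ hBn)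
    rw [norm_smul, Real.norm_eq_abs, abs_of_pos (by linarith)]
    exact (mul_le_of_le_one_left (norm_nonneg _) (by linarith)).trans hAn

theorem IsTube.affineProfile_apply (ht : IsTube Ω τ π d) (h : IsAdmissibleWidth Ω ρ τ s₀)
    (hε : ε ≤ s₀) {ξ : EuclideanSpace ℝ (Fin n)} (hξ : ξ ∈ frontier Ω) {t : ℝ} (ht0 : 0 < t)
    (ht1 : t < ε * ρ ξ) :
    affineProfile ρ u π d ε (ξ + t • outerNormal Ω ξ) = u ξ * (1 - t / (ε * ρ ξ)) := by
  have hp := h.width_pos ξ hξ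
  have h1 : |t| < τ := by
    rw [abs_of_pos ht0]
    have := h.mul_lt ξ hξ
    have := mul_le_mul_of_nonneg_right hε hp.le
    linarith [ht.pos]
  rw [affineProfile, ht.proj_apply ξ hξ t h1, ht.dist_apply ξ hξ t h1]

theorem IsTube.disjoint_slice (ht : IsTube Ω τ π d) (hΩ : IsOpen Ω) (hC2 : HasC2Boundary Ω)
    (h : IsAdmissibleWidth Ω ρ τ s₀) (hε : ε ≤ s₀) {x : EuclideanSpace ℝ (Fin n)}
    (hx : x ∈ slice Ω ρ (frontier Ω) (Ioo 0 ε)) : x ∉ Ω := by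
  have hxT := ht.cthickening_subset (slice_subset_cthickening hΩ hC2 h subset_rfl
    (fun r hr => ⟨hr.1.le, hr.2.le.trans hε⟩) hx)
  rw [ht.mem_iff x hxT, not_lt]
  exact (ht.dist_mem h hε hx).2.1.le

/-- The prescriptions are consistent: each layer point has a single foot and height, and the layer
misses `Ω` because d > 0 there. -/
theorem IsTube.exists_isAffineExtension (ht : IsTube Ω τ π d) (hΩ : IsOpen Ω) (hC2 : HasC2Boundary Ω)
    (h : IsAdmissibleWidth Ω ρ τ s₀) (hε : ε ≤ s₀) : ∃ w, IsAffineExtension Ω ρ u ε w := by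
  classical
  refine ⟨Ω.piecewise u (affineProfile ρ u π d ε), Ω.piecewise_eqOn _ _, fun ξ hξ t ht0 ht1 => ?_⟩
  have hx : ξ + t • outerNormal Ω ξ ∈ slice Ω ρ (frontier Ω) (Ioo 0 ε) := by
    rw [← layer_eq_slice h.width_pos]
    exact ⟨ξ, hξ, t, ht0, ht1, rfl⟩
  rw [piecewise_eq_of_notMem _ _ _ (ht.disjoint_slice hΩ hC2 h hε hx)]
  exact ht.affineProfile_apply h hε hξ ht0 ht1

theorem IsTube.eqOn_slice (ht : IsTube Ω τ π d) (h : IsAdmissibleWidth Ω ρ τ s₀) (hε : ε ≤ s₀)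
    (hw : IsAffineExtension Ω ρ u ε w) :
    EqOn w (affineProfile ρ u π d ε) (slice Ω ρ (frontier Ω) (Ioo 0 ε)) := by
  rw [← layer_eq_slice h.width_pos]
  rintro _ ⟨ξ, hξ, t, ht0, ht1, rfl⟩
  rw [hw.2 ξ hξ t ht0 ht1, ht.affineProfile_apply h hε hξ ht0 ht1]

/-- The coated domain is open. -/
theorem IsTube.isOpen_coatedDomain (ht : IsTube Ω τ π d) (hΩ : IsOpen Ω) (hC2 : HasC2Boundary Ω)
    (hρ : ContinuousOn ρ (frontier Ω)) (h : IsAdmissibleWidth Ω ρ τ s₀) (hε0 : 0 < ε) (hε : ε ≤ s₀) :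
    IsOpen (coatedDomain Ω ρ ε) := by
  have hTo : IsOpen (Metric.thickening τ (frontier Ω)) := Metric.isOpen_thickening
  have hρπ : ContinuousOn (fun x => ρ (π x)) (Metric.thickening τ (frontier Ω)) :=
    hρ.comp ht.contDiffOn_proj.continuousOn ht.proj_mem
  have hc : ContinuousOn (fun x => ε * ρ (π x) - d x) (Metric.thickening τ (frontier Ω)) :=
    (continuousOn_const.mul hρπ).sub ht.contDiffOn_dist.continuousOn
  have ho := hc.isOpen_inter_preimage hTo (isOpen_Ioi (a := (0 : ℝ)))
  convert hΩ.union ho using 1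
  rw [coatedDomain, layer_eq_slice h.width_pos]
  ext x
  constructor
  · rintro ((hx | hx) | hx)
    · exact Or.inl hx
    · rw [ht.slice_Ioo_eq hΩ hC2 h le_rfl hε] at hx
      exact Or.inr ⟨hx.1, sub_pos.2 hx.2.2⟩
    · have h1 := ht.proj_apply x hx 0 (by simpa using ht.pos)
      have h2 := ht.dist_apply x hx 0 (by simpa using ht.pos)
      rw [zero_smul, add_zero] at h1 h2
      refine Or.inr ⟨Metric.self_subset_thickening ht.pos _ hx, ?_⟩
      rw [mem_preimage, h1, h2, mem_Ioi, sub_zero]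
      exact mul_pos hε0 (h.width_pos x hx)
  · rintro (hx | ⟨hxT, hx⟩)
    · exact Or.inl (Or.inl hx)
    · rcases lt_trichotomy (d x) 0 with hd | hd | hd
      · exact Or.inl (Or.inl ((ht.mem_iff x hxT).2 hd))
      · refine Or.inr ?_
        have := ht.eq_add x hxT
        rw [hd, zero_smul, add_zero] at this
        rw [this]
        exact ht.proj_mem x hxT
      · refine Or.inl (Or.inr ?_)
        rw [ht.slice_Ioo_eq hΩ hC2 h le_rfl hε]
        exact ⟨hxT, by simpa using hd, sub_pos.1 hx⟩

/-- The affine extension vanishes on the outer boundary. -/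
theorem IsTube.tendsto_affineExtension (ht : IsTube Ω τ π d) (hΩ : IsOpen Ω) (hC2 : HasC2Boundary Ω)
    (hρ : ContinuousOn ρ (frontier Ω)) (h : IsAdmissibleWidth Ω ρ τ s₀)
    (hu : ContinuousOn u (closure Ω)) (hε0 : 0 < ε) (hε : ε ≤ s₀) (hw : IsAffineExtension Ω ρ u ε w)
    {y : EuclideanSpace ℝ (Fin n)} (hy : y ∈ frontier (coatedDomain Ω ρ ε)) :
    Tendsto w (𝓝[layer Ω ρ ε] y) (𝓝 0) := by
  have hyc : y ∉ coatedDomain Ω ρ ε := by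
    rw [(ht.isOpen_coatedDomain hΩ hC2 hρ h hε0 hε).frontier_eq] at hy
    exact hy.2
  rw [layer_eq_slice h.width_pos]
  set S := slice Ω ρ (frontier Ω) (Ioo 0 ε) with hS
  by_cases hcl : y ∈ closure S
  swap
  · rw [mem_closure_iff_nhdsWithin_neBot, not_neBot] at hcl
    rw [hcl]
    exact tendsto_bot
  have hne : (𝓝[S] y).NeBot := mem_closure_iff_nhdsWithin_neBot.1 hcl
  have hSK : S ⊆ Metric.cthickening (τ / 2) (frontier Ω) :=
    slice_subset_cthickening hΩ hC2 h subset_rfl (fun r hr => ⟨hr.1.le, hr.2.le.trans hε⟩)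
  have hyT : y ∈ Metric.thickening τ (frontier Ω) :=
    ht.cthickening_subset (closure_minimal hSK Metric.isClosed_cthickening hcl)
  have hTo : IsOpen (Metric.thickening τ (frontier Ω)) := Metric.isOpen_thickening
  have hTy := hTo.mem_nhds hyT
  have hπc := ht.contDiffOn_proj.continuousOn
  have hρπ : ContinuousAt (fun x => ρ (π x)) y := (hρ.comp hπc ht.proj_mem).continuousAt hTy
  have huπ : ContinuousAt (fun x => u (π x)) y :=
    ((hu.mono frontier_subset_closure).comp hπc ht.proj_mem).continuousAt hTy
  have hdc : ContinuousAt d y := ht.contDiffOn_dist.continuousOn.continuousAt hTy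
  have hξ := ht.proj_mem y hyT
  have hρp := h.width_pos _ hξ
  have hd0 : 0 ≤ d y := by
    refine ge_of_tendsto (hdc.tendsto.mono_left (nhdsWithin_le_nhds (s := S))) ?_
    filter_upwards [self_mem_nhdsWithin] with x hx using (ht.dist_mem h hε hx).2.1.le
  have hd1 : d y ≤ ε * ρ (π y) := by
    refine le_of_tendsto_of_tendsto (hdc.tendsto.mono_left (nhdsWithin_le_nhds (s := S)))
      ((hρπ.tendsto.const_mul ε).mono_left (nhdsWithin_le_nhds (s := S))) ?_
    filter_upwards [self_mem_nhdsWithin] with x hx using (ht.dist_mem h hε hx).2.2.le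
  -- Strict inequality would put `y` on Γ or in the layer, inside the open coated domain, which
  -- contains none of its boundary points.
  have hd : d y = ε * ρ (π y) := by
    refine le_antisymm hd1 ?_
    by_contra! hlt
    refine hyc ?_
    rcases hd0.eq_or_lt with h0 | h0
    · refine Or.inr ?_
      have := ht.eq_add y hyT
      rw [← h0, zero_smul, add_zero] at this
      rw [this]
      exact hξ
    · refine Or.inl (Or.inr ?_)
      rw [layer_eq_slice h.width_pos, ht.slice_Ioo_eq hΩ hC2 h le_rfl hε]
      exact ⟨hyT, by simpa using h0, hlt⟩
  have hlim : Tendsto (affineProfile ρ u π d ε) (𝓝 y) (𝓝 0) := by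
    have hc : ContinuousAt (fun x => u (π x) * (1 - d x / (ε * ρ (π x)))) y :=
      huπ.mul (continuousAt_const.sub (hdc.div (continuousAt_const.mul hρπ) (by positivity)))
    have := hc.tendsto
    simp only [hd, div_self (show ε * ρ (π y) ≠ 0 by positivity), sub_self, mul_zero] at this
    exact this
  refine (hlim.mono_left nhdsWithin_le_nhds).congr' ?_
  filter_upwards [self_mem_nhdsWithin] with x hx using (ht.eqOn_slice h hε hw hx).symm

/-- The affine extension is differentiable off the boundary, with a gradient that is explicit up to a
bounded error in the layer. -/
theorem IsTube.exists_gradient_affineExtension_bound (ht : IsTube Ω τ π d) (hΩ : IsOpen Ω)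
    (hb : Bornology.IsBounded Ω) (hC2 : HasC2Boundary Ω)
    (hρ : ContDiffOn ℝ 1 ρ (frontier Ω)) (h : IsAdmissibleWidth Ω ρ τ s₀)
    (hu : ContinuousOn u (closure Ω)) (hG : ∀ x ∈ Ω, HasGradientAt u (G x) x)
    (hGc : ContinuousOn G (closure Ω)) :
    ∃ M : ℝ, 0 ≤ M ∧ ∀ ε : ℝ, 0 < ε → ε ≤ s₀ → ∀ w, IsAffineExtension Ω ρ u ε w →
      (∀ x ∈ Ω ∪ layer Ω ρ ε, HasGradientAt w (gradient w x) x) ∧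
      (∀ x ∈ Ω, gradient w x = G x) ∧
      ∀ x ∈ layer Ω ρ ε, |ε * ‖gradient w x‖ - |u (π x)| / ρ (π x)| ≤ M * ε := by
  obtain ⟨M, hM0, hM⟩ := ht.exists_gradient_affineProfile_bound hΩ hb hC2 hρ h hu hG hGc
  refine ⟨M, hM0, fun ε hε0 hε w hw => ?_⟩
  rw [layer_eq_slice h.width_pos]
  have h1 : ∀ x ∈ Ω, HasGradientAt w (G x) x := fun x hx => by
    have := (hG x hx).hasFDerivAt.congr_of_eventuallyEq
      (show w =ᶠ[𝓝 x] u from hw.1.eventuallyEq_of_mem (hΩ.mem_nhds hx))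
    exact this
  have hSo := ht.isOpen_slice hΩ hC2 hρ.continuousOn h le_rfl hε
  have h2 : ∀ x ∈ slice Ω ρ (frontier Ω) (Ioo 0 ε), ∃ g, HasGradientAt w g x ∧
      ‖g + (u (π x) / (ε * ρ (π x))) • outerNormal Ω (π x)‖ ≤ M := fun x hx => by
    obtain ⟨g, hg, hgM⟩ := hM ε hε0 hε x hx
    refine ⟨g, ?_, hgM⟩
    have := hg.hasFDerivAt.congr_of_eventuallyEq
      (show w =ᶠ[𝓝 x] _ from (ht.eqOn_slice h hε hw).eventuallyEq_of_mem (hSo.mem_nhds hx))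
    exact this
  refine ⟨?_, fun x hx => (h1 x hx).gradient, fun x hx => ?_⟩
  · rintro x (hx | hx)
    · rw [(h1 x hx).gradient]; exact h1 x hx
    · obtain ⟨g, hg, -⟩ := h2 x hx
      rw [hg.gradient]; exact hg
  · obtain ⟨g, hg, hgM⟩ := h2 x hx
    rw [hg.gradient]
    have hξ := (ht.dist_mem h hε hx).1
    have hρp := h.width_pos _ hξ
    have e1 : ‖(u (π x) / (ε * ρ (π x))) • outerNormal Ω (π x)‖ = ε⁻¹ * (|u (π x)| / ρ (π x)) := by
      rw [norm_smul, norm_outerNormal hΩ hC2 hξ, mul_one, Real.norm_eq_abs, abs_div,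
        abs_of_pos (show 0 < ε * ρ (π x) by positivity)]
      field_simp
    have e2 : |‖g‖ - ε⁻¹ * (|u (π x)| / ρ (π x))| ≤ M := by
      rw [← e1, ← norm_neg ((u (π x) / (ε * ρ (π x))) • outerNormal Ω (π x))]
      refine (abs_norm_sub_norm_le _ _).trans ?_
      rwa [sub_neg_eq_add]
    have e3 : ε * ‖g‖ - |u (π x)| / ρ (π x) = ε * (‖g‖ - ε⁻¹ * (|u (π x)| / ρ (π x))) := by
      field_simp
    rw [e3, abs_mul, abs_of_pos hε0, mul_comm]
    gcongr

end AffineExtension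

/-! ### Sobolev regularity and the energy in the layer -/

section Energy

variable {n : ℕ} {Ω : Set (EuclideanSpace ℝ (Fin n))} {ρ u : EuclideanSpace ℝ (Fin n) → ℝ}
  {G : EuclideanSpace ℝ (Fin n) → EuclideanSpace ℝ (Fin n)}
  {τ s₀ ε : ℝ} {π : EuclideanSpace ℝ (Fin n) → EuclideanSpace ℝ (Fin n)}
  {d w : EuclideanSpace ℝ (Fin n) → ℝ}

theorem measurable_gradient (f : EuclideanSpace ℝ (Fin n) → ℝ) : Measurable (gradient f) :=
  (InnerProductSpace.toDual ℝ (EuclideanSpace ℝ (Fin n))).symm.continuous.measurable.comp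
    (measurable_fderiv ℝ f)

theorem isBounded_layer (hΩ : IsOpen Ω) (hb : Bornology.IsBounded Ω) (hC2 : HasC2Boundary Ω)
    (hρ : ContinuousOn ρ (frontier Ω)) (hρ_pos : ∀ ξ ∈ frontier Ω, 0 < ρ ξ) (ε : ℝ) :
    Bornology.IsBounded (layer Ω ρ ε) := by
  rw [layer_eq_slice hρ_pos]
  exact isBounded_slice hΩ hb hC2 hρ (Metric.isBounded_Ioo 0 ε)

/-- The volume of the layer is of the order of its width. -/
theorem IsTube.exists_volume_layer_le (ht : IsTube Ω τ π d) (hΩ : IsOpen Ω)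
    (hb : Bornology.IsBounded Ω) (hC2 : HasC2Boundary Ω)
    (hρ : ContDiffOn ℝ 1 ρ (frontier Ω)) (h : IsAdmissibleWidth Ω ρ τ s₀) :
    ∃ D : ℝ, 0 ≤ D ∧ ∀ ε : ℝ, 0 < ε → ε ≤ s₀ → ε ≤ 1 → volume.real (layer Ω ρ ε) ≤ D * ε := by
  obtain ⟨D, hD⟩ := ht.exists_integral_slice_sub_le hΩ hb hC2 hρ h (g := fun _ => 1)
    continuousOn_const (fun _ _ => zero_le_one)
  set Q := ∫ ξ in frontier Ω, ρ ξ * 1 ∂(Measure.euclideanHausdorffMeasure (n - 1))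
  refine ⟨|Q| + |D|, by positivity, fun ε hε hεs hε1 => ?_⟩
  have h1 := hD ε hε hεs hε1
  rw [layer_eq_slice h.width_pos]
  rw [setIntegral_const, smul_eq_mul, mul_one] at h1
  have h2 := (abs_le.1 h1).2
  have h3 : D * ε ^ 2 ≤ |D| * ε := by
    have : ε ^ 2 ≤ ε := by nlinarith
    exact mul_le_mul (le_abs_self D) this (by positivity) (abs_nonneg D)
  have h4 : ε * Q ≤ |Q| * ε := by
    rw [mul_comm]; exact mul_le_mul_of_nonneg_right (le_abs_self Q) hε.le
  linarith

/-- The affine extension is a Sobolev function on `Ω ∪ Σ_ε`. -/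
theorem IsTube.memW1p_affineExtension (ht : IsTube Ω τ π d) (hΩ : IsOpen Ω)
    (hb : Bornology.IsBounded Ω) (hC2 : HasC2Boundary Ω)
    (hρ : ContDiffOn ℝ 1 ρ (frontier Ω)) (h : IsAdmissibleWidth Ω ρ τ s₀)
    (hu : ContinuousOn u (closure Ω)) (hG : ∀ x ∈ Ω, HasGradientAt u (G x) x)
    (hGc : ContinuousOn G (closure Ω)) (p : ℝ) (hε0 : 0 < ε) (hε : ε ≤ s₀)
    (hw : IsAffineExtension Ω ρ u ε w) : MemW1p (Ω ∪ layer Ω ρ ε) p w (gradient w) := by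
  obtain ⟨M, hM0, hM⟩ := ht.exists_gradient_affineExtension_bound hΩ hb hC2 hρ h hu hG hGc
  obtain ⟨hgrad, hgradΩ, hgradL⟩ := hM ε hε0 hε w hw
  have hlay := layer_eq_slice (Ω := Ω) h.width_pos ε
  have hLo : IsOpen (layer Ω ρ ε) := by
    rw [hlay]; exact ht.isOpen_slice hΩ hC2 hρ.continuousOn h le_rfl hε
  have hVo : IsOpen (Ω ∪ layer Ω ρ ε) := hΩ.union hLo
  have hVm := hVo.measurableSet
  have hVb : volume (Ω ∪ layer Ω ρ ε) < ⊤ :=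
    (hb.union (isBounded_layer hΩ hb hC2 hρ.continuousOn h.width_pos ε)).measure_lt_top
  have hfin : IsFiniteMeasure (volume.restrict (Ω ∪ layer Ω ρ ε)) := ⟨by
    rwa [Measure.restrict_apply_univ]⟩
  have hcl : IsCompact (closure Ω) := hb.isCompact_closure
  obtain ⟨Mu, hMu⟩ := hcl.exists_bound_of_continuousOn hu
  obtain ⟨MG, hMG⟩ := hcl.exists_bound_of_continuousOn hGc
  obtain ⟨Mq, hMq⟩ := (isCompact_frontier hb).exists_bound_of_continuousOn
    ((hu.mono frontier_subset_closure).abs.div hρ.continuousOn fun ξ hξ => (h.width_pos ξ hξ).ne')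
  have hwb : ∀ x ∈ Ω ∪ layer Ω ρ ε, ‖w x‖ ≤ Mu := by
    rintro x (hx | hx)
    · rw [hw.1 hx]; exact hMu x (subset_closure hx)
    · rw [hlay] at hx
      obtain ⟨hξ, hd0, hd1⟩ := ht.dist_mem h hε hx
      rw [ht.eqOn_slice h hε hw hx, affineProfile, norm_mul]
      have hp : 0 < ε * ρ (π x) := mul_pos hε0 (h.width_pos _ hξ)
      have h1 : d x / (ε * ρ (π x)) < 1 := (div_lt_one hp).2 hd1
      have h2 : 0 < d x / (ε * ρ (π x)) := by positivity
      rw [Real.norm_eq_abs (1 - _), abs_of_pos (by linarith)]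
      exact (mul_le_of_le_one_right (norm_nonneg _) (by linarith)).trans
        (hMu _ (frontier_subset_closure hξ))
  have hgb : ∀ x ∈ Ω ∪ layer Ω ρ ε, ‖gradient w x‖ ≤ max MG (ε⁻¹ * (Mq + M * ε)) := by
    rintro x (hx | hx)
    · rw [hgradΩ x hx]; exact (hMG x (subset_closure hx)).trans (le_max_left _ _)
    · refine le_trans ?_ (le_max_right _ _)
      have h1 := (abs_le.1 (hgradL x hx)).2
      rw [hlay] at hx
      have h2 := (le_abs_self _).trans (hMq _ (ht.dist_mem h hε hx).1)
      simp only [Pi.div_apply] at h2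
      rw [le_inv_mul_iff₀ hε0]
      linarith
  have hgLp : ∀ q : ℝ≥0∞, MemLp (gradient w) q (volume.restrict (Ω ∪ layer Ω ρ ε)) := fun q =>
    MemLp.of_bound (measurable_gradient w).aestronglyMeasurable _
      ((ae_restrict_mem hVm).mono fun x hx => hgb x hx)
  refine ⟨?_, hgLp _, ?_⟩
  · refine MemLp.of_bound ?_ Mu ((ae_restrict_mem hVm).mono fun x hx => hwb x hx)
    exact ContinuousOn.aestronglyMeasurable
      (fun x hx => (hgrad x hx).continuousAt.continuousWithinAt) hVm
  · refine hasWeakGradient_of_hasGradientAt hVo ?_ hgrad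
    exact IntegrableOn.locallyIntegrableOn ((hgLp 1).integrable le_rfl)

/-- The scaled energy of the affine extension in the layer. -/
theorem IsTube.exists_energy_sub_le (ht : IsTube Ω τ π d) (hΩ : IsOpen Ω)
    (hb : Bornology.IsBounded Ω) (hC2 : HasC2Boundary Ω)
    (hρ : ContDiffOn ℝ 1 ρ (frontier Ω)) (h : IsAdmissibleWidth Ω ρ τ s₀)
    (hu : ContinuousOn u (closure Ω)) (hG : ∀ x ∈ Ω, HasGradientAt u (G x) x)
    (hGc : ContinuousOn G (closure Ω)) {p : ℝ} (hp : 1 < p) :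
    ∃ D : ℝ, ∀ ε : ℝ, 0 < ε → ε ≤ s₀ → ε ≤ 1 → ∀ w, IsAffineExtension Ω ρ u ε w →
      |(∫ x in layer Ω ρ ε, ε ^ (p - 1) * ‖gradient w x‖ ^ p) -
        ∫ ξ in frontier Ω, |u ξ| ^ p / ρ ξ ^ (p - 1) ∂(Measure.euclideanHausdorffMeasure (n - 1))| ≤
        D * ε := by
  obtain ⟨M, hM0, hM⟩ := ht.exists_gradient_affineExtension_bound hΩ hb hC2 hρ h hu hG hGc
  obtain ⟨D₁, hD₁0, hD₁⟩ := ht.exists_volume_layer_le hΩ hb hC2 hρ h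
  have hp0 : 0 ≤ p := by linarith
  have hqc : ContinuousOn (fun ξ => |u ξ| / ρ ξ) (frontier Ω) :=
    (hu.mono frontier_subset_closure).abs.div hρ.continuousOn fun ξ hξ => (h.width_pos ξ hξ).ne'
  have hq0 : ∀ ξ ∈ frontier Ω, 0 ≤ |u ξ| / ρ ξ := fun ξ hξ => div_nonneg (abs_nonneg _) (h.width_pos ξ hξ).le
  have hgc : ContinuousOn (fun ξ => (|u ξ| / ρ ξ) ^ p) (frontier Ω) :=
    hqc.rpow_const fun _ _ => Or.inr hp0
  have hg0 : ∀ ξ ∈ frontier Ω, 0 ≤ (|u ξ| / ρ ξ) ^ p := fun ξ hξ => Real.rpow_nonneg (hq0 ξ hξ) p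
  obtain ⟨D₂, hD₂⟩ := ht.exists_integral_slice_sub_le hΩ hb hC2 hρ h hgc hg0
  obtain ⟨Mq, hMq⟩ := (isCompact_frontier hb).exists_bound_of_continuousOn hqc
  obtain ⟨Mg, hMg⟩ := (isCompact_frontier hb).exists_bound_of_continuousOn hgc
  -- As p > 1, t ↦ t^p is C¹; the interval contains both ε|∇w| and |u|/ρ once ε ≤ 1.
  obtain ⟨Λ, hΛ⟩ := ((Real.contDiff_rpow_const_of_le (p := p) (n := 1)
    (by exact_mod_cast hp.le)).contDiffOn (s := Icc 0 (Mq + M))).exists_lipschitzOnWith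
    (by norm_num) (convex_Icc _ _) isCompact_Icc
  have hsurf : ∫ ξ in frontier Ω, |u ξ| ^ p / ρ ξ ^ (p - 1) ∂(Measure.euclideanHausdorffMeasure (n - 1)) =
      ∫ ξ in frontier Ω, ρ ξ * (|u ξ| / ρ ξ) ^ p ∂(Measure.euclideanHausdorffMeasure (n - 1)) := by
    refine setIntegral_congr_fun isClosed_frontier.measurableSet fun ξ hξ => ?_
    have hρp := h.width_pos ξ hξ
    rw [Real.div_rpow (abs_nonneg _) hρp.le, Real.rpow_sub_one hρp.ne']
    field_simp
  refine ⟨Λ * M * D₁ + D₂, fun ε hε0 hε hε1 w hw => ?_⟩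
  obtain ⟨hgrad, hgradΩ, hgradL⟩ := hM ε hε0 hε w hw
  have hlay := layer_eq_slice (Ω := Ω) h.width_pos ε
  set S := layer Ω ρ ε with hS
  have hSo : IsOpen S := by
    rw [hlay]; exact ht.isOpen_slice hΩ hC2 hρ.continuousOn h le_rfl hε
  have hSm := hSo.measurableSet
  have hSfin : volume S < ⊤ := (isBounded_layer hΩ hb hC2 hρ.continuousOn h.width_pos ε).measure_lt_top
  have hfin : IsFiniteMeasure (volume.restrict S) := ⟨by rwa [Measure.restrict_apply_univ]⟩
  have hproj : ∀ x ∈ S, π x ∈ frontier Ω := fun x hx => by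
    rw [hlay] at hx; exact (ht.dist_mem h hε hx).1
  have hST : S ⊆ Metric.thickening τ (frontier Ω) := by
    rw [hlay]
    exact (slice_subset_cthickening hΩ hC2 h subset_rfl
      (fun r hr => ⟨hr.1.le, hr.2.le.trans hε⟩)).trans ht.cthickening_subset
  have hεg : ∀ x ∈ S, ε * ‖gradient w x‖ ∈ Icc 0 (Mq + M) ∧ |u (π x)| / ρ (π x) ∈ Icc 0 (Mq + M) := by
    intro x hx
    have h1 := (abs_le.1 (hgradL x hx)).2
    have h2 := (le_abs_self _).trans (hMq _ (hproj x hx))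
    have h3 := hq0 _ (hproj x hx)
    have h4 : M * ε ≤ M := mul_le_of_le_one_right hM0 hε1
    exact ⟨⟨by positivity, by linarith⟩, ⟨h3, by linarith⟩⟩
  have hdiff : ∀ x ∈ S, ‖(ε * ‖gradient w x‖) ^ p - (|u (π x)| / ρ (π x)) ^ p‖ ≤ Λ * (M * ε) := by
    intro x hx
    have h1 := hΛ.dist_le_mul _ (hεg x hx).1 _ (hεg x hx).2
    rw [dist_eq_norm, dist_eq_norm] at h1
    refine h1.trans ?_
    gcongr
    exact hgradL x hx
  have hint1 : IntegrableOn (fun x => (ε * ‖gradient w x‖) ^ p) S := by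
    have hmeas : AEStronglyMeasurable (fun x => (ε * ‖gradient w x‖) ^ p) (volume.restrict S) :=
      (((measurable_gradient w).norm.const_mul ε).pow_const p).aestronglyMeasurable
    refine (MemLp.of_bound (p := 1) hmeas ((Mq + M) ^ p) ?_).integrable le_rfl
    filter_upwards [ae_restrict_mem hSm] with x hx
    have h1 := (hεg x hx).1
    rw [Real.norm_eq_abs, abs_of_nonneg (Real.rpow_nonneg h1.1 p)]
    exact Real.rpow_le_rpow h1.1 h1.2 hp0
  have hint2 : IntegrableOn (fun x => (|u (π x)| / ρ (π x)) ^ p) S := by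
    have hcont : ContinuousOn (fun x => (|u (π x)| / ρ (π x)) ^ p) S :=
      hgc.comp (ht.contDiffOn_proj.continuousOn.mono hST) hproj
    refine (MemLp.of_bound (p := 1) (hcont.aestronglyMeasurable hSm) Mg ?_).integrable le_rfl
    filter_upwards [ae_restrict_mem hSm] with x hx using hMg _ (hproj x hx)
  have hscale : ∫ x in S, ε ^ (p - 1) * ‖gradient w x‖ ^ p =
      ε⁻¹ * ∫ x in S, (ε * ‖gradient w x‖) ^ p := by
    rw [← integral_const_mul]
    refine integral_congr_ae (Eventually.of_forall fun x => ?_)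
    simp only
    rw [Real.mul_rpow hε0.le (norm_nonneg _), Real.rpow_sub_one hε0.ne']
    field_simp
  have e1 : |(∫ x in S, (ε * ‖gradient w x‖) ^ p) - ∫ x in S, (|u (π x)| / ρ (π x)) ^ p| ≤
      Λ * (M * ε) * (D₁ * ε) := by
    rw [← integral_sub hint1 hint2, ← Real.norm_eq_abs]
    refine (norm_setIntegral_le_of_norm_le_const hSfin hdiff).trans ?_
    have : (0 : ℝ) ≤ Λ := Λ.2
    gcongr
    exact hD₁ ε hε0 hε hε1
  have e2 := hD₂ ε hε0 hε hε1
  rw [← hlay] at e2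
  rw [hsurf, hscale]
  set a := ∫ x in S, (ε * ‖gradient w x‖) ^ p
  set b := ∫ x in S, (|u (π x)| / ρ (π x)) ^ p
  set q := ∫ ξ in frontier Ω, ρ ξ * (|u ξ| / ρ ξ) ^ p ∂(Measure.euclideanHausdorffMeasure (n - 1))
  -- Both differences are O(ε²): the first is an O(ε) integrand over a layer of volume O(ε), the
  -- second is the tube formula. Dividing by ε leaves O(ε).
  have e3 : ε⁻¹ * a - q = ε⁻¹ * ((a - b) + (b - ε * q)) := by
    field_simp
    ring
  rw [e3, abs_mul, abs_of_pos (inv_pos.2 hε0), inv_mul_le_iff₀ hε0]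
  refine (abs_add_le _ _).trans ((add_le_add e1 e2).trans (le_of_eq ?_))
  ring

end Energy

end ThinCoating

end

/-! ### Assembly of (A) and (B) -/

theorem lemma3p3 (n : ℕ) (hn : 2 ≤ n)
    (Ω : Set (EuclideanSpace ℝ (Fin n))) (hΩ_open : IsOpen Ω) (hΩ_conn : IsConnected Ω)
    (hΩ_bdd : Bornology.IsBounded Ω) (hΩ_C2 : ThinCoating.HasC2Boundary Ω)
    (ρ : EuclideanSpace ℝ (Fin n) → ℝ) (hρ : ContDiffOn ℝ 2 ρ (frontier Ω))
    (hρ_pos : ∀ ξ ∈ frontier Ω, 0 < ρ ξ)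
    (p : ℝ) (hp : 1 < p)
    (α : ℝ≥0) (hα_pos : 0 < α) (hα_lt : α < 1)
    (u : EuclideanSpace ℝ (Fin n) → ℝ) (hu : ThinCoating.IsC1Holder Ω α u) :
    -- (A) extensions with a uniform gradient bound
    (∀ (ε₀ : ℝ) (w : ℝ → EuclideanSpace ℝ (Fin n) → ℝ)
        (G : ℝ → EuclideanSpace ℝ (Fin n) → EuclideanSpace ℝ (Fin n)) (C : ℝ),
        0 < ε₀ → 0 < C →
        (∀ ε ∈ Ioo 0 ε₀,
          EqOn (w ε) u Ω ∧
          ThinCoating.MemW1p (Ω ∪ ThinCoating.layer Ω ρ ε) p (w ε) (G ε) ∧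
          ∀ᵐ x ∂(volume.restrict (ThinCoating.layer Ω ρ ε)), ‖G ε x‖ ≤ C) →
        (fun ε : ℝ => ∫ x in ThinCoating.layer Ω ρ ε, ‖G ε x‖ ^ p)
            =O[𝓝[>] 0] (fun ε : ℝ => ε) ∧
        ∀ ε ∈ Ioo 0 ε₀,
          volume (ThinCoating.layer Ω ρ ε) < ⊤ ∧
          ∫ x in ThinCoating.layer Ω ρ ε, ‖G ε x‖ ^ p
            ≤ C ^ p * volume.real (ThinCoating.layer Ω ρ ε)) ∧
    -- (B) the affine extension exists for small `ε`
    (∀ᶠ ε in 𝓝[>] (0 : ℝ), ∃ w, ThinCoating.IsAffineExtension Ω ρ u ε w) ∧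
    IntegrableOn (fun ξ => |u ξ| ^ p / ρ ξ ^ (p - 1)) (frontier Ω)
      (Measure.euclideanHausdorffMeasure (n - 1)) ∧
    ∀ w : ℝ → EuclideanSpace ℝ (Fin n) → ℝ,
      (∀ᶠ ε in 𝓝[>] (0 : ℝ), ThinCoating.IsAffineExtension Ω ρ u ε (w ε)) →
      (∀ᶠ ε in 𝓝[>] (0 : ℝ),
        (∃ G, ThinCoating.MemW1p (Ω ∪ ThinCoating.layer Ω ρ ε) p (w ε) G) ∧
        ∀ y ∈ frontier (ThinCoating.coatedDomain Ω ρ ε),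
          Tendsto (w ε) (𝓝[ThinCoating.layer Ω ρ ε] y) (𝓝 0)) ∧
      ∀ G : ℝ → EuclideanSpace ℝ (Fin n) → EuclideanSpace ℝ (Fin n),
        (∀ᶠ ε in 𝓝[>] (0 : ℝ),
          ThinCoating.MemW1p (Ω ∪ ThinCoating.layer Ω ρ ε) p (w ε) (G ε)) →
        (fun ε : ℝ => (∫ x in ThinCoating.layer Ω ρ ε, ε ^ (p - 1) * ‖G ε x‖ ^ p) -
            ∫ ξ in frontier Ω, |u ξ| ^ p / ρ ξ ^ (p - 1)
              ∂(Measure.euclideanHausdorffMeasure (n - 1)))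
          =O[𝓝[>] 0] (fun ε : ℝ => ε) ∧
        (fun ε : ℝ => (∫ x in ThinCoating.layer Ω ρ ε, ε ^ (p - 1) * ‖G ε x‖ ^ p) -
            ∫ ξ in frontier Ω, |u ξ| ^ p / ρ ξ ^ (p - 1)
              ∂(Measure.euclideanHausdorffMeasure (n - 1)))
          =o[𝓝[>] 0] (fun _ : ℝ => (1 : ℝ)) := by
  obtain ⟨hu_cont, Gu, hGu, K, hK⟩ := hu
  have hGc : ContinuousOn Gu (closure Ω) := hK.continuousOn hα_pos
  have hρ1 : ContDiffOn ℝ 1 ρ (frontier Ω) := hρ.of_le (by norm_num)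
  obtain ⟨τ, π, d, ht⟩ := ThinCoating.exists_isTube hΩ_open hΩ_bdd hΩ_C2
  obtain ⟨s₀, hs⟩ := ThinCoating.exists_isAdmissibleWidth hΩ_bdd hρ1.continuousOn hρ_pos ht.pos
  have hsmall : ∀ᶠ ε in 𝓝[>] (0 : ℝ), 0 < ε ∧ ε ≤ s₀ ∧ ε ≤ 1 := by
    filter_upwards [Ioo_mem_nhdsGT (lt_min hs.pos one_pos)] with ε hε
    exact ⟨hε.1, hε.2.le.trans (min_le_left _ _), hε.2.le.trans (min_le_right _ _)⟩
  refine ⟨fun ε₀ w G C hε₀ hC hw => ?_, ?_, ?_, fun w hw => ⟨?_, fun G hG => ?_⟩⟩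
  · have hvol : ∀ ε : ℝ, volume (ThinCoating.layer Ω ρ ε) < ⊤ := fun ε =>
      (ThinCoating.isBounded_layer hΩ_open hΩ_bdd hΩ_C2 hρ1.continuousOn hρ_pos ε).measure_lt_top
    have hbound : ∀ ε ∈ Ioo 0 ε₀, ‖∫ x in ThinCoating.layer Ω ρ ε, ‖G ε x‖ ^ p‖ ≤
        C ^ p * volume.real (ThinCoating.layer Ω ρ ε) := by
      intro ε hε
      refine norm_setIntegral_le_of_norm_le_const_ae (hvol ε) ?_
      filter_upwards [(hw ε hε).2.2] with x hx
      rw [Real.norm_eq_abs, abs_of_nonneg (Real.rpow_nonneg (norm_nonneg _) p)]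
      exact Real.rpow_le_rpow (norm_nonneg _) hx (by linarith)
    refine ⟨?_, fun ε hε => ⟨hvol ε, (le_abs_self _).trans (hbound ε hε)⟩⟩
    obtain ⟨D, hD0, hD⟩ := ht.exists_volume_layer_le hΩ_open hΩ_bdd hΩ_C2 hρ1 hs
    refine IsBigO.of_bound (C ^ p * D) ?_
    filter_upwards [hsmall, Ioo_mem_nhdsGT hε₀] with ε hε hε'
    refine (hbound ε hε').trans ?_
    rw [Real.norm_eq_abs, abs_of_pos hε.1, mul_assoc]
    have := Real.rpow_nonneg hC.le p
    gcongr
    exact hD ε hε.1 hε.2.1 hε.2.2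
  · filter_upwards [hsmall] with ε hε
    exact ht.exists_isAffineExtension hΩ_open hΩ_C2 hs hε.2.1
  · have hcont : ContinuousOn (fun ξ => |u ξ| ^ p / ρ ξ ^ (p - 1)) (frontier Ω) := by
      refine ContinuousOn.div ?_ ?_ fun ξ hξ => (Real.rpow_pos_of_pos (hρ_pos ξ hξ) _).ne'
      · exact (hu_cont.mono frontier_subset_closure).abs.rpow_const fun _ _ => Or.inr (by linarith)
      · exact hρ1.continuousOn.rpow_const fun ξ hξ => Or.inl (hρ_pos ξ hξ).ne'
    obtain ⟨M, hM⟩ := (ThinCoating.isCompact_frontier hΩ_bdd).exists_bound_of_continuousOn hcont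
    have hΓm : MeasurableSet (frontier Ω) := isClosed_frontier.measurableSet
    exact IntegrableOn.of_bound
      (ht.euclideanHausdorffMeasure_frontier_lt_top hΩ_open hΩ_bdd hΩ_C2 hρ1 hs)
      (hcont.aestronglyMeasurable hΓm) M ((ae_restrict_mem hΓm).mono fun ξ hξ => hM ξ hξ)
  · filter_upwards [hw, hsmall] with ε hwε hε
    exact ⟨⟨_, ht.memW1p_affineExtension hΩ_open hΩ_bdd hΩ_C2 hρ1 hs hu_cont hGu hGc p hε.1 hε.2.1 hwε⟩,
      fun y hy => ht.tendsto_affineExtension hΩ_open hΩ_C2 hρ1.continuousOn hs hu_cont hε.1 hε.2.1 hwε hy⟩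
  · have hO : (fun ε : ℝ => (∫ x in ThinCoating.layer Ω ρ ε, ε ^ (p - 1) * ‖G ε x‖ ^ p) -
        ∫ ξ in frontier Ω, |u ξ| ^ p / ρ ξ ^ (p - 1)
          ∂(Measure.euclideanHausdorffMeasure (n - 1))) =O[𝓝[>] 0] (fun ε : ℝ => ε) := by
      obtain ⟨D, hD⟩ := ht.exists_energy_sub_le hΩ_open hΩ_bdd hΩ_C2 hρ1 hs hu_cont hGu hGc hp
      refine IsBigO.of_bound D ?_
      filter_upwards [hw, hsmall, hG] with ε hwε hε hGε
      have hLo : IsOpen (ThinCoating.layer Ω ρ ε) := by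
        rw [ThinCoating.layer_eq_slice hρ_pos]
        exact ht.isOpen_slice hΩ_open hΩ_C2 hρ1.continuousOn hs le_rfl hε.2.1
      -- An arbitrary weak gradient is replaced by the classical one, for which the estimate was
      -- proved.
      have hae := hGε.hasWeakGradient.ae_eq (hΩ_open.union hLo)
        (ht.memW1p_affineExtension hΩ_open hΩ_bdd hΩ_C2 hρ1 hs hu_cont hGu hGc p
          hε.1 hε.2.1 hwε).hasWeakGradient
      have hint : ∫ x in ThinCoating.layer Ω ρ ε, ε ^ (p - 1) * ‖G ε x‖ ^ p =
          ∫ x in ThinCoating.layer Ω ρ ε, ε ^ (p - 1) * ‖gradient (w ε) x‖ ^ p := by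
        refine setIntegral_congr_ae hLo.measurableSet ?_
        filter_upwards [hae] with x hx hxL
        rw [hx (Or.inr hxL)]
      rw [hint, Real.norm_eq_abs, Real.norm_eq_abs, abs_of_pos hε.1]
      exact hD ε hε.1 hε.2.1 hε.2.2 (w ε) hwε
    refine ⟨hO, hO.trans_isLittleO ?_⟩
    rw [isLittleO_one_iff]
    exact tendsto_id.mono_left nhdsWithin_le_nhds
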